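/- A continual diagram is a function $w:\mathbb R\to\mathbb R$ with $|w(s_1)-w(s_2)|\le|s_1-s_2|$ such that, for some $s_0\in\mathbb R$ (the center), $w(s)=|s-s_0|$ whenever $|s|$ is large enough. For $a<0<b$ let $\mathcal D[a,b]$ be the set of continual diagrams with center $s_0\in[a,b]$ and $w(s)=|s-s_0|$ for $s\notin[a,b]$. The charge of $w$ is $\sigma(s)=\tfrac12(w(s)-|s|)$. For $0<q<1$, $w\in\mathcal D[a,b]$ and real $x\notin[a,b]$ put $$R_w(x;q)=\frac{1-q}{1-q^x}\exp\Bigl[-\ln q^{-1}\int_a^b\frac{\sigma'(s)\,ds}{1-q^{x-s}}\Bigr].$$ Let $t_0\in\mathbb R$. For each $q\in(0,1)$ let $w(\cdot,t;q)$, $t\ge t_0$, be a family of continual diagrams that is increasing in $t$, with charge $\sigma(s,t;q)$, and suppose that it satisfies the dynamic equation: for every $t\ge t_0$, $$\int_a^b\frac{1}{1-q^{x-s}}\,\frac{\partial\sigma(s,t;q)}{\partial t}\,ds=\frac{1}{1-q^x}\exp\Bigl[-\ln q^{-1}\int_a^b\frac{1}{1-q^{x-s}}\,\frac{\partial\sigma(s,t;q)}{\partial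 s}\,ds\Bigr]\qquad(x\in\mathbb R\setminus[a,b]),$$ where $[a,b]$ is an interval, which may depend on $t$ and $q$, with $w(\cdot,t;q)\in\mathcal D[a,b]$ and $a<0<b$, and where $\frac{\partial\sigma}{\partial t}ds$ is a finite positive measure on $[a,b]$, the derivative in $t$ (one-sided at $t_0$) of $\sigma(s,t;q)\,ds$ in the sense of distributions in $s$. Suppose also that there is an interval $[a_0,b_0]$, independent of $q$, with $w(\cdot,t_0;q)\in\mathcal D[a_0,b_0]$ for all $q\in(0,1)$. Such a family is called a solution. There exist continual diagrams $\Omega(\cdot;q)$, $0<q<1$, with the following properties. 1. For every solution $w$, $$\lim_{t\to\infty}\frac1{\sqrt t}\,w\bigl(s\sqrt t,t;q^{1/\sqrt t}\bigr)=\Omega(s;q)$$ uniformly in $s\in\mathbb R$ and $q\in(0,1)$. 2. For every $q\in(0,1)$, if $\Omega(\cdot;q)\in\mathcal D[a,b]$, then for all real $x\notin[a,b]$ the number $r=R_{\Omega(\cdot;q)}(x;q)$ satisfies $$r\Bigl(1-q^{\,x-\frac{\ln q^{-1}}{1-q}\,r}\Bigr)=1-q .$$ The limiting diagram is uniquely determined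 by this: if $v\in\mathcal D[a,b]$ and $r=R_v(x;q)$ satisfies this equation for all real $x\notin[a,b]$, then $v=\Omega(\cdot;q)$. It is also uniquely determined by its $R$-function: if $v$ and $\Omega(\cdot;q)$ lie in $\mathcal D[a,b]$ and $R_v(x;q)=R_{\Omega(\cdot;q)}(x;q)$ for all real $x\notin[a,b]$, then $v=\Omega(\cdot;q)$. 3. The system of differential equations $$\frac{dy_n}{d\varsigma}=n^2\sum_{|\lambda|=n}\ \prod_{k}\frac{y_k(\varsigma)^{r_k}}{k^{r_k}\,r_k!},\qquad y_n(0)=1,\qquad n=1,2,\dots,\ \varsigma\ge0,$$ where $\lambda=(1^{r_1},2^{r_2},\dots)$ runs over the partitions of $n$, has a solution. For every $q\in(0,1)$ the diagram $\Omega(\cdot;q)$ has a Rayleigh measure $\tau$, i.e. a finite signed measure with $\tau((-\infty,s])=\tfrac12(1+\Omega'(s;q))$ for almost every $s$, and for every solution $y$ of the system $$\int q^{-ns}\,\tau(ds)=y_n(\ln^2 q),\qquad n=1,2,\dots$$ -/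

import Mathlib

open Set Filter Topology MeasureTheory
open scoped ContDiff

namespace QPlancherel

noncomputable section

/-- A continual diagram: a 1-Lipschitz function on `ℝ` that coincides with `|s - s₀|` for all
`s` with `|s|` large, where `s₀` is a real number (the center of the diagram). -/
def IsContinualDiagram (w : ℝ → ℝ) : Prop :=
  LipschitzWith 1 w ∧ ∃ s₀ L : ℝ, ∀ s, L < |s| → w s = |s - s₀|

/-- The space `𝒟[a,b]` of continual diagrams that coincide with `|s - s₀|` outside `[a,b]`, the
center `s₀` lying in `[a,b]`; as always for this space, `a < 0 < b`. -/
def InDiagramSpace (a b : ℝ) (w : ℝ → ℝ) : Prop :=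
  a < 0 ∧ 0 < b ∧ LipschitzWith 1 w ∧
    ∃ s₀ ∈ Icc a b, ∀ s, s ∉ Icc a b → w s = |s - s₀|

/-- The charge `σ(s) = (w(s) - |s|) / 2` of a diagram. It is Lipschitz, so that it is
differentiable almost everywhere. -/
def charge (w : ℝ → ℝ) (s : ℝ) : ℝ := (w s - |s|) / 2

/-- The `q`-deformed `R`-function
`R_w(x;q) = (1 - q) / (1 - q^x) * exp (- ln q⁻¹ ∫ σ'(s) / (1 - q^(x-s)) ds)` of a diagram.
For `w` in `𝒟[a,b]` the derivative `σ'` vanishes outside `[a,b]`, so that the integral over the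
line is the integral over `[a,b]`; the function is considered for real `x` outside `[a,b]`. -/
def qR (q : ℝ) (w : ℝ → ℝ) (x : ℝ) : ℝ :=
  (1 - q) / (1 - q ^ x) *
    Real.exp (-Real.log q⁻¹ * ∫ s, deriv (charge w) s / (1 - q ^ (x - s)))

/-- `μ(ds) = (∂σ(s,t)/∂t) ds` at the time `t`, for a function `σ(s,t)` defined for `t ≥ t₀`.
The derivative in `t` is taken in the sense of distributions in `s` (a one-sided derivative at
`t = t₀`), which covers densities as well as singular measures. -/
def IsTimeDerivative (t₀ : ℝ) (σ : ℝ → ℝ → ℝ) (t : ℝ) (μ : Measure ℝ) : Prop :=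
  ∀ φ : ℝ → ℝ, ContDiff ℝ ∞ φ → HasCompactSupport φ →
    HasDerivWithinAt (fun u => ∫ s, φ s * σ s u) (∫ s, φ s ∂μ) (Ici t₀) t

/-- `w(s,t)`, `t ≥ t₀`, is a continual tableau (a family of continual diagrams that increases
with `t`) satisfying for every `t ≥ t₀` the dynamic equation
`∫ (1 - q^(x-s))⁻¹ (∂σ/∂t) ds = (1 - q^x)⁻¹ exp (- ln q⁻¹ ∫ (1 - q^(x-s))⁻¹ (∂σ/∂s) ds)`
for all real `x` outside an interval `[a,b]`, which may depend on `t`, since the diagrams grow. -/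
structure SolvesDynamicEquation (q t₀ : ℝ) (w : ℝ → ℝ → ℝ) : Prop where
  increasing : ∀ s, MonotoneOn (fun t => w s t) (Ici t₀)
  equation : ∀ t, t₀ ≤ t → ∃ (a b : ℝ) (μ : Measure ℝ),
    InDiagramSpace a b (fun s => w s t) ∧
    IsFiniteMeasure μ ∧ μ (Icc a b)ᶜ = 0 ∧
    IsTimeDerivative t₀ (fun s u => charge (fun s' => w s' u) s) t μ ∧
    ∀ x, x ∉ Icc a b →
      ∫ s in Icc a b, (1 - q ^ (x - s))⁻¹ ∂μ =
        (1 - q ^ x)⁻¹ * Real.exp (-Real.log q⁻¹ *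
          ∫ s in Icc a b, (1 - q ^ (x - s))⁻¹ * deriv (charge (fun s' => w s' t)) s)

/-- The equation `r (1 - q^(x - (ln q⁻¹ / (1-q)) r)) = 1 - q`. -/
def LimitEquation (q x r : ℝ) : Prop :=
  r * (1 - q ^ (x - Real.log q⁻¹ / (1 - q) * r)) = 1 - q

/-- `τ` is the Rayleigh measure of the diagram `w`: the finite signed measure whose distribution
function is `F(s) = (1 + w'(s)) / 2`. The derivative exists for almost every `s`, and these
values determine `τ`. -/
def IsRayleighMeasure (w : ℝ → ℝ) (τ : SignedMeasure ℝ) : Prop :=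
  ∀ᵐ s, τ (Iic s) = (1 + deriv w s) / 2

/-- The `n`-th `q`-moment `∫ q^(-n s) τ(ds)` of a signed measure. -/
def qMoment (q : ℝ) (n : ℕ) (τ : SignedMeasure ℝ) : ℝ :=
  ∫ᵛ s, q ^ (-(n : ℝ) * s) ∂•τ

/-- `h_n(y) = ∑_{|λ| = n} ∏_k y_k^{r_k} / (k^{r_k} r_k!)`, the sum over the partitions
`λ = (1^{r_1}, 2^{r_2}, …)` of `n`. -/
def hPoly (n : ℕ) (y : ℕ → ℝ) : ℝ :=
  ∑ p : n.Partition, ∏ k ∈ p.parts.toFinset,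
    y k ^ p.parts.count k / ((k : ℝ) ^ p.parts.count k * (p.parts.count k).factorial)

/-- `(y_n(ς))_{n ≥ 1}` solves `dy_n/dς = n² h_n(y)` for `ς ≥ 0`, with `y_n(0) = 1`. -/
def SolvesMomentSystem (y : ℕ → ℝ → ℝ) : Prop :=
  ∀ n : ℕ, 1 ≤ n → y n 0 = 1 ∧
    ∀ ς : ℝ, 0 ≤ ς →
      HasDerivWithinAt (y n) ((n : ℝ) ^ 2 * hPoly n (fun k => y k ς)) (Ici 0) ς

end

end QPlancherel

/-! ### The kernels `kerE`, `kerK`, `kerD`, with bounds uniform in the parameter `α = ln q⁻¹`,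
including `α = 0`. -/

namespace QPlancherel

noncomputable section

/-! Put α = ln q⁻¹ and K(y) = α / (1 - e^{-αy}), with K(y) = 1/y for α = 0. Let G_t = `trG` be the
transform of the charge taken relative to the center of the diagram. Integration by parts gives R =
((1-q)/α) G. The limit equation becomes G(x) = K(x - G(x)), and the dynamic equation becomes ∫
K(x-s) μ_t(ds) = G_t(x), where μ_t = (∂σ/∂t) ds.

Convergence. Since G_t is K times the exponential of a potential of the charge, the dynamic equation
yields ∂G/∂t + G ∂G/∂x = 0, a Burgers equation. Hence G is constant along characteristics: G_T(x) =
G_{t₀}(x - (T-t₀) G_T(x)) for x in the strip 0 < Im x < π/α (`trG_characteristic`). A backward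
characteristic moves upwards because Im G < 0 inside the strip, but it cannot leave, because G is
real on the upper edge. After rescaling by √T the initial transform is K up to a factor tending to 1
and a vanishing center, so every limit satisfies G(x) = K(x - G(x)).

Uniformity in q is treated by sequences: t_n → ∞ with arbitrary q_n. For bounded α_n the areas of
the charges are bounded, the charges are Lipschitz, and a subsequence converges, possibly with α_n →
0; the limit is identified by `charge_unique`. For large α_n a bounded moment ∫ e^{-αs} σ(s) ds
forces the charges to be uniformly small. Thus two sequences of the type `IsApproxSeq` with the same
α_n are uniformly close (`IsApproxSeq.asymptotically_eq`). Both the rescaled solutions and the exact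
limiting diagrams are of this type.

Uniqueness. Far to the right on a horizontal line two solutions G of the limit equation coincide by
a contraction estimate, and then they coincide on the strip by the identity theorem. The difference
of the charges then has zero convolution with K', hence with K. Since Im K on low horizontal lines
concentrates at a point, the difference vanishes.

Existence. With G = αρ, ς = α² and z = e^{-αx} the limit equation reads z = (1 - 1/ρ) e^{-ςρ}. In
the upper half-plane the branch `xi` of ςρ - log(1 - 1/ρ) is real on a curve that meets every ray
from 0 exactly once. The image of the uniform distribution of the angle under s = `xi`/α is the
Rayleigh measure of Ω. Deforming the curve to a circle (`integral_curve_eq`) turns its moments into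
circle averages p_n of F^n, F = e^{ςρ}/(1 - 1/ρ). A residue computation gives ∑ p_n z^n / n = log ρ,
which is the limit equation.

Moments. Differentiation gives dp_n/dς = n · average(ρ F^n). The same residue computation with the
extra factor ρ shows that this average is n h_n with ∑ h_n z^n = ρ = exp ∑ p_n z^n / n. So h_n is
the complete symmetric function of the power sums p_k, which is the right-hand side of the system.
The system is triangular, hence has only one solution. -/

/-- The entire function `(1 - exp (-α y)) / α`, equal to `y` for `α = 0`. -/
def kerE (α : ℝ) (y : ℂ) : ℂ := if α = 0 then y else (1 - Complex.exp (-(α * y))) / α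

/-- The kernel `α / (1 - exp (-α y))`, equal to `1 / y` for `α = 0`. -/
def kerK (α : ℝ) (y : ℂ) : ℂ := (kerE α y)⁻¹

/-- The derivative of `kerK` with the opposite sign. -/
def kerD (α : ℝ) (y : ℂ) : ℂ := kerK α y * (kerK α y - α)

lemma mul_kerE (α : ℝ) (y : ℂ) : α * kerE α y = 1 - Complex.exp (-(α * y)) := by
  unfold kerE
  split_ifs with h
  · simp [h]
  · have : (α : ℂ) ≠ 0 := by exact_mod_cast h
    field_simp

lemma hasDerivAt_kerE (α : ℝ) (y : ℂ) : HasDerivAt (kerE α) (Complex.exp (-(α * y))) y := by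
  unfold kerE
  split_ifs with h
  · simpa [h] using hasDerivAt_id' y
  · have h1 : HasDerivAt (fun y : ℂ => -(α * y)) (-α : ℂ) y := by
      simpa using ((hasDerivAt_id' y).const_mul (α : ℂ)).fun_neg
    have h2 := ((h1.cexp).const_sub 1).div_const (α : ℂ)
    refine h2.congr_deriv ?_
    have : (α : ℂ) ≠ 0 := by exact_mod_cast h
    field_simp

lemma continuous_kerE (α : ℝ) : Continuous (kerE α) :=
  continuous_iff_continuousAt.2 fun y => (hasDerivAt_kerE α y).continuousAt

lemma kerD_eq {α : ℝ} {y : ℂ} (h : kerE α y ≠ 0) :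
    kerD α y = Complex.exp (-(α * y)) / kerE α y ^ 2 := by
  have := mul_kerE α y
  unfold kerD kerK
  field_simp
  linear_combination -this

lemma hasDerivAt_kerK {α : ℝ} {y : ℂ} (h : kerE α y ≠ 0) :
    HasDerivAt (kerK α) (-kerD α y) y := by
  rw [kerD_eq h]
  exact ((hasDerivAt_kerE α y).inv h).congr_deriv (by ring)

lemma hasDerivAt_kerD {α : ℝ} {y : ℂ} (h : kerE α y ≠ 0) :
    HasDerivAt (kerD α) (-(kerD α y * (2 * kerK α y - α))) y := by
  have h1 := hasDerivAt_kerK h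
  refine (h1.mul (h1.sub_const (α : ℂ))).congr_deriv ?_
  simp only [kerD]
  ring_nf

lemma kerE_zero (y : ℂ) : kerE 0 y = y := by simp [kerE]

lemma kerE_ne_zero_of_exp {α : ℝ} {y : ℂ} (h : Complex.exp (-(α * y)) ≠ 1) : kerE α y ≠ 0 := by
  intro h0
  have := mul_kerE α y
  rw [h0] at this
  apply h
  linear_combination this

lemma kerE_ne_zero_of_re {α : ℝ} {y : ℂ} (hy : y.re ≠ 0) : kerE α y ≠ 0 := by
  by_cases hα : α = 0
  · subst hα
    rw [kerE_zero]
    rintro rfl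
    exact hy rfl
  · apply kerE_ne_zero_of_exp
    intro h
    have := congrArg norm h
    rw [Complex.norm_exp] at this
    simp at this
    tauto

/-- For α > 0 the zeros of `kerE α` are the points 2πin/α. The bound 2π, twice the height of
`strip`, leaves room for the line α Im y = π, where the characteristics are stopped. -/
lemma kerE_ne_zero_of_im {α : ℝ} {y : ℂ} (hα : 0 ≤ α) (hy : 0 < y.im) (hy' : α * y.im < 2 * Real.pi) :
    kerE α y ≠ 0 := by
  rcases hα.eq_or_lt with rfl | hα
  · rw [kerE_zero]
    rintro rfl
    simp at hy
  · apply kerE_ne_zero_of_exp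
    intro h
    obtain ⟨n, hn⟩ := Complex.exp_eq_one_iff.1 h
    have h1 := congrArg Complex.im hn
    simp at h1
    have h2 : 0 < α * y.im := by positivity
    have h3 : (0 : ℝ) < -n := by
      by_contra! h3
      nlinarith [Real.pi_pos]
    have h4 : (-n : ℝ) < 1 := by
      by_contra! h4
      nlinarith [Real.pi_pos]
    have h5 : 0 < -n := by exact_mod_cast h3
    have h6 : -n < 1 := by exact_mod_cast h4
    omega

lemma one_add_sq_div_two_le_cosh (u : ℝ) : 1 + u ^ 2 / 2 ≤ Real.cosh u := by
  have h := Real.cosh_two_mul (u / 2)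
  have h1 := Real.cosh_sq (u / 2)
  have h2 : (u / 2) ^ 2 ≤ Real.sinh (u / 2) ^ 2 := by
    rw [sq_le_sq]
    rcases le_total 0 (u / 2) with h | h
    · rw [abs_of_nonneg h, abs_of_nonneg (Real.sinh_nonneg_iff.2 h)]
      exact Real.self_le_sinh_iff.2 h
    · rw [abs_of_nonpos h, abs_of_nonpos (Real.sinh_nonpos_iff.2 h)]
      linarith [Real.sinh_le_self_iff.2 h]
  have h3 : 2 * (u / 2) = u := by ring
  rw [h3] at h
  nlinarith

lemma cos_le_one_sub_two_mul_sq {v : ℝ} (h0 : 0 ≤ v) (h1 : v ≤ Real.pi) :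
    Real.cos v ≤ 1 - 2 * (v / Real.pi) ^ 2 := by
  have h2 := Real.mul_le_sin (x := v / 2) (by linarith) (by linarith)
  have h3 := Real.cos_two_mul' (v / 2)
  have h4 := Real.sin_sq_add_cos_sq (v / 2)
  have h5 : 2 * (v / 2) = v := by ring
  rw [h5] at h3
  have h6 : 2 / Real.pi * (v / 2) = v / Real.pi := by ring
  rw [h6] at h2
  have : 0 ≤ v / Real.pi := by positivity
  nlinarith

/-- The norm of the kernel `kerD`. -/
lemma norm_kerD_mul {α : ℝ} {y : ℂ} (h : kerE α y ≠ 0) :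
    ‖kerD α y‖ * (2 * (Real.cosh (α * y.re) - Real.cos (α * y.im))) = α ^ 2 := by
  have hE : ‖kerE α y‖ ≠ 0 := norm_ne_zero_iff.2 h
  rw [kerD_eq h, norm_div, norm_pow, Complex.norm_exp]
  have h1 : α ^ 2 * ‖kerE α y‖ ^ 2 = ‖1 - Complex.exp (-(α * y))‖ ^ 2 := by
    rw [← mul_kerE, norm_mul, mul_pow]; simp
  have h2 : ‖1 - Complex.exp (-(α * y))‖ ^ 2
      = Real.exp (-(α * y.re)) * (2 * (Real.cosh (α * y.re) - Real.cos (α * y.im))) := by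
    rw [← Complex.normSq_eq_norm_sq, Complex.normSq_apply]
    simp only [Complex.sub_re, Complex.one_re, Complex.exp_re, Complex.sub_im, Complex.one_im,
      Complex.exp_im, Complex.mul_re, Complex.mul_im, Complex.neg_re, Complex.neg_im,
      Complex.ofReal_re, Complex.ofReal_im]
    simp only [zero_mul, sub_zero, add_zero, neg_mul, Real.cos_neg, Real.sin_neg, zero_sub]
    rw [Real.cosh_eq]
    have h3 : Real.exp (-(α * y.re)) * Real.exp (α * y.re) = 1 := by
      rw [← Real.exp_add]; simp
    linear_combination (Real.exp (-(α * y.re))) ^ 2 * Real.sin_sq_add_cos_sq (α * y.im) - h3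
  have h3 : (-((α : ℂ) * y)).re = -(α * y.re) := by simp
  rw [h3]
  rw [h2] at h1
  field_simp
  linarith

/-- Quadratic lower bounds for cosh - 1 and 1 - cos make α² cancel in `norm_kerD_mul`. What remains
is an integrable majorant in Re y that does not depend on α, as needed for limits with varying α. -/
lemma norm_kerD_le {α : ℝ} {y : ℂ} (hα : 0 ≤ α) (hy : 0 < y.im) (hy' : α * y.im ≤ Real.pi) :
    ‖kerD α y‖ * (y.re ^ 2 + (2 * y.im / Real.pi) ^ 2) ≤ 1 := by
  have hE : kerE α y ≠ 0 := kerE_ne_zero_of_im hα hy (by linarith [Real.pi_pos])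
  rcases hα.eq_or_lt with rfl | hα
  · have h1 : ‖kerD 0 y‖ = (y.re ^ 2 + y.im ^ 2)⁻¹ := by
      rw [kerD_eq hE, kerE_zero]
      simp only [Complex.ofReal_zero, neg_zero, zero_mul, Complex.exp_zero, one_div, norm_inv, norm_pow]
      rw [← Complex.normSq_eq_norm_sq, Complex.normSq_apply]
      ring_nf
    rw [h1, inv_mul_le_iff₀ (by positivity)]
    have : (2 * y.im / Real.pi) ^ 2 ≤ y.im ^ 2 := by
      apply pow_le_pow_left₀ (by positivity)
      rw [div_le_iff₀ Real.pi_pos]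
      nlinarith [Real.two_le_pi]
    linarith
  · have h1 := norm_kerD_mul hE
    have h2 := one_add_sq_div_two_le_cosh (α * y.re)
    have h3 := cos_le_one_sub_two_mul_sq (v := α * y.im) (by positivity) hy'
    have h4 : α ^ 2 * (y.re ^ 2 + (2 * y.im / Real.pi) ^ 2)
        ≤ 2 * (Real.cosh (α * y.re) - Real.cos (α * y.im)) := by
      have : α ^ 2 * (y.re ^ 2 + (2 * y.im / Real.pi) ^ 2)
        = (α * y.re) ^ 2 + 4 * (α * y.im / Real.pi) ^ 2 := by ring
      rw [this]; linarith
    have h5 := mul_le_mul_of_nonneg_left h4 (norm_nonneg (kerD α y))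
    rw [h1] at h5
    have h6 : 0 < α ^ 2 := by positivity
    nlinarith

lemma norm_kerD_le_of_le_im {α η : ℝ} {y : ℂ} (hα : 0 ≤ α) (hη : 0 < η) (hy : η ≤ y.im)
    (hy' : α * y.im ≤ Real.pi) : ‖kerD α y‖ ≤ (Real.pi / (2 * η)) ^ 2 := by
  have h1 := norm_kerD_le hα (hη.trans_le hy) hy'
  have h2 : (2 * η / Real.pi) ^ 2 ≤ (2 * y.im / Real.pi) ^ 2 := by
    have := Real.pi_pos
    gcongr
  have h3 : ‖kerD α y‖ * (2 * η / Real.pi) ^ 2 ≤ 1 := by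
    nlinarith [norm_nonneg (kerD α y), sq_nonneg y.re]
  have h4 : (Real.pi / (2 * η)) ^ 2 = ((2 * η / Real.pi) ^ 2)⁻¹ := by
    rw [← inv_pow, inv_div]
  have := Real.pi_pos
  rw [h4, ← one_div, le_div_iff₀ (by positivity)]
  exact h3

/-- A bound for `kerK` in terms of a bound for `kerD`. -/
lemma norm_kerK_le {α : ℝ} {y : ℂ} (hα : 0 ≤ α) : ‖kerK α y‖ ≤ ‖kerD α y‖ + 1 + α := by
  -- Completing the square in `kerD = kerK * (kerK - α)`.
  have h1 : (kerK α y - α / 2) ^ 2 = kerD α y + (α / 2) ^ 2 := by unfold kerD; ring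
  have h2 : ‖kerK α y - α / 2‖ ^ 2 ≤ ‖kerD α y‖ + (α / 2) ^ 2 := by
    rw [← norm_pow, h1]
    refine (norm_add_le _ _).trans (le_of_eq ?_)
    congr 1
    rw [norm_pow, norm_div]
    simp [abs_of_nonneg hα]
  have h3 : ‖kerK α y‖ ≤ ‖kerK α y - α / 2‖ + α / 2 := by
    have := norm_add_le (kerK α y - α / 2) (α / 2 : ℂ)
    simpa [abs_of_nonneg hα] using this
  have h4 : ‖kerK α y - α / 2‖ ≤ ‖kerD α y‖ + 1 + α / 2 := by
    nlinarith [norm_nonneg (kerD α y), norm_nonneg (kerK α y - α / 2)]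
  linarith

/-- On a horizontal line Im K is a constant multiple of |K'|, so it plays the role of a Poisson
kernel. It is negative inside the strip and zero on the line α Im y = π; both facts drive the
argument with characteristics. -/
lemma kerK_im {α : ℝ} {y : ℂ} (hα : 0 < α) (h : kerE α y ≠ 0) :
    (kerK α y).im = -(‖kerD α y‖ * (Real.sin (α * y.im) / α)) := by
  have hE : ‖kerE α y‖ ≠ 0 := norm_ne_zero_iff.2 h
  rw [kerD_eq h, norm_div, norm_pow, Complex.norm_exp, kerK, Complex.inv_im,
    Complex.normSq_eq_norm_sq]
  have h1 : (kerE α y).im = Real.exp (-(α * y.re)) * Real.sin (α * y.im) / α := by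
    have := congrArg Complex.im (mul_kerE α y)
    simp [Complex.exp_im] at this
    rw [eq_div_iff hα.ne', mul_comm]
    exact this
  have h3 : (-((α : ℂ) * y)).re = -(α * y.re) := by simp
  rw [h3, h1]
  field_simp

lemma kerK_zero_im {y : ℂ} (h : y ≠ 0) : (kerK 0 y).im = -(‖kerD 0 y‖ * y.im) := by
  have hE : ‖y‖ ≠ 0 := norm_ne_zero_iff.2 h
  rw [kerD_eq (by rwa [kerE_zero]), kerE_zero, kerK, kerE_zero, Complex.inv_im,
    Complex.normSq_eq_norm_sq]
  simp
  field_simp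

/-- Scaling of the kernels. -/
lemma kerE_scale {α l : ℝ} (hl : 0 < l) (y : ℂ) : kerE (α / l) (l * y) = l * kerE α y := by
  have hl' : (l : ℂ) ≠ 0 := by exact_mod_cast hl.ne'
  unfold kerE
  by_cases h : α = 0
  · simp [h]
  · have h' : α / l ≠ 0 := div_ne_zero h hl.ne'
    have h'' : (α : ℂ) ≠ 0 := by exact_mod_cast h
    simp only [h, h', if_false]
    push_cast
    have : -((α : ℂ) / l * (l * y)) = -(α * y) := by field_simp
    rw [this]
    field_simp

lemma kerK_scale {α l : ℝ} (hl : 0 < l) (y : ℂ) : kerK (α / l) (l * y) = kerK α y / l := by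
  unfold kerK
  rw [kerE_scale hl]
  field_simp

lemma kerD_scale {α l : ℝ} (hl : 0 < l) (y : ℂ) : kerD (α / l) (l * y) = kerD α y / l ^ 2 := by
  unfold kerD
  rw [kerK_scale hl]
  push_cast
  field_simp

/-- Joint continuity of `kerE`, along sequences. -/
lemma tendsto_kerE {ι : Type*} {f : Filter ι} {a : ι → ℝ} {y : ι → ℂ} {α : ℝ} {z : ℂ}
    (ha : Tendsto a f (𝓝 α)) (hy : Tendsto y f (𝓝 z)) :
    Tendsto (fun n => kerE (a n) (y n)) f (𝓝 (kerE α z)) := by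
  -- The entire function (1 - e^{-u})/u removes the case distinction at α = 0: `kerE α y = y * g (α
  -- y)`.
  let g : ℂ → ℂ := dslope (fun u => 1 - Complex.exp (-u)) 0
  have hd : Differentiable ℂ (fun u : ℂ => 1 - Complex.exp (-u)) := by fun_prop
  have hg : Continuous g := by
    rw [continuous_iff_continuousAt]
    intro u
    by_cases hu : u = 0
    · rw [hu]; exact continuousAt_dslope_same.2 hd.differentiableAt
    · exact (continuousAt_dslope_of_ne hu).2 hd.continuous.continuousAt
  have key : ∀ (α : ℝ) (y : ℂ), kerE α y = y * g (α * y) := by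
    intro α y
    by_cases h : α = 0
    · subst h
      have h1 : HasDerivAt (fun u : ℂ => 1 - Complex.exp (-u)) 1 0 := by
        have := ((hasDerivAt_neg (0 : ℂ)).cexp).const_sub 1
        simpa using this
      simp only [g, Complex.ofReal_zero, zero_mul, dslope_same, kerE_zero, h1.deriv, mul_one]
    · by_cases hy : y = 0
      · simp [kerE, hy]
      · have h' : (α : ℂ) ≠ 0 := by exact_mod_cast h
        have h2 : (α : ℂ) * y ≠ 0 := mul_ne_zero h' hy
        simp only [g, kerE, h, if_false, dslope_of_ne _ h2, slope_def_field]
        simp only [neg_zero, Complex.exp_zero, sub_self, sub_zero]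
        field_simp
  simp_rw [key]
  refine hy.mul ((hg.tendsto _).comp ?_)
  exact ((Complex.continuous_ofReal.tendsto _).comp ha).mul hy

lemma tendsto_kerK {ι : Type*} {f : Filter ι} {a : ι → ℝ} {y : ι → ℂ} {α : ℝ} {z : ℂ}
    (ha : Tendsto a f (𝓝 α)) (hy : Tendsto y f (𝓝 z)) (hz : kerE α z ≠ 0) :
    Tendsto (fun n => kerK (a n) (y n)) f (𝓝 (kerK α z)) :=
  (tendsto_kerE ha hy).inv₀ hz

lemma tendsto_kerD {ι : Type*} {f : Filter ι} {a : ι → ℝ} {y : ι → ℂ} {α : ℝ} {z : ℂ}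
    (ha : Tendsto a f (𝓝 α)) (hy : Tendsto y f (𝓝 z)) (hz : kerE α z ≠ 0) :
    Tendsto (fun n => kerD (a n) (y n)) f (𝓝 (kerD α z)) := by
  have h := tendsto_kerK ha hy hz
  exact h.mul (h.sub ((Complex.continuous_ofReal.tendsto _).comp ha))

end

end QPlancherel

/-! ### Integrals of the kernels against weights, the identity theorem, and the transform `trG`. -/

namespace QPlancherel

noncomputable section

lemma measurable_kerK (α : ℝ) : Measurable (kerK α) :=
  (continuous_kerE α).measurable.inv

lemma measurable_kerD (α : ℝ) : Measurable (kerD α) :=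
  (measurable_kerK α).mul ((measurable_kerK α).sub_const _)

/-- Near `x₀` the kernel `kerK α (x - s)` is regular and bounded, uniformly in `s ∈ A`. -/
def KernelBddNear (α : ℝ) (A : Set ℝ) (x₀ : ℂ) : Prop :=
  ∃ r > 0, ∃ B, ∀ x ∈ Metric.ball x₀ r, ∀ s ∈ A, kerE α (x - s) ≠ 0 ∧ ‖kerK α (x - s)‖ ≤ B

/-- The strip `0 < Im x`, `α Im x < π`. -/
def strip (α : ℝ) : Set ℂ := {x | 0 < x.im ∧ α * x.im < Real.pi}

lemma isOpen_strip (α : ℝ) : IsOpen (strip α) :=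
  (isOpen_lt continuous_const Complex.continuous_im).inter
    (isOpen_lt (continuous_const.mul Complex.continuous_im) continuous_const)

lemma convex_strip (α : ℝ) : Convex ℝ (strip α) := by
  intro x hx y hy a b ha hb hab
  simp only [strip, mem_ofPred_eq, Complex.add_im, Complex.real_smul, Complex.mul_im,
    Complex.ofReal_re, Complex.ofReal_im, zero_mul, add_zero] at *
  rcases ha.eq_or_lt with rfl | ha
  · have : b = 1 := by linarith
    subst this; simpa using hy
  · constructor
    · have := mul_pos ha hx.1
      have := mul_nonneg hb hy.1.le
      linarith
    · have h1 := mul_lt_mul_of_pos_left hx.2 ha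
      have h2 := mul_le_mul_of_nonneg_left hy.2.le hb
      have h3 : a * Real.pi + b * Real.pi = Real.pi := by rw [← add_mul, hab, one_mul]
      nlinarith

lemma kernelBddNear_of_mem_strip {α : ℝ} (hα : 0 ≤ α) {x₀ : ℂ} (hx : x₀ ∈ strip α) :
    KernelBddNear α univ x₀ := by
  have ho : IsOpen {x : ℂ | x₀.im / 2 < x.im ∧ α * x.im < Real.pi} :=
    (isOpen_lt continuous_const Complex.continuous_im).inter
      (isOpen_lt (continuous_const.mul Complex.continuous_im) continuous_const)
  have hx0 := hx.1
  obtain ⟨r, hr, hb⟩ := Metric.isOpen_iff.1 ho x₀ ⟨by linarith, hx.2⟩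
  refine ⟨r, hr, (Real.pi / (2 * (x₀.im / 2))) ^ 2 + 1 + α, fun x hxr s _ => ?_⟩
  obtain ⟨h1, h2⟩ := hb hxr
  have him : (x - s : ℂ).im = x.im := by simp
  refine ⟨kerE_ne_zero_of_im hα (by rw [him]; linarith) (by rw [him]; linarith [Real.pi_pos]), ?_⟩
  refine (norm_kerK_le hα).trans ?_
  have := norm_kerD_le_of_le_im (y := x - s) (η := x₀.im / 2) hα (by linarith)
    (by rw [him]; exact h1.le) (by rw [him]; exact h2.le)
  linarith

/-- The segment x₀ - [a,b] is compact, so a closed thickening of it still avoids the zeros of `kerE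
α`. -/
lemma kernelBddNear_Icc {α a b : ℝ} {x₀ : ℂ} (h : ∀ s ∈ Icc a b, kerE α (x₀ - s) ≠ 0) :
    KernelBddNear α (Icc a b) x₀ := by
  have hK : IsCompact ((fun s : ℝ => x₀ - (s : ℂ)) '' Icc a b) :=
    isCompact_Icc.image (by fun_prop)
  have hU : IsOpen {y : ℂ | kerE α y ≠ 0} := isOpen_ne_fun (continuous_kerE α) continuous_const
  obtain ⟨δ, hδ, hsub⟩ := hK.exists_cthickening_subset_open hU (by
    rintro _ ⟨s, hs, rfl⟩; exact h s hs)
  have hK' := hK.cthickening (r := δ)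
  have hc : ContinuousOn (kerK α) (Metric.cthickening δ ((fun s : ℝ => x₀ - (s : ℂ)) '' Icc a b)) :=
    (continuous_kerE α).continuousOn.inv₀ fun y hy => hsub hy
  obtain ⟨B, hB⟩ := hK'.exists_bound_of_continuousOn hc
  refine ⟨δ, hδ, B, fun x hx s hs => ?_⟩
  have hmem : x - s ∈ Metric.cthickening δ ((fun s : ℝ => x₀ - (s : ℂ)) '' Icc a b) := by
    refine Metric.mem_cthickening_of_dist_le (x - s) (x₀ - s) _ _ (mem_image_of_mem _ hs) ?_
    rw [dist_sub_right]
    exact (Metric.mem_ball.1 hx).le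
  exact ⟨hsub hmem, hB _ hmem⟩

lemma norm_kerD_le_of_norm_kerK {α B : ℝ} {y : ℂ} (h : ‖kerK α y‖ ≤ B) :
    ‖kerD α y‖ ≤ B * (B + |α|) := by
  unfold kerD
  rw [norm_mul]
  have : ‖kerK α y - α‖ ≤ B + |α| := by
    refine (norm_sub_le _ _).trans ?_
    rw [Complex.norm_real, Real.norm_eq_abs]
    linarith
  have h0 := norm_nonneg (kerK α y)
  gcongr
  linarith

section ParametricIntegral

variable {α : ℝ} {A : Set ℝ} {x₀ : ℂ} {μ : Measure ℝ} {f : ℝ → ℝ}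

lemma aestronglyMeasurable_weight_mul (hf : Integrable f μ) {g : ℂ → ℂ} (hg : Measurable g)
    (x : ℂ) : AEStronglyMeasurable (fun s => (f s : ℂ) * g (x - s)) μ :=
  hf.ofReal.aestronglyMeasurable.mul
    (hg.comp (by fun_prop : Measurable fun s : ℝ => x - (s : ℂ))).aestronglyMeasurable

lemma integrable_weight_mul (hf : Integrable f μ) {g : ℂ → ℂ} (hg : Measurable g) {x : ℂ} {B : ℝ}
    (hA : ∀ᵐ s ∂μ, f s ≠ 0 → s ∈ A) (hb : ∀ s ∈ A, ‖g (x - s)‖ ≤ B) :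
    Integrable (fun s => (f s : ℂ) * g (x - s)) μ := by
  refine (hf.norm.mul_const B).mono' (aestronglyMeasurable_weight_mul hf hg x) ?_
  filter_upwards [hA] with s hs
  by_cases h : f s = 0
  · simp [h]
  · rw [norm_mul, Complex.norm_real]
    exact mul_le_mul_of_nonneg_left (hb s (hs h)) (norm_nonneg _)

lemma hasDerivAt_integral_weight_mul (hf : Integrable f μ) (hA : ∀ᵐ s ∂μ, f s ≠ 0 → s ∈ A)
    {g g' : ℂ → ℂ} (hg : Measurable g) (hg' : Measurable g') {r B B' : ℝ} (hr : 0 < r)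
    (hb : ∀ s ∈ A, ‖g (x₀ - s)‖ ≤ B)
    (hb' : ∀ x ∈ Metric.ball x₀ r, ∀ s ∈ A, ‖g' (x - s)‖ ≤ B')
    (hd : ∀ x ∈ Metric.ball x₀ r, ∀ s ∈ A, HasDerivAt g (g' (x - s)) (x - s)) :
    HasDerivAt (fun x => ∫ s, (f s : ℂ) * g (x - s) ∂μ) (∫ s, (f s : ℂ) * g' (x₀ - s) ∂μ) x₀ := by
  refine (hasDerivAt_integral_of_dominated_loc_of_deriv_le (Metric.ball_mem_nhds x₀ hr)
    (F' := fun x s => (f s : ℂ) * g' (x - s)) (bound := fun s => ‖f s‖ * B')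
    (Eventually.of_forall fun x => aestronglyMeasurable_weight_mul hf hg x)
    (integrable_weight_mul hf hg hA hb) (aestronglyMeasurable_weight_mul hf hg' x₀)
    ?_ (hf.norm.mul_const B') ?_).2
  · filter_upwards [hA] with s hs x hx
    by_cases h : f s = 0
    · simp [h]
    · rw [norm_mul, Complex.norm_real]
      exact mul_le_mul_of_nonneg_left (hb' x hx s (hs h)) (norm_nonneg _)
  · filter_upwards [hA] with s hs x hx
    by_cases h : f s = 0
    · simpa [h] using hasDerivAt_const x (0 : ℂ)
    · exact ((hd x hx s (hs h)).comp_sub_const x (s : ℂ)).const_mul (f s : ℂ)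

lemma hasDerivAt_integral_kerK (hx : KernelBddNear α A x₀) (hf : Integrable f μ)
    (hA : ∀ᵐ s ∂μ, f s ≠ 0 → s ∈ A) :
    HasDerivAt (fun x => ∫ s, (f s : ℂ) * kerK α (x - s) ∂μ)
      (-∫ s, (f s : ℂ) * kerD α (x₀ - s) ∂μ) x₀ := by
  obtain ⟨r, hr, B, h⟩ := hx
  have := hasDerivAt_integral_weight_mul (x₀ := x₀) (g := kerK α) (g' := fun y => -kerD α y)
    (B := B) (B' := B * (B + |α|)) hf hA (measurable_kerK α) (measurable_kerD α).neg hr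
    (fun s hs => (h x₀ (Metric.mem_ball_self hr) s hs).2)
    (fun x hx s hs => by rw [norm_neg]; exact norm_kerD_le_of_norm_kerK (h x hx s hs).2)
    (fun x hx s hs => hasDerivAt_kerK (h x hx s hs).1)
  refine this.congr_deriv ?_
  rw [← integral_neg]
  congr 1
  ext s
  ring

lemma norm_deriv_kerD_le {B : ℝ} {y : ℂ} (h : ‖kerK α y‖ ≤ B) :
    ‖-(kerD α y * (2 * kerK α y - α))‖ ≤ B * (B + |α|) * (2 * B + |α|) := by
  have h0 := norm_nonneg (kerK α y)
  rw [norm_neg, norm_mul]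
  have h1 := norm_kerD_le_of_norm_kerK h
  have h2 : ‖2 * kerK α y - α‖ ≤ 2 * B + |α| := by
    refine (norm_sub_le _ _).trans ?_
    rw [Complex.norm_real, Real.norm_eq_abs, norm_mul]
    simp
    linarith
  have h3 := norm_nonneg (kerD α y)
  gcongr
  linarith

lemma hasDerivAt_integral_kerD (hx : KernelBddNear α A x₀) (hf : Integrable f μ)
    (hA : ∀ᵐ s ∂μ, f s ≠ 0 → s ∈ A) :
    HasDerivAt (fun x => ∫ s, (f s : ℂ) * kerD α (x - s) ∂μ)
      (∫ s, (f s : ℂ) * -(kerD α (x₀ - s) * (2 * kerK α (x₀ - s) - α)) ∂μ) x₀ := by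
  obtain ⟨r, hr, B, h⟩ := hx
  exact hasDerivAt_integral_weight_mul (x₀ := x₀) (g := kerD α)
    (g' := fun y => -(kerD α y * (2 * kerK α y - α)))
    (B := B * (B + |α|)) (B' := B * (B + |α|) * (2 * B + |α|)) hf hA (measurable_kerD α)
    ((measurable_kerD α).mul ((measurable_const.mul (measurable_kerK α)).sub_const _)).neg hr
    (fun s hs => norm_kerD_le_of_norm_kerK (h x₀ (Metric.mem_ball_self hr) s hs).2)
    (fun x hx s hs => norm_deriv_kerD_le (h x hx s hs).2)
    (fun x hx s hs => hasDerivAt_kerD (h x hx s hs).1)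

end ParametricIntegral

/-- Identity theorem: two holomorphic functions that agree on a real segment agree. -/
lemma eqOn_of_eventually_line {U : Set ℂ} (hU : IsOpen U) (hc : IsPreconnected U) {f g : ℂ → ℂ}
    (hf : DifferentiableOn ℂ f U) (hg : DifferentiableOn ℂ g U) {x₀ : ℂ} (hx : x₀ ∈ U)
    (h : ∀ᶠ t : ℝ in 𝓝 0, f (x₀ + t) = g (x₀ + t)) : EqOn f g U := by
  refine (hf.analyticOnNhd hU).eqOn_of_preconnected_of_frequently_eq (hg.analyticOnNhd hU) hc hx ?_
  have ht : Tendsto (fun t : ℝ => x₀ + (t : ℂ)) (𝓝[≠] 0) (𝓝[≠] x₀) := by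
    refine tendsto_nhdsWithin_iff.2 ⟨?_, ?_⟩
    · have : Tendsto (fun t : ℝ => x₀ + (t : ℂ)) (𝓝 0) (𝓝 (x₀ + (0 : ℝ))) :=
        Continuous.tendsto (by fun_prop) 0
      simpa using this.mono_left nhdsWithin_le_nhds
    · filter_upwards [self_mem_nhdsWithin] with t ht
      simpa using ht
  exact ht.frequently (h.filter_mono nhdsWithin_le_nhds).frequently

/-- The transform `exp (α c) k(x - c) exp (∫ e(s) (-k')(x - s) ds)` of the charge `e` of a diagram
relative to its center `c`. -/
def trG (α c : ℝ) (e : ℝ → ℝ) (x : ℂ) : ℂ :=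
  Real.exp (α * c) * kerK α (x - c) * Complex.exp (∫ s, (e s : ℂ) * kerD α (x - s))

lemma differentiableAt_trG {α c : ℝ} {A : Set ℝ} {e : ℝ → ℝ} {x₀ : ℂ} (hx : KernelBddNear α A x₀)
    (hc : kerE α (x₀ - c) ≠ 0) (he : Integrable e) (hA : ∀ s, e s ≠ 0 → s ∈ A) :
    DifferentiableAt ℂ (trG α c e) x₀ := by
  unfold trG
  have h1 := (hasDerivAt_integral_kerD hx he (Eventually.of_forall hA)).differentiableAt
  have h2 := ((hasDerivAt_kerK hc).comp_sub_const x₀ (c : ℂ)).differentiableAt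
  exact (h2.const_mul _).mul h1.cexp

end

end QPlancherel

/-! ### Uniqueness of a charge whose transform solves the limit equation. -/

namespace QPlancherel

noncomputable section

lemma norm_kerD_le_inv_sq {α : ℝ} {y : ℂ} (hα : 0 ≤ α) (hy : 0 < y.im) (hy' : α * y.im ≤ Real.pi)
    (hr : y.re ≠ 0) : ‖kerD α y‖ ≤ (y.re ^ 2)⁻¹ := by
  have h := norm_kerD_le hα hy hy'
  have h2 : 0 < y.re ^ 2 := by positivity
  rw [← one_div, le_div_iff₀ h2]
  nlinarith [norm_nonneg (kerD α y), sq_nonneg (2 * y.im / Real.pi)]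

/-- Near the real axis the kernel is large. -/
lemma le_norm_kerD {α u h : ℝ} (hα : 0 ≤ α) (hh : 0 < h) (hαh : α * h ≤ 1) (hu : |u| ≤ h) :
    (3 * h ^ 2)⁻¹ ≤ ‖kerD α (u + h * Complex.I)‖ := by
  have him : ((u : ℂ) + h * Complex.I).im = h := by simp
  have hre : ((u : ℂ) + h * Complex.I).re = u := by simp
  have hE : kerE α (u + h * Complex.I) ≠ 0 :=
    kerE_ne_zero_of_im hα (by rw [him]; exact hh) (by rw [him]; linarith [Real.two_le_pi])
  have hu2 : u ^ 2 ≤ h ^ 2 := sq_le_sq' (by linarith [abs_le.1 hu]) (abs_le.1 hu).2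
  rcases hα.eq_or_lt with rfl | hα'
  · rw [kerD_eq hE, kerE_zero]
    simp only [Complex.ofReal_zero, neg_zero, zero_mul, Complex.exp_zero, one_div, norm_inv, norm_pow]
    rw [← Complex.normSq_eq_norm_sq, Complex.normSq_apply, him, hre]
    apply inv_anti₀ <;> nlinarith
  · have h1 := norm_kerD_mul hE
    rw [him, hre] at h1
    have h2 : Real.cosh (α * u) ≤ 1 + (α * u) ^ 2 := by
      have habs : |α * u| ≤ 1 := by
        rw [abs_mul, abs_of_pos hα']
        nlinarith
      have e1 := Real.abs_exp_sub_one_sub_id_le habs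
      have e2 := Real.abs_exp_sub_one_sub_id_le (x := -(α * u)) (by rwa [abs_neg])
      rw [Real.cosh_eq]
      nlinarith [abs_le.1 e1, abs_le.1 e2]
    have h3 := Real.one_sub_sq_div_two_le_cos (x := α * h)
    have h4 : 2 * (Real.cosh (α * u) - Real.cos (α * h)) ≤ 3 * (α * h) ^ 2 := by
      have : (α * u) ^ 2 ≤ (α * h) ^ 2 := by rw [mul_pow, mul_pow]; gcongr
      linarith
    have h5 := mul_le_mul_of_nonneg_left h4 (norm_nonneg (kerD α (u + h * Complex.I)))
    rw [h1] at h5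
    rw [← one_div, div_le_iff₀ (by positivity)]
    have h6 : 0 < α ^ 2 := by positivity
    have h7 : α ^ 2 * 1 ≤ α ^ 2 * (‖kerD α (u + h * Complex.I)‖ * (3 * h ^ 2)) := by linarith
    exact le_of_mul_le_mul_left h7 h6

lemma measurable_norm_kerD_line (α h ξ : ℝ) :
    Measurable fun s : ℝ => ‖kerD α ((ξ - s : ℝ) + h * Complex.I)‖ :=
  ((measurable_kerD α).comp (by fun_prop)).norm

lemma integrable_mul_norm_kerD {α h : ℝ} (hα : 0 ≤ α) (hh : 0 < h) (hαh : α * h ≤ Real.pi)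
    {f : ℝ → ℝ} (hf : Integrable f) (ξ : ℝ) :
    Integrable fun s => f s * ‖kerD α ((ξ - s : ℝ) + h * Complex.I)‖ := by
  refine (hf.norm.mul_const ((Real.pi / (2 * h)) ^ 2)).mono'
    (hf.aestronglyMeasurable.mul (measurable_norm_kerD_line α h ξ).aestronglyMeasurable) ?_
  refine Eventually.of_forall fun s => ?_
  rw [norm_mul, norm_norm]
  refine mul_le_mul_of_nonneg_left ?_ (norm_nonneg _)
  exact norm_kerD_le_of_le_im hα hh (by simp) (by simpa using hαh)

/-- As h → 0 the kernel |K'(· + ih)| has mass of order at least 1/h on an interval of length 2h, and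
stays bounded by δ⁻² at distance δ. If f(ξ) were positive, the neighborhood of ξ would dominate and
the integral could not vanish. -/
lemma nonpos_of_integral_mul_norm_kerD {α : ℝ} (hα : 0 ≤ α) {f : ℝ → ℝ} (hf : Integrable f)
    (hc : Continuous f)
    (h0 : ∀ h ξ : ℝ, 0 < h → α * h < Real.pi →
      ∫ s, f s * ‖kerD α ((ξ - s : ℝ) + h * Complex.I)‖ = 0) (ξ : ℝ) : f ξ ≤ 0 := by
  by_contra! hpos
  obtain ⟨c, hc0, hcf⟩ : ∃ c, 0 < c ∧ c < f ξ := exists_between hpos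
  obtain ⟨δ, hδ, hball⟩ := Metric.eventually_nhds_iff_ball.1
    ((hc.tendsto ξ).eventually (lt_mem_nhds hcf))
  set M := ∫ s, |f s| with hM
  have hM0 : 0 ≤ M := integral_nonneg fun s => abs_nonneg _
  -- The left side is the length 2h times c times the lower bound 1/(3h²) of `le_norm_kerD`; it
  -- explodes as h → 0 while the right side is fixed.
  have key : ∀ h : ℝ, 0 < h → α * h ≤ 1 → h < δ → c * (2 / (3 * h)) ≤ M * (δ ^ 2)⁻¹ := by
    intro h hh hαh hhδ
    have hαπ : α * h < Real.pi := by linarith [Real.two_le_pi]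
    have h1 := h0 h ξ hh hαπ
    have hint := integrable_mul_norm_kerD hα hh hαπ.le hf ξ
    have hle : ∀ s, (Icc (ξ - h) (ξ + h)).indicator (fun _ => c * (3 * h ^ 2)⁻¹) s
        - |f s| * (δ ^ 2)⁻¹ ≤ f s * ‖kerD α ((ξ - s : ℝ) + h * Complex.I)‖ := by
      intro s
      have hP := norm_nonneg (kerD α ((ξ - s : ℝ) + h * Complex.I))
      have hn : 0 ≤ |f s| * (δ ^ 2)⁻¹ := by positivity
      by_cases hs : s ∈ Icc (ξ - h) (ξ + h)
      · rw [indicator_of_mem hs]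
        have habs : |ξ - s| ≤ h := by rw [abs_le]; constructor <;> linarith [hs.1, hs.2]
        have h2 := le_norm_kerD (u := ξ - s) hα hh hαh habs
        have h3 : c < f s := hball s (by
          rw [Metric.mem_ball, dist_comm, Real.dist_eq]; linarith)
        have h4 : c * (3 * h ^ 2)⁻¹ ≤ f s * ‖kerD α ((ξ - s : ℝ) + h * Complex.I)‖ :=
          mul_le_mul h3.le h2 (by positivity) (hc0.le.trans h3.le)
        linarith
      · rw [indicator_of_notMem hs]
        by_cases hsδ : |ξ - s| < δ
        · have h3 : c < f s := hball s (by rw [Metric.mem_ball, dist_comm, Real.dist_eq]; exact hsδ)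
          have : 0 ≤ f s * ‖kerD α ((ξ - s : ℝ) + h * Complex.I)‖ :=
            mul_nonneg (hc0.le.trans h3.le) hP
          linarith
        · push Not at hsδ
          have hne : ξ - s ≠ 0 := by
            intro h; rw [h, abs_zero] at hsδ; linarith
          have h2 := norm_kerD_le_inv_sq (y := (ξ - s : ℝ) + h * Complex.I) hα (by simpa using hh)
            (by simpa using hαπ.le) (by simpa using hne)
          have h5 : (((ξ - s : ℝ) + h * Complex.I : ℂ).re ^ 2)⁻¹ ≤ (δ ^ 2)⁻¹ := by
            apply inv_anti₀ (by positivity)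
            have : ((ξ - s : ℝ) + h * Complex.I : ℂ).re = ξ - s := by simp
            rw [this, ← sq_abs (ξ - s)]
            gcongr
          have h6 : |f s| * ‖kerD α ((ξ - s : ℝ) + h * Complex.I)‖ ≤ |f s| * (δ ^ 2)⁻¹ :=
            mul_le_mul_of_nonneg_left (h2.trans h5) (abs_nonneg _)
          have h7 : -(|f s| * ‖kerD α ((ξ - s : ℝ) + h * Complex.I)‖)
              ≤ f s * ‖kerD α ((ξ - s : ℝ) + h * Complex.I)‖ := by
            rw [← neg_mul]; exact mul_le_mul_of_nonneg_right (neg_abs_le _) hP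
          linarith
    have hi1 : Integrable ((Icc (ξ - h) (ξ + h)).indicator (fun _ => c * (3 * h ^ 2)⁻¹)) := by
      rw [integrable_indicator_iff measurableSet_Icc]
      exact integrableOn_const (by simp) (by finiteness)
    have hi2 : Integrable fun s => |f s| * (δ ^ 2)⁻¹ := hf.abs.mul_const _
    have := integral_mono (hi1.sub hi2) hint hle
    rw [h1] at this
    simp only [Pi.sub_apply] at this
    have hI : ∫ s, |f s| * (δ ^ 2)⁻¹ = M * (δ ^ 2)⁻¹ := integral_mul_const _ _
    rw [integral_sub hi1 hi2, integral_indicator measurableSet_Icc, setIntegral_const, hI] at this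
    simp only [measureReal_def, Real.volume_Icc, smul_eq_mul] at this
    rw [ENNReal.toReal_ofReal (by linarith)] at this
    have h9 : c * (2 / (3 * h)) = (ξ + h - (ξ - h)) * (c * (3 * h ^ 2)⁻¹) := by
      field_simp; ring
    rw [h9]
    linarith
  have hlim : Tendsto (fun h : ℝ => c * (2 / (3 * h))) (𝓝[>] 0) atTop := by
    have : Tendsto (fun h : ℝ => (c * 2 / 3) * h⁻¹) (𝓝[>] 0) atTop :=
      tendsto_inv_nhdsGT_zero.const_mul_atTop (by positivity)
    refine this.congr fun h => ?_
    rw [mul_div_assoc', mul_comm 3 h, div_mul_eq_div_div_swap, div_eq_mul_inv (c * 2 / 3)]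
  have hsmall : ∀ᶠ h : ℝ in 𝓝[>] 0, 0 < h ∧ α * h ≤ 1 ∧ h < δ := by
    have e1 : ∀ᶠ h : ℝ in 𝓝[>] 0, α * h < 1 := by
      have : Tendsto (fun h : ℝ => α * h) (𝓝[>] 0) (𝓝 (α * 0)) :=
        ((continuous_const.mul continuous_id).tendsto 0).mono_left nhdsWithin_le_nhds
      exact this.eventually (gt_mem_nhds (by simp))
    have e2 : ∀ᶠ h : ℝ in 𝓝[>] 0, h < δ := nhdsWithin_le_nhds (gt_mem_nhds hδ)
    filter_upwards [e1, e2, self_mem_nhdsWithin] with h h1 h2 h3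
    exact ⟨h3, h1.le, h2⟩
  obtain ⟨h, ⟨ha, hb, hc'⟩, hd⟩ := (hsmall.and (hlim.eventually (eventually_gt_atTop _))).exists
  exact absurd (key h ha hb hc') (not_le.2 hd)

lemma tendsto_norm_line {l : Filter ℝ} (h : ℝ) (hl : Tendsto (fun ξ : ℝ => |ξ|) l atTop) :
    Tendsto (fun ξ : ℝ => ‖(ξ + h * Complex.I : ℂ)‖) l atTop := by
  refine tendsto_atTop_mono (fun ξ => ?_) hl
  have := Complex.abs_re_le_norm (ξ + h * Complex.I)
  simpa using this

/-- The kernel at the right end of a horizontal line. -/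
lemma tendsto_kerK_line_atTop {α : ℝ} (hα : 0 ≤ α) (h : ℝ) :
    Tendsto (fun ξ : ℝ => kerK α (ξ + h * Complex.I)) atTop (𝓝 α) := by
  rcases hα.eq_or_lt with rfl | hα
  · rw [Complex.ofReal_zero, tendsto_zero_iff_norm_tendsto_zero]
    simp only [kerK, kerE_zero, norm_inv]
    exact (tendsto_norm_line h tendsto_abs_atTop_atTop).inv_tendsto_atTop
  · have hα' : (α : ℂ) ≠ 0 := by exact_mod_cast hα.ne'
    have h1 : Tendsto (fun ξ : ℝ => Complex.exp (-(α * (ξ + h * Complex.I)))) atTop (𝓝 0) := by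
      rw [tendsto_zero_iff_norm_tendsto_zero]
      simp only [Complex.norm_exp]
      refine Real.tendsto_exp_atBot.comp ?_
      simp only [Complex.neg_re, Complex.mul_re, Complex.ofReal_re, Complex.add_re, Complex.ofReal_im,
        Complex.I_re, Complex.I_im, mul_zero, mul_one, sub_self, add_zero, zero_mul, sub_zero]
      exact tendsto_neg_atTop_atBot.comp (tendsto_id.const_mul_atTop hα)
    have h2 : Tendsto (fun ξ : ℝ => kerE α (ξ + h * Complex.I)) atTop (𝓝 ((1 - 0) / α)) := by
      simp only [kerE, hα.ne', if_false]
      exact (h1.const_sub 1).div_const _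
    have h3 := h2.inv₀ (by simp [hα'])
    simpa [kerK] using h3

/-- The kernel at the left end of a horizontal line. -/
lemma tendsto_kerK_line_atBot {α : ℝ} (hα : 0 ≤ α) (h : ℝ) :
    Tendsto (fun ξ : ℝ => kerK α (ξ + h * Complex.I)) atBot (𝓝 0) := by
  rw [tendsto_zero_iff_norm_tendsto_zero]
  simp only [kerK, norm_inv]
  refine Tendsto.inv_tendsto_atTop ?_
  rcases hα.eq_or_lt with rfl | hα
  · simp only [kerE_zero]
    exact tendsto_norm_line h tendsto_abs_atBot_atTop
  · have h1 : Tendsto (fun ξ : ℝ => (Real.exp (-(α * ξ)) - 1) / α) atBot atTop := by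
      refine Tendsto.atTop_div_const hα (tendsto_atTop_add_const_right _ _ ?_)
      refine Real.tendsto_exp_atTop.comp ?_
      exact tendsto_neg_atBot_atTop.comp (tendsto_id.const_mul_atBot hα)
    refine tendsto_atTop_mono (fun ξ => ?_) h1
    simp only [kerE, hα.ne', if_false, norm_div, Complex.norm_real, Real.norm_eq_abs, abs_of_pos hα]
    gcongr
    have h2 := norm_sub_norm_le (Complex.exp (-(α * (ξ + h * Complex.I)))) 1
    rw [norm_sub_rev, Complex.norm_exp] at h2
    simpa using h2

lemma tendsto_integral_mul_line {l : Filter ℝ} [l.IsCountablyGenerated] {f : ℝ → ℝ}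
    (hf : Integrable f) {g : ℂ → ℂ} (hg : Measurable g) {h B : ℝ}
    (hb : ∀ ξ : ℝ, ‖g (ξ + h * Complex.I)‖ ≤ B)
    (hlim : ∀ s : ℝ, Tendsto (fun ξ : ℝ => g ((ξ - s : ℝ) + h * Complex.I)) l (𝓝 0)) :
    Tendsto (fun ξ : ℝ => ∫ s, (f s : ℂ) * g (ξ + h * Complex.I - s)) l (𝓝 0) := by
  have hrw : ∀ ξ s : ℝ, (ξ + h * Complex.I - s : ℂ) = (ξ - s : ℝ) + h * Complex.I := by
    intro ξ s; push_cast; ring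
  have := tendsto_integral_filter_of_dominated_convergence (l := l) (μ := volume)
    (F := fun ξ s => (f s : ℂ) * g (ξ + h * Complex.I - s)) (f := fun s => (f s : ℂ) * 0)
    (fun s => ‖f s‖ * B)
    (Eventually.of_forall fun ξ => aestronglyMeasurable_weight_mul hf hg _)
    (Eventually.of_forall fun ξ => Eventually.of_forall fun s => by
      rw [norm_mul, Complex.norm_real, hrw]
      exact mul_le_mul_of_nonneg_left (hb _) (norm_nonneg _))
    (hf.norm.mul_const B)
    (Eventually.of_forall fun s => by
      simp_rw [hrw]
      exact (hlim s).const_mul _)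
  simpa using this

lemma tendsto_sub_const_atTop (s : ℝ) : Tendsto (fun ξ : ℝ => ξ - s) atTop atTop :=
  tendsto_atTop_add_const_right _ _ tendsto_id

lemma tendsto_sub_const_atBot (s : ℝ) : Tendsto (fun ξ : ℝ => ξ - s) atBot atBot :=
  tendsto_atBot_add_const_right _ _ tendsto_id

lemma tendsto_integral_kerD_line_atTop {α h : ℝ} (hα : 0 ≤ α) (hh : 0 < h) (hαh : α * h < Real.pi)
    {f : ℝ → ℝ} (hf : Integrable f) :
    Tendsto (fun ξ : ℝ => ∫ s, (f s : ℂ) * kerD α (ξ + h * Complex.I - s)) atTop (𝓝 0) := by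
  refine tendsto_integral_mul_line hf (measurable_kerD α) (B := (Real.pi / (2 * h)) ^ 2)
    (fun ξ => norm_kerD_le_of_le_im hα hh (by simp) (by simpa using hαh.le)) fun s => ?_
  have h1 := (tendsto_kerK_line_atTop hα h).comp (tendsto_sub_const_atTop s)
  have h2 := h1.mul (h1.sub_const (α : ℂ))
  simpa [kerD, Function.comp_def] using h2

lemma tendsto_integral_kerK_line_atBot {α h : ℝ} (hα : 0 ≤ α) (hh : 0 < h) (hαh : α * h < Real.pi)
    {f : ℝ → ℝ} (hf : Integrable f) :
    Tendsto (fun ξ : ℝ => ∫ s, (f s : ℂ) * kerK α (ξ + h * Complex.I - s)) atBot (𝓝 0) := by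
  refine tendsto_integral_mul_line hf (measurable_kerK α) (B := (Real.pi / (2 * h)) ^ 2 + 1 + α)
    (fun ξ => ?_) fun s => (tendsto_kerK_line_atBot hα h).comp (tendsto_sub_const_atBot s)
  have := norm_kerD_le_of_le_im (y := ξ + h * Complex.I) hα hh (by simp) (by simpa using hαh.le)
  linarith [norm_kerK_le (y := ξ + h * Complex.I) hα]

lemma norm_kerE_sub_le {α m : ℝ} (hα : 0 ≤ α) {y z : ℂ} (hy : m ≤ y.re) (hz : m ≤ z.re) :
    ‖kerE α y - kerE α z‖ ≤ Real.exp (-(α * m)) * ‖y - z‖ := by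
  have hconv : Convex ℝ {y : ℂ | m ≤ y.re} := convex_halfSpace_re_ge m
  refine hconv.norm_image_sub_le_of_norm_hasDerivWithin_le
    (fun x _ => (hasDerivAt_kerE α x).hasDerivWithinAt) (fun x hx => ?_) hz hy
  rw [Complex.norm_exp]
  simp only [Complex.neg_re, Complex.mul_re, Complex.ofReal_re, Complex.ofReal_im, zero_mul, sub_zero]
  apply Real.exp_le_exp.2
  have hx' : m ≤ x.re := hx
  nlinarith

/-- Two transforms that solve the limit equation agree far to the right on a horizontal line. -/
lemma eventually_trG_eq {α h : ℝ} (hα : 0 ≤ α) {g₁ g₂ : ℝ → ℂ}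
    (hg₁ : Tendsto g₁ atTop (𝓝 α)) (hg₂ : Tendsto g₂ atTop (𝓝 α))
    (h₁ : ∀ ξ : ℝ, g₁ ξ * kerE α (ξ + h * Complex.I - g₁ ξ) = 1)
    (h₂ : ∀ ξ : ℝ, g₂ ξ * kerE α (ξ + h * Complex.I - g₂ ξ) = 1) :
    ∀ᶠ ξ in atTop, g₁ ξ = g₂ ξ := by
  have hb : ∀ {g : ℝ → ℂ}, Tendsto g atTop (𝓝 α) → ∀ᶠ ξ in atTop, ‖g ξ‖ < α + 1 := by
    intro g hg
    refine hg.norm.eventually (gt_mem_nhds ?_)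
    rw [Complex.norm_real, Real.norm_eq_abs, abs_of_nonneg hα]; linarith
  -- This contraction factor tends to 0 for different reasons: for α = 0 because g₁ and g₂ do, for α
  -- > 0 because the exponential does.
  have hlim : Tendsto (fun ξ : ℝ => ‖g₁ ξ * g₂ ξ‖ * Real.exp (-(α * (ξ - (α + 1))))) atTop (𝓝 0) := by
    have h12 := (hg₁.mul hg₂).norm
    rcases hα.eq_or_lt with rfl | hα'
    · simpa using h12
    · have : Tendsto (fun ξ : ℝ => Real.exp (-(α * (ξ - (α + 1))))) atTop (𝓝 0) :=
        Real.tendsto_exp_atBot.comp (tendsto_neg_atTop_atBot.comp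
          ((tendsto_sub_const_atTop _).const_mul_atTop hα'))
      simpa using h12.mul this
  filter_upwards [hb hg₁, hb hg₂, hlim.eventually (gt_mem_nhds one_pos)] with ξ b1 b2 b3
  have hre : ∀ {z : ℂ}, ‖z‖ < α + 1 → ξ - (α + 1) ≤ (ξ + h * Complex.I - z : ℂ).re := by
    intro z hz
    have := (abs_le.1 (Complex.abs_re_le_norm z)).2
    simp
    linarith
  have hE := norm_kerE_sub_le hα (hre b1) (hre b2)
  have hkey : g₂ ξ - g₁ ξ = g₁ ξ * g₂ ξ * (kerE α (ξ + h * Complex.I - g₁ ξ)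
      - kerE α (ξ + h * Complex.I - g₂ ξ)) := by
    linear_combination g₁ ξ * h₂ ξ - g₂ ξ * h₁ ξ
  have hnorm : ‖g₂ ξ - g₁ ξ‖ ≤ ‖g₁ ξ * g₂ ξ‖ * Real.exp (-(α * (ξ - (α + 1)))) * ‖g₂ ξ - g₁ ξ‖ := by
    calc ‖g₂ ξ - g₁ ξ‖ = ‖g₁ ξ * g₂ ξ‖ * ‖kerE α (ξ + h * Complex.I - g₁ ξ)
      - kerE α (ξ + h * Complex.I - g₂ ξ)‖ := by rw [← norm_mul, ← hkey]
      _ ≤ ‖g₁ ξ * g₂ ξ‖ * (Real.exp (-(α * (ξ - (α + 1)))) * ‖g₂ ξ - g₁ ξ‖) := by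
        gcongr
        have : ξ + h * Complex.I - g₁ ξ - (ξ + h * Complex.I - g₂ ξ) = g₂ ξ - g₁ ξ := by ring
        rwa [this] at hE
      _ = _ := by ring
  have h0 : ‖g₂ ξ - g₁ ξ‖ = 0 := by
    by_contra hne
    have : 0 < ‖g₂ ξ - g₁ ξ‖ := lt_of_le_of_ne (norm_nonneg _) (Ne.symm hne)
    nlinarith
  exact (sub_eq_zero.1 (norm_eq_zero.1 h0)).symm

/-- The charge is determined by the integrals `∫ f(s) k'(x - s) ds`, `x` in the strip. -/
lemma eq_zero_of_integral_kerD_eq_zero {α : ℝ} (hα : 0 ≤ α) {f : ℝ → ℝ} (hf : Integrable f)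
    (hc : Continuous f) (h0 : ∀ x ∈ strip α, ∫ s, (f s : ℂ) * kerD α (x - s) = 0) (ξ : ℝ) :
    f ξ = 0 := by
  -- The hypothesis says that the convolution with `kerK` has zero derivative along each horizontal
  -- line. The constant is 0 because `kerK` vanishes at the left end, unlike at the right end, where
  -- its limit is α.
  have hJ : ∀ h ξ : ℝ, 0 < h → α * h < Real.pi →
      ∫ s, (f s : ℂ) * kerK α (ξ + h * Complex.I - s) = 0 := by
    intro h ξ hh hαh
    have hmem : ∀ ξ : ℝ, (ξ + h * Complex.I : ℂ) ∈ strip α := fun ξ => by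
      constructor <;> simpa
    set J : ℝ → ℂ := fun ξ => ∫ s, (f s : ℂ) * kerK α (ξ + h * Complex.I - s) with hJdef
    have hd : ∀ ξ : ℝ, HasDerivAt J 0 ξ := by
      intro ξ
      have h1 := hasDerivAt_integral_kerK (kernelBddNear_of_mem_strip hα (hmem ξ)) hf
        (Eventually.of_forall fun s _ => mem_univ s)
      rw [h0 _ (hmem ξ), neg_zero] at h1
      have h2 : HasDerivAt (fun z : ℂ => z + h * Complex.I) 1 (ξ : ℂ) :=
        (hasDerivAt_id' _).add_const _
      have h3 := (HasDerivAt.comp (ξ : ℂ) h1 h2).comp_ofReal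
      simpa using h3
    have hconst : ∀ x y, J x = J y := is_const_of_deriv_eq_zero
      (fun x => (hd x).differentiableAt) (fun x => (hd x).deriv)
    have hlim := tendsto_integral_kerK_line_atBot hα hh hαh hf
    have hlim2 : Tendsto J atBot (𝓝 (J ξ)) := by
      have : J = fun _ => J ξ := funext fun x => hconst x ξ
      rw [this]; exact tendsto_const_nhds
    exact tendsto_nhds_unique hlim2 hlim
  have hP : ∀ h ξ : ℝ, 0 < h → α * h < Real.pi →
      ∫ s, f s * ‖kerD α ((ξ - s : ℝ) + h * Complex.I)‖ = 0 := by
    intro h ξ hh hαh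
    have h1 := hJ h ξ hh hαh
    have hmem : (ξ + h * Complex.I : ℂ) ∈ strip α := by constructor <;> simpa
    obtain ⟨r, hr, B, hB⟩ := kernelBddNear_of_mem_strip hα hmem
    have hint : Integrable fun s => (f s : ℂ) * kerK α (ξ + h * Complex.I - s) :=
      integrable_weight_mul hf (measurable_kerK α) (A := univ)
        (Eventually.of_forall fun s _ => mem_univ s)
        (fun s hs => (hB _ (Metric.mem_ball_self hr) s hs).2)
    have h2 : ∫ s, ((f s : ℂ) * kerK α (ξ + h * Complex.I - s)).im = 0 := by
      have := integral_im hint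
      rw [h1] at this
      simpa using this
    -- On the line Im y = h the imaginary part of `kerK` is a fixed negative multiple of |`kerD`|,
    -- with m = sin(αh)/α, or m = h for α = 0.
    obtain ⟨m, hm, him⟩ : ∃ m : ℝ, 0 < m ∧ ∀ y : ℂ, y.im = h →
        (kerK α y).im = -(‖kerD α y‖ * m) := by
      rcases hα.eq_or_lt with rfl | hα'
      · refine ⟨h, hh, fun y hy => ?_⟩
        rw [kerK_zero_im (by rintro rfl; simp at hy; linarith), hy]
      · refine ⟨Real.sin (α * h) / α, div_pos (Real.sin_pos_of_pos_of_lt_pi (by positivity) hαh) hα',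
          fun y hy => ?_⟩
        rw [kerK_im hα' (kerE_ne_zero_of_im hα (by rwa [hy]) (by rw [hy]; linarith [Real.pi_pos])), hy]
    have h3 : ∀ s : ℝ, ((f s : ℂ) * kerK α (ξ + h * Complex.I - s)).im
        = -m * (f s * ‖kerD α ((ξ - s : ℝ) + h * Complex.I)‖) := by
      intro s
      have hrw : (ξ + h * Complex.I - s : ℂ) = (ξ - s : ℝ) + h * Complex.I := by push_cast; ring
      rw [Complex.im_ofReal_mul, hrw, him _ (by simp)]
      ring
    simp_rw [h3] at h2
    rw [integral_const_mul] at h2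
    rcases mul_eq_zero.1 h2 with h | h
    · linarith
    · exact h
  have h1 := nonpos_of_integral_mul_norm_kerD hα hf hc hP ξ
  have h2 := nonpos_of_integral_mul_norm_kerD hα hf.neg hc.neg (fun h ξ hh hαh => by
    simp only [Pi.neg_apply, neg_mul, integral_neg, hP h ξ hh hαh, neg_zero]) ξ
  simp only [Pi.neg_apply] at h2
  linarith

/-- Uniqueness: a charge whose transform solves the limit equation on the strip is unique. -/
theorem charge_unique {α : ℝ} (hα : 0 ≤ α) {e₁ e₂ : ℝ → ℝ} (hi₁ : Integrable e₁)
    (hi₂ : Integrable e₂) (hc₁ : Continuous e₁) (hc₂ : Continuous e₂)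
    (h₁ : ∀ x ∈ strip α, trG α 0 e₁ x * kerE α (x - trG α 0 e₁ x) = 1)
    (h₂ : ∀ x ∈ strip α, trG α 0 e₂ x * kerE α (x - trG α 0 e₂ x) = 1) : e₁ = e₂ := by
  obtain ⟨h, hh, hαh⟩ : ∃ h : ℝ, 0 < h ∧ α * h < Real.pi := by
    refine ⟨(α + 1)⁻¹, by positivity, ?_⟩
    rw [← div_eq_mul_inv, div_lt_iff₀ (by positivity)]
    nlinarith [Real.two_le_pi]
  have hmem : ∀ ξ : ℝ, (ξ + h * Complex.I : ℂ) ∈ strip α := fun ξ => by constructor <;> simpa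
  have hlim : ∀ {e : ℝ → ℝ}, Integrable e →
      Tendsto (fun ξ : ℝ => trG α 0 e (ξ + h * Complex.I)) atTop (𝓝 α) := by
    intro e he
    have h1 := (tendsto_kerK_line_atTop hα h).mul (tendsto_integral_kerD_line_atTop hα hh hαh he).cexp
    simpa [trG] using h1
  have hev := eventually_trG_eq hα (hlim hi₁) (hlim hi₂) (fun ξ => h₁ _ (hmem ξ))
    (fun ξ => h₂ _ (hmem ξ))
  have hi : Integrable (fun s => e₁ s - e₂ s) := hi₁.sub hi₂
  have hsub : ∀ x ∈ strip α, ∫ s, ((e₁ s - e₂ s : ℝ) : ℂ) * kerD α (x - s)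
      = (∫ s, (e₁ s : ℂ) * kerD α (x - s)) - ∫ s, (e₂ s : ℂ) * kerD α (x - s) := by
    intro x hx
    obtain ⟨r, hr, B, hB⟩ := kernelBddNear_of_mem_strip hα hx
    have hb : ∀ s ∈ (univ : Set ℝ), ‖kerD α (x - s)‖ ≤ B * (B + |α|) := fun s hs =>
      norm_kerD_le_of_norm_kerK (hB _ (Metric.mem_ball_self hr) s hs).2
    rw [← integral_sub (integrable_weight_mul hi₁ (measurable_kerD α)
        (Eventually.of_forall fun s _ => mem_univ s) hb)
      (integrable_weight_mul hi₂ (measurable_kerD α)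
        (Eventually.of_forall fun s _ => mem_univ s) hb)]
    congr 1
    ext s
    push_cast
    ring
  have hzero : ∀ᶠ ξ : ℝ in atTop,
      ∫ s, ((e₁ s - e₂ s : ℝ) : ℂ) * kerD α (ξ + h * Complex.I - s) = 0 := by
    have hl := (tendsto_integral_kerD_line_atTop hα hh hαh hi).norm
    rw [norm_zero] at hl
    filter_upwards [hev, hl.eventually (gt_mem_nhds one_pos)] with ξ h1 h2
    have hK : kerK α (ξ + h * Complex.I) ≠ 0 := by
      refine inv_ne_zero (kerE_ne_zero_of_im hα (by simpa using hh) ?_)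
      have : α * (ξ + h * Complex.I : ℂ).im = α * h := by simp
      rw [this]; linarith [Real.pi_pos]
    have h3 : Complex.exp (∫ s, (e₁ s : ℂ) * kerD α (ξ + h * Complex.I - s))
        = Complex.exp (∫ s, (e₂ s : ℂ) * kerD α (ξ + h * Complex.I - s)) := by
      simp only [trG, mul_zero, Real.exp_zero, Complex.ofReal_one, one_mul, Complex.ofReal_zero,
        sub_zero] at h1
      exact mul_left_cancel₀ hK h1
    -- The exponents agree up to a multiple of 2πi; their difference has norm less than 1 here, so
    -- the multiple is 0.
    obtain ⟨n, hn⟩ := Complex.exp_eq_exp_iff_exists_int.1 h3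
    rw [hsub _ (hmem ξ), hn, add_sub_cancel_left] at h2 ⊢
    have h4 : |(n : ℝ)| * (2 * Real.pi) < 1 := by
      simpa [abs_of_pos Real.pi_pos] using h2
    have h5 : n = 0 := by
      by_contra hne
      have : (1 : ℝ) ≤ |(n : ℝ)| := by exact_mod_cast Int.one_le_abs hne
      nlinarith [Real.two_le_pi]
    simp [h5]
  obtain ⟨M, hM⟩ := eventually_atTop.1 hzero
  have hstrip : ∀ x ∈ strip α, ∫ s, ((e₁ s - e₂ s : ℝ) : ℂ) * kerD α (x - s) = 0 := by
    refine eqOn_of_eventually_line (isOpen_strip α) (convex_strip α).isPreconnected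
      (g := fun _ => 0) (fun x hx => (hasDerivAt_integral_kerD (kernelBddNear_of_mem_strip hα hx) hi
        (Eventually.of_forall fun s _ => mem_univ s)).differentiableAt.differentiableWithinAt)
      (differentiableOn_const _) (hmem (M + 1)) ?_
    filter_upwards [lt_mem_nhds (show (-1 : ℝ) < 0 by norm_num)] with t ht
    have := hM (M + 1 + t) (by linarith)
    convert this using 5
    push_cast
    ring
  funext s
  have := eq_zero_of_integral_kerD_eq_zero hα hi (hc₁.sub hc₂) hstrip s
  linarith

end

end QPlancherel

/-! ### Diagrams with a given center, and integration by parts in the `R`-function. -/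

namespace QPlancherel

noncomputable section

/-- `w` is a diagram in `𝒟[a,b]` with center `c`. -/
structure IsDiagramWith (a b c : ℝ) (w : ℝ → ℝ) : Prop where
  neg : a < 0
  pos : 0 < b
  lip : LipschitzWith 1 w
  mem : c ∈ Icc a b
  out : ∀ s, s ∉ Icc a b → w s = |s - c|

lemma InDiagramSpace.exists_center {a b : ℝ} {w : ℝ → ℝ} (h : InDiagramSpace a b w) :
    ∃ c, IsDiagramWith a b c w :=
  let ⟨ha, hb, hl, c, hc, ho⟩ := h
  ⟨c, ha, hb, hl, hc, ho⟩

/-- The charge of `w` relative to the center `c`. -/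
def cCharge (c : ℝ) (w : ℝ → ℝ) (s : ℝ) : ℝ := (w s - |s - c|) / 2

lemma abs_sub_le_of_lip {w : ℝ → ℝ} (h : LipschitzWith 1 w) (s t : ℝ) : |w s - w t| ≤ |s - t| := by
  simpa [Real.dist_eq] using h.dist_le_mul s t

lemma lipschitz_abs_sub (c : ℝ) : LipschitzWith 1 fun s : ℝ => |s - c| :=
  LipschitzWith.of_dist_le_mul fun s t => by
    have := abs_abs_sub_abs_le (s - c) (t - c)
    simpa [Real.dist_eq] using this

lemma lipschitz_half_sub {f g : ℝ → ℝ} (hf : LipschitzWith 1 f) (hg : LipschitzWith 1 g) :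
    LipschitzWith 1 fun s => (f s - g s) / 2 :=
  LipschitzWith.of_dist_le_mul fun s t => by
    have h1 := abs_sub_le_of_lip hf s t
    have h2 := abs_sub_le_of_lip hg s t
    rw [Real.dist_eq, Real.dist_eq, NNReal.coe_one, one_mul]
    have : (f s - g s) / 2 - (f t - g t) / 2 = ((f s - f t) - (g s - g t)) / 2 := by ring
    rw [this, abs_div, abs_two]
    have := abs_sub (f s - f t) (g s - g t)
    linarith

namespace IsDiagramWith

variable {a b c : ℝ} {w : ℝ → ℝ} (h : IsDiagramWith a b c w)

include h

lemma lip_cCharge : LipschitzWith 1 (cCharge c w) := lipschitz_half_sub h.lip (lipschitz_abs_sub c)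

lemma continuous_cCharge : Continuous (cCharge c w) := h.lip_cCharge.continuous

/-- Continuity carries the vanishing to the endpoints, which removes the boundary terms in the
integration by parts. -/
lemma cCharge_eq_zero {s : ℝ} (hs : s ∉ Ioo a b) : cCharge c w s = 0 := by
  have h1 : IsClosed {s | cCharge c w s = 0} := isClosed_eq h.continuous_cCharge continuous_const
  have h2 : (Icc a b)ᶜ ⊆ {s | cCharge c w s = 0} := fun s hs => by
    simp [cCharge, h.out s hs]
  have h3 : s ∈ closure (Icc a b)ᶜ := by
    rw [closure_compl, interior_Icc]; exact hs
  exact h1.closure_subset_iff.2 h2 h3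

lemma mem_of_cCharge_ne_zero (s : ℝ) (hs : cCharge c w s ≠ 0) : s ∈ Icc a b := by
  by_contra h'
  exact hs (h.cCharge_eq_zero fun h'' => h' (Ioo_subset_Icc_self h''))

/-- The Lipschitz bound between s and points to the right and to the left of [a,b], where w is
known. -/
lemma abs_sub_le (s : ℝ) : |s - c| ≤ w s := by
  have h1 := abs_sub_le_of_lip h.lip s (max s b + 1)
  have h2 := abs_sub_le_of_lip h.lip s (min s a - 1)
  rw [h.out (max s b + 1) (by
    simp only [mem_Icc, not_and, not_le]; intro; linarith [le_max_right s b])] at h1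
  rw [h.out (min s a - 1) (by
    simp only [mem_Icc, not_and, not_le]; intro; linarith [min_le_right s a])] at h2
  rw [abs_of_pos (show 0 < max s b + 1 - c by linarith [le_max_right s b, h.mem.2])] at h1
  rw [abs_of_neg (show min s a - 1 - c < 0 by linarith [min_le_right s a, h.mem.1])] at h2
  rw [abs_of_neg (show s - (max s b + 1) < 0 by linarith [le_max_left s b])] at h1
  rw [abs_of_pos (show 0 < s - (min s a - 1) by linarith [min_le_left s a])] at h2
  rw [abs_le] at h1 h2 ⊢
  constructor <;> linarith

lemma cCharge_nonneg (s : ℝ) : 0 ≤ cCharge c w s := by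
  have := h.abs_sub_le s
  unfold cCharge; linarith

lemma hasCompactSupport_cCharge : HasCompactSupport (cCharge c w) :=
  HasCompactSupport.of_support_subset_isCompact isCompact_Icc fun s hs =>
    h.mem_of_cCharge_ne_zero s hs

lemma integrable_cCharge : Integrable (cCharge c w) :=
  h.continuous_cCharge.integrable_of_hasCompactSupport h.hasCompactSupport_cCharge

/-- The slope of w never exceeds that of s - c. Together with `monotoneOn_cCharge` this makes the
charge unimodal with its peak at c. -/
lemma antitoneOn_cCharge : AntitoneOn (cCharge c w) (Ici c) := by
  intro s hs t ht hst
  have h1 := abs_sub_le_of_lip h.lip t s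
  rw [abs_of_nonneg (sub_nonneg.2 hst)] at h1
  unfold cCharge
  rw [abs_of_nonneg (sub_nonneg.2 (mem_Ici.1 hs)), abs_of_nonneg (sub_nonneg.2 (mem_Ici.1 ht))]
  linarith [(abs_le.1 h1).2]

lemma monotoneOn_cCharge : MonotoneOn (cCharge c w) (Iic c) := by
  intro s hs t ht hst
  have h1 := abs_sub_le_of_lip h.lip t s
  rw [abs_of_nonneg (sub_nonneg.2 hst)] at h1
  unfold cCharge
  rw [abs_of_nonpos (sub_nonpos.2 (mem_Iic.1 hs)), abs_of_nonpos (sub_nonpos.2 (mem_Iic.1 ht))]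
  linarith [(abs_le.1 h1).1]

end IsDiagramWith

/-- The real kernel `α / (1 - exp (-α y))`. -/
def kerR (α y : ℝ) : ℝ := α / (1 - Real.exp (-(α * y)))

lemma one_sub_exp_ne_zero {α y : ℝ} (hα : α ≠ 0) (hy : y ≠ 0) : 1 - Real.exp (-(α * y)) ≠ 0 := by
  intro h
  have h1 : Real.exp (-(α * y)) = 1 := by linarith
  rw [Real.exp_eq_one_iff] at h1
  have : α * y = 0 := by linarith
  simp_all

lemma kerK_ofReal {α : ℝ} (hα : α ≠ 0) (y : ℝ) : kerK α y = (kerR α y : ℝ) := by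
  unfold kerK kerE kerR
  rw [if_neg hα, inv_div]
  push_cast
  rfl

lemma kerD_ofReal {α : ℝ} (hα : α ≠ 0) (y : ℝ) :
    kerD α y = (kerR α y * (kerR α y - α) : ℝ) := by
  unfold kerD
  rw [kerK_ofReal hα]
  push_cast
  rfl

lemma measurable_kerR (α : ℝ) : Measurable (kerR α) := by
  unfold kerR; fun_prop

lemma hasDerivAt_kerR {α y : ℝ} (hα : α ≠ 0) (hy : y ≠ 0) :
    HasDerivAt (kerR α) (-(kerR α y * (kerR α y - α))) y := by
  have h0 := one_sub_exp_ne_zero hα hy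
  have h1 : HasDerivAt (fun y : ℝ => -(α * y)) (-α) y := by
    simpa using ((hasDerivAt_id' y).const_mul α).fun_neg
  have h2 := (hasDerivAt_const y α).div (h1.exp.const_sub 1) h0
  refine h2.congr_deriv ?_
  unfold kerR
  field_simp
  ring

lemma continuousOn_kerR {α : ℝ} (hα : α ≠ 0) : ContinuousOn (kerR α) {0}ᶜ := fun _ hy =>
  (hasDerivAt_kerR hα hy).continuousAt.continuousWithinAt

/-- The antiderivative of `s ↦ -kerR α (x - s)`. -/
def logKer (α x s : ℝ) : ℝ := Real.log (Real.exp (α * (x - s)) - 1)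

lemma exp_sub_one_ne_zero {α x s : ℝ} (hα : α ≠ 0) (hs : x ≠ s) :
    Real.exp (α * (x - s)) - 1 ≠ 0 := by
  have := one_sub_exp_ne_zero (y := s - x) hα (sub_ne_zero.2 hs.symm)
  have h2 : -(α * (s - x)) = α * (x - s) := by ring
  rw [h2] at this
  intro h
  apply this
  linarith

lemma hasDerivAt_logKer {α x s : ℝ} (hα : α ≠ 0) (hs : x ≠ s) :
    HasDerivAt (logKer α x) (-kerR α (x - s)) s := by
  have h0 := exp_sub_one_ne_zero hα hs
  have h1 : HasDerivAt (fun s : ℝ => α * (x - s)) (-α) s := by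
    simpa using ((hasDerivAt_id' s).const_sub x).const_mul α
  refine ((h1.exp.sub_const 1).log h0).congr_deriv ?_
  unfold kerR
  have h3 : Real.exp (-(α * (x - s))) = (Real.exp (α * (x - s)))⁻¹ := Real.exp_neg _
  have h4 := one_sub_exp_ne_zero (y := x - s) hα (sub_ne_zero.2 hs)
  rw [h3] at h4 ⊢
  have := Real.exp_pos (α * (x - s))
  field_simp

lemma integral_kerR_eq_logKer {α x u v : ℝ} (hα : α ≠ 0) (h : x ∉ uIcc u v) :
    ∫ s in u..v, kerR α (x - s) = logKer α x u - logKer α x v := by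
  have hne : ∀ s ∈ uIcc u v, x ≠ s := fun s hs hxs => h (hxs ▸ hs)
  have h1 := intervalIntegral.integral_eq_sub_of_hasDerivAt (a := u) (b := v)
    (f := logKer α x) (f' := fun s => -kerR α (x - s))
    (fun s hs => hasDerivAt_logKer hα (hne s hs))
    (ContinuousOn.intervalIntegrable (((continuousOn_kerR hα).comp (by fun_prop)
      fun s hs => by simpa [sub_eq_zero] using hne s hs).neg))
  rw [intervalIntegral.integral_neg] at h1
  linarith

/-- The derivative of the charge of `s ↦ |s - u|`. -/
def stepDiff (u s : ℝ) : ℝ := (if u ≤ s then 1 else 0) - (if 0 ≤ s then 1 else 0)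

lemma stepDiff_eq (u s : ℝ) :
    stepDiff u s = (Ico u 0).indicator (fun _ => (1 : ℝ)) s - (Ico 0 u).indicator (fun _ => (1 : ℝ)) s := by
  unfold stepDiff
  simp only [indicator_apply, mem_Ico]
  split_ifs <;> first | (exfalso; grind) | norm_num

lemma measurable_stepDiff : Measurable fun p : ℝ × ℝ => stepDiff p.1 p.2 := by
  unfold stepDiff
  exact (Measurable.ite (measurableSet_le measurable_fst measurable_snd) measurable_const
    measurable_const).sub (Measurable.ite (measurableSet_le measurable_const measurable_snd)
    measurable_const measurable_const)

/-- The step function is 1 on [u,0) and -1 on [0,u), so the oriented integral covers both signs of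
u. -/
lemma integral_stepDiff_mul (u : ℝ) {g : ℝ → ℝ} (hg : IntegrableOn g (uIcc 0 u)) :
    Integrable (fun s => stepDiff u s * g s) ∧ ∫ s, stepDiff u s * g s = -∫ s in (0 : ℝ)..u, g s := by
  have e : (fun s => stepDiff u s * g s)
      = fun s => (Ico u 0).indicator g s - (Ico 0 u).indicator g s := by
    funext s
    rw [stepDiff_eq, sub_mul]
    congr 1 <;> · simp only [indicator_apply]; split_ifs <;> simp
  have i1 : Integrable ((Ico u 0).indicator g) := by
    rw [integrable_indicator_iff measurableSet_Ico]
    exact hg.mono_set (Ico_subset_Icc_self.trans (uIcc_comm (0 : ℝ) u ▸ Icc_subset_uIcc))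
  have i2 : Integrable ((Ico 0 u).indicator g) := by
    rw [integrable_indicator_iff measurableSet_Ico]
    exact hg.mono_set (Ico_subset_Icc_self.trans Icc_subset_uIcc)
  rw [e]
  refine ⟨i1.sub i2, ?_⟩
  rw [integral_sub i1 i2, integral_indicator measurableSet_Ico, integral_indicator measurableSet_Ico,
    integral_Ico_eq_integral_Ioc, integral_Ico_eq_integral_Ioc, intervalIntegral]
  ring

lemma ae_deriv_half_abs (u : ℝ) :
    ∀ᵐ s : ℝ, HasDerivAt (fun s : ℝ => (|s - u| - |s|) / 2) (stepDiff u s) s := by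
  have h0 : ∀ᵐ s : ℝ, s ≠ 0 := by simp [ae_iff, measure_singleton]
  have hu : ∀ᵐ s : ℝ, s ≠ u := by simp [ae_iff, measure_singleton]
  filter_upwards [h0, hu] with s h0 hu
  have habs : ∀ v : ℝ, s ≠ v →
      HasDerivAt (fun s : ℝ => |s - v|) (2 * (if v ≤ s then 1 else 0) - 1) s := by
    intro v hv
    rcases lt_or_gt_of_ne hv with h | h
    · rw [if_neg (not_le.2 h)]
      have h1 : HasDerivAt (fun s : ℝ => -(s - v)) (2 * 0 - 1) s := by
        simpa using ((hasDerivAt_id' s).sub_const v).fun_neg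
      refine h1.congr_of_eventuallyEq ?_
      filter_upwards [gt_mem_nhds h] with t ht
      exact abs_of_neg (sub_neg.2 ht)
    · rw [if_pos h.le]
      have h1 : HasDerivAt (fun s : ℝ => s - v) (2 * 1 - 1) s :=
        ((hasDerivAt_id' s).sub_const v).congr_deriv (by norm_num)
      refine h1.congr_of_eventuallyEq ?_
      filter_upwards [lt_mem_nhds h] with t ht
      exact abs_of_pos (sub_pos.2 ht)
  have h1 := habs u hu
  have h2 := habs 0 h0
  simp only [sub_zero] at h2
  refine ((h1.sub h2).div_const 2).congr_deriv ?_
  unfold stepDiff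
  ring

namespace IsDiagramWith

variable {a b c : ℝ} {w : ℝ → ℝ} (h : IsDiagramWith a b c w)

include h

lemma ae_deriv_charge : ∀ᵐ s, deriv (charge w) s = deriv (cCharge c w) s + stepDiff c s := by
  filter_upwards [ae_deriv_half_abs c, h.lip_cCharge.ae_differentiableAt] with s h1 h2
  have h3 := (h2.hasDerivAt.add h1).deriv
  rw [← h3]
  congr 1
  funext t
  simp only [charge, cCharge, Pi.add_apply]
  ring

lemma deriv_cCharge_eq_zero {s : ℝ} (hs : s ∉ Icc a b) : deriv (cCharge c w) s = 0 := by
  have : cCharge c w =ᶠ[𝓝 s] fun _ => 0 := by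
    filter_upwards [isClosed_Icc.isOpen_compl.mem_nhds hs] with t ht
    exact h.cCharge_eq_zero fun h' => ht (Ioo_subset_Icc_self h')
  rw [this.deriv_eq, deriv_const]

/-- The charge is only Lipschitz, so the integration by parts is that of absolutely continuous
functions on [a,b]. -/
lemma integral_deriv_cCharge {α x : ℝ} (hα : α ≠ 0) (hx : x ∉ Icc a b) :
    Integrable (fun s => deriv (cCharge c w) s * kerR α (x - s)) ∧
    ∫ s, deriv (cCharge c w) s * kerR α (x - s)
      = -∫ s, cCharge c w s * (kerR α (x - s) * (kerR α (x - s) - α)) := by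
  have hab : a ≤ b := h.neg.le.trans h.pos.le
  have hne : ∀ s ∈ Icc a b, x - s ≠ 0 := fun s hs h0 => hx ((sub_eq_zero.1 h0) ▸ hs)
  have hcont : ContinuousOn (fun s => kerR α (x - s)) (Icc a b) :=
    (continuousOn_kerR hα).comp (by fun_prop) fun s hs => hne s hs
  have hd : ∀ s ∈ Icc a b, HasDerivAt (fun s => kerR α (x - s))
      (kerR α (x - s) * (kerR α (x - s) - α)) s := by
    intro s hs
    have := (hasDerivAt_kerR hα (hne s hs)).comp_const_sub x s
    simpa using this
  have hac : AbsolutelyContinuousOnInterval (cCharge c w) a b :=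
    (h.lip_cCharge.lipschitzOnWith (s := uIcc a b)).absolutelyContinuousOnInterval
  have hac2 : AbsolutelyContinuousOnInterval (fun s => kerR α (x - s)) a b := by
    obtain ⟨C, hC⟩ := isCompact_Icc.exists_bound_of_continuousOn
      (f := fun s => kerR α (x - s) * (kerR α (x - s) - α)) (s := Icc a b)
      (hcont.mul (hcont.sub continuousOn_const))
    have : LipschitzOnWith (Real.toNNReal C) (fun s => kerR α (x - s)) (uIcc a b) := by
      rw [uIcc_of_le hab]
      refine (convex_Icc a b).lipschitzOnWith_of_nnnorm_hasDerivWithin_le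
        (fun s hs => (hd s hs).hasDerivWithinAt) fun s hs => ?_
      rw [← NNReal.coe_le_coe, coe_nnnorm]
      exact (hC s hs).trans (Real.le_coe_toNNReal C)
    exact this.absolutelyContinuousOnInterval
  have hparts := hac.integral_mul_deriv_eq_deriv_mul hac2
  rw [h.cCharge_eq_zero (s := a) (by simp), h.cCharge_eq_zero (s := b) (by simp)] at hparts
  have hzero : ∀ s, s ∉ Icc a b → deriv (cCharge c w) s * kerR α (x - s) = 0 := fun s hs => by
    rw [h.deriv_cCharge_eq_zero hs, zero_mul]
  have hi : IntegrableOn (fun s => deriv (cCharge c w) s * kerR α (x - s)) (Icc a b) := by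
    have := hac.intervalIntegrable_deriv.mul_continuousOn (g := fun s => kerR α (x - s))
      (by rwa [uIcc_of_le hab])
    rwa [intervalIntegrable_iff_integrableOn_Icc_of_le hab] at this
  have hsup : ∀ {f : ℝ → ℝ}, (∀ s, s ∉ Icc a b → f s = 0) → ∫ s, f s = ∫ s in a..b, f s := by
    intro f hf
    rw [intervalIntegral.integral_of_le hab, ← integral_Icc_eq_integral_Ioc,
      setIntegral_eq_integral_of_forall_compl_eq_zero hf]
  refine ⟨?_, ?_⟩
  · rw [integrableOn_iff_integrable_of_support_subset] at hi
    · exact hi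
    · intro s hs
      by_contra h'
      exact hs (hzero s h')
  · rw [hsup hzero, hsup (f := fun s => cCharge c w s * (kerR α (x - s) * (kerR α (x - s) - α)))
      fun s hs => by rw [h.cCharge_eq_zero fun h' => hs (Ioo_subset_Icc_self h'), zero_mul]]
    have hcongr : ∫ s in a..b, cCharge c w s * deriv (fun s => kerR α (x - s)) s
        = ∫ s in a..b, cCharge c w s * (kerR α (x - s) * (kerR α (x - s) - α)) := by
      refine intervalIntegral.integral_congr fun s hs => ?_
      rw [uIcc_of_le hab] at hs
      simp only [(hd s hs).deriv]
    rw [← hcongr, hparts]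
    ring

/-- Integration by parts in the exponent of the `R`-function. -/
lemma integral_deriv_charge_mul {α x : ℝ} (hα : α ≠ 0) (hx : x ∉ Icc a b) :
    ∫ s, deriv (charge w) s * kerR α (x - s) = logKer α x c - logKer α x 0
      - ∫ s, cCharge c w s * (kerR α (x - s) * (kerR α (x - s) - α)) := by
  have hx0 : x ∉ uIcc 0 c := fun h' =>
    hx (uIcc_subset_Icc ⟨h.neg.le, h.pos.le⟩ h.mem h')
  have hint : IntegrableOn (fun s => kerR α (x - s)) (uIcc 0 c) :=
    ContinuousOn.integrableOn_uIcc ((continuousOn_kerR hα).comp (by fun_prop)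
      fun s hs => fun h0 => hx0 ((sub_eq_zero.1 h0) ▸ hs))
  obtain ⟨i1, e1⟩ := integral_stepDiff_mul c hint
  obtain ⟨i2, e2⟩ := h.integral_deriv_cCharge hα hx
  rw [integral_kerR_eq_logKer hα hx0] at e1
  have : ∫ s, deriv (charge w) s * kerR α (x - s)
      = ∫ s, (deriv (cCharge c w) s * kerR α (x - s) + stepDiff c s * kerR α (x - s)) := by
    refine integral_congr_ae ?_
    filter_upwards [h.ae_deriv_charge] with s hs
    rw [hs]; ring
  rw [this, integral_add i2 i1, e1, e2]
  ring

/-- The exponential expression in the `R`-function and in the dynamic equation, as a transform of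
the charge. -/
lemma trG_ofReal {α x : ℝ} (hα : 0 < α) (hx : x ∉ Icc a b) :
    trG α c (cCharge c w) x
      = ((kerR α x * Real.exp (-∫ s, deriv (charge w) s * kerR α (x - s)) : ℝ) : ℂ) := by
  have hI : ∫ s, (cCharge c w s : ℂ) * kerD α (x - s)
      = ((∫ s, cCharge c w s * (kerR α (x - s) * (kerR α (x - s) - α)) : ℝ) : ℂ) := by
    refine Eq.trans ?_ integral_ofReal
    congr 1
    ext s
    rw [← Complex.ofReal_sub, kerD_ofReal hα.ne']
    push_cast
    rfl
  have hne : ∀ s ∈ Icc a b, x ≠ s := fun s hs h0 => hx (h0 ▸ hs)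
  have h0 : x ≠ 0 := hne 0 ⟨h.neg.le, h.pos.le⟩
  have hc := hne c h.mem
  unfold trG
  rw [hI, ← Complex.ofReal_sub, kerK_ofReal hα.ne', h.integral_deriv_charge_mul hα.ne' hx]
  rw [← Complex.ofReal_exp, ← Complex.ofReal_mul, ← Complex.ofReal_mul]
  congr 1
  have hsplit : -(logKer α x c - logKer α x 0
      - ∫ s, cCharge c w s * (kerR α (x - s) * (kerR α (x - s) - α)))
      = logKer α x 0 - logKer α x c
        + ∫ s, cCharge c w s * (kerR α (x - s) * (kerR α (x - s) - α)) := by ring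
  rw [hsplit, Real.exp_add, ← mul_assoc]
  congr 1
  have e0 := exp_sub_one_ne_zero hα.ne' h0
  have ec := exp_sub_one_ne_zero hα.ne' hc
  -- The two logarithms may be taken of negative numbers. Only the ratio matters, and it is positive
  -- because x lies on the same side of 0 and of c.
  rw [Real.exp_sub, logKer, logKer, Real.exp_log_eq_abs e0, Real.exp_log_eq_abs ec, ← abs_div,
    abs_of_pos]
  · unfold kerR
    rw [Real.exp_neg, Real.exp_neg]
    have hc' : Real.exp (α * (x - c)) = Real.exp (α * x) / Real.exp (α * c) := by
      rw [mul_sub, Real.exp_sub]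
    simp only [sub_zero] at e0 ⊢
    rw [hc'] at ec ⊢
    have p1 := Real.exp_pos (α * x)
    have p2 := Real.exp_pos (α * c)
    have e3 : Real.exp (α * x) - Real.exp (α * c) ≠ 0 := by
      intro h3; apply ec; rw [sub_eq_zero.1 h3]; field_simp; ring
    have e4 : 1 - (Real.exp (α * x) / Real.exp (α * c))⁻¹ ≠ 0 := by
      rw [inv_div]; intro h4; apply e3; field_simp at h4; linarith
    have e5 : 1 - (Real.exp (α * x))⁻¹ ≠ 0 := by
      intro h4; apply e0; field_simp at h4; linarith
    field_simp
  · by_cases hlt : x < a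
    · apply div_pos_of_neg_of_neg
      · rw [sub_neg, Real.exp_lt_one_iff]
        have : x - 0 < 0 := by linarith [h.neg]
        nlinarith
      · rw [sub_neg, Real.exp_lt_one_iff]
        have : x - c < 0 := by linarith [h.mem.1]
        nlinarith
    · have hgt : b < x := by
        by_contra h'; exact hx ⟨not_lt.1 hlt, not_lt.1 h'⟩
      apply div_pos
      · rw [sub_pos, Real.one_lt_exp_iff]
        have : 0 < x - 0 := by linarith [h.pos]
        positivity
      · rw [sub_pos, Real.one_lt_exp_iff]
        have : 0 < x - c := by linarith [h.mem.2]
        positivity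

end IsDiagramWith

lemma rpow_eq_exp {q : ℝ} (hq : 0 < q) (x : ℝ) : q ^ x = Real.exp (-(-Real.log q * x)) := by
  rw [Real.rpow_def_of_pos hq]; congr 1; ring

lemma neg_log_pos {q : ℝ} (hq : q ∈ Ioo (0 : ℝ) 1) : 0 < -Real.log q := by
  have := Real.log_neg hq.1 hq.2; linarith

lemma qR_eq_mul_exp {q : ℝ} (hq : q ∈ Ioo (0 : ℝ) 1) (w : ℝ → ℝ) (x : ℝ) :
    qR q w x = (1 - q) / (-Real.log q) * (kerR (-Real.log q) x
      * Real.exp (-∫ s, deriv (charge w) s * kerR (-Real.log q) (x - s))) := by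
  have hα := neg_log_pos hq
  unfold qR
  have : ∀ s, -Real.log q * (deriv (charge w) s / (1 - q ^ (x - s)))
      = deriv (charge w) s * kerR (-Real.log q) (x - s) := by
    intro s
    rw [rpow_eq_exp hq.1]
    unfold kerR
    ring
  have hI : -(-Real.log q) * ∫ s, deriv (charge w) s / (1 - q ^ (x - s))
      = -∫ s, deriv (charge w) s * kerR (-Real.log q) (x - s) := by
    rw [neg_mul, ← integral_const_mul, integral_congr_ae (Eventually.of_forall this)]
  rw [Real.log_inv, hI, rpow_eq_exp hq.1, ← mul_assoc]
  have hl : Real.log q ≠ 0 := by linarith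
  congr 1
  unfold kerR
  field_simp

lemma IsDiagramWith.qR_eq {q a b c x : ℝ} {w : ℝ → ℝ} (hq : q ∈ Ioo (0 : ℝ) 1)
    (h : IsDiagramWith a b c w) (hx : x ∉ Icc a b) :
    trG (-Real.log q) c (cCharge c w) x = ((-Real.log q / (1 - q) * qR q w x : ℝ) : ℂ) := by
  rw [h.trG_ofReal (neg_log_pos hq) hx, qR_eq_mul_exp hq]
  have h1 : (1 : ℝ) - q ≠ 0 := by linarith [hq.2]
  have h2 := (neg_log_pos hq).ne'
  congr 1
  rw [← mul_assoc]
  have : -Real.log q / (1 - q) * ((1 - q) / -Real.log q) = 1 := by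
    rw [div_mul_div_comm, mul_comm, div_self (mul_ne_zero h1 h2)]
  rw [this, one_mul]

/-- The limit equation in terms of the transform. -/
lemma limitEquation_iff {q x r : ℝ} (hq : q ∈ Ioo (0 : ℝ) 1) {g : ℂ}
    (hg : g = ((-Real.log q / (1 - q) * r : ℝ) : ℂ)) :
    LimitEquation q x r ↔ g * kerE (-Real.log q) (x - g) = 1 := by
  have hα := neg_log_pos hq
  have h1 : (1 : ℝ) - q ≠ 0 := by linarith [hq.2]
  have h2 := hα.ne'
  rw [hg]
  unfold LimitEquation kerE
  rw [if_neg hα.ne', rpow_eq_exp hq.1, Real.log_inv]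
  set α := -Real.log q
  have e : (((α / (1 - q) * r : ℝ) : ℂ) * ((1 - Complex.exp (-(α * (x - ((α / (1 - q) * r : ℝ) : ℂ))))) / α))
    = ((α / (1 - q) * r * ((1 - Real.exp (-(α * (x - α / (1 - q) * r)))) / α) : ℝ) : ℂ) := by
    push_cast; ring_nf
  rw [e]
  norm_cast
  rw [show α / (1 - q) * r * ((1 - Real.exp (-(α * (x - α / (1 - q) * r)))) / α)
    = r * (1 - Real.exp (-(α * (x - α / (1 - q) * r)))) / (1 - q) by field_simp, div_eq_one_iff_eq h1]

end

end QPlancherel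

/-! ### Analytic continuation of the limit equation, and the transform at real `±∞`. -/

namespace QPlancherel

noncomputable section

/-- A connected region outside `[a,b]` on which the transforms of diagrams are holomorphic. -/
def outer (α a b : ℝ) : Set ℂ := {x | x.re < a} ∪ {x | 0 < x.im ∧ α * x.im < 2 * Real.pi} ∪ {x | b < x.re}

lemma isOpen_outer (α a b : ℝ) : IsOpen (outer α a b) :=
  ((isOpen_lt Complex.continuous_re continuous_const).union
    ((isOpen_lt continuous_const Complex.continuous_im).inter
    (isOpen_lt (continuous_const.mul Complex.continuous_im) continuous_const))).union
    (isOpen_lt continuous_const Complex.continuous_re)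

/-- Two convex half-planes, each of which meets a convex horizontal strip above the real axis. -/
lemma isPreconnected_outer {α : ℝ} (hα : 0 ≤ α) (a b : ℝ) : IsPreconnected (outer α a b) := by
  have h1 : IsPreconnected {x : ℂ | x.re < a} := (convex_halfSpace_re_lt a).isPreconnected
  have h3 : IsPreconnected {x : ℂ | b < x.re} := (convex_halfSpace_re_gt b).isPreconnected
  have h2 : IsPreconnected {x : ℂ | 0 < x.im ∧ α * x.im < 2 * Real.pi} := by
    have : {x : ℂ | 0 < x.im ∧ α * x.im < 2 * Real.pi} = strip (α / 2) := by
      ext x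
      simp only [strip, mem_ofPred_eq]
      constructor <;> rintro ⟨h, h'⟩ <;> exact ⟨h, by linarith⟩
    rw [this]
    exact (convex_strip _).isPreconnected
  obtain ⟨y, hy, hy'⟩ : ∃ y : ℝ, 0 < y ∧ α * y < 2 * Real.pi := by
    refine ⟨(α + 1)⁻¹, by positivity, ?_⟩
    rw [← div_eq_mul_inv, div_lt_iff₀ (by positivity)]
    nlinarith [Real.two_le_pi]
  exact IsPreconnected.union' ⟨(⟨b + 1, y⟩ : ℂ), Or.inr ⟨hy, hy'⟩, by simp⟩
    (IsPreconnected.union' ⟨(⟨a - 1, y⟩ : ℂ), by simp, hy, hy'⟩ h1 h2) h3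

lemma kerE_ne_zero_of_mem_outer {α a b : ℝ} (hα : 0 ≤ α) {x : ℂ} (hx : x ∈ outer α a b) {s : ℝ}
    (hs : s ∈ Icc a b) : kerE α (x - s) ≠ 0 := by
  rcases hx with (hx | hx) | hx
  · have hx' : x.re < a := hx
    exact kerE_ne_zero_of_re (by simp; linarith [hs.1])
  · exact kerE_ne_zero_of_im hα (by simpa using hx.1) (by simpa using hx.2)
  · have hx' : b < x.re := hx
    exact kerE_ne_zero_of_re (by simp; linarith [hs.2])

lemma strip_subset_outer {α : ℝ} (a b : ℝ) : strip α ⊆ outer α a b := fun _ hx =>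
  Or.inl (Or.inr ⟨hx.1, by linarith [hx.2, Real.pi_pos]⟩)

lemma ofReal_mem_outer {α a b x : ℝ} (hx : x ∉ Icc a b) : (x : ℂ) ∈ outer α a b := by
  by_cases h : x < a
  · exact Or.inl (Or.inl (by simpa using h))
  · refine Or.inr ?_
    have : b < x := by
      by_contra h'; exact hx ⟨not_lt.1 h, not_lt.1 h'⟩
    simpa using this

namespace IsDiagramWith

variable {a b c : ℝ} {w : ℝ → ℝ} (h : IsDiagramWith a b c w)

include h

lemma differentiableOn_trG {α : ℝ} (hα : 0 ≤ α) :
    DifferentiableOn ℂ (trG α c (cCharge c w)) (outer α a b) := fun _ hx =>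
  (differentiableAt_trG (kernelBddNear_Icc fun _ hs => kerE_ne_zero_of_mem_outer hα hx hs)
    (kerE_ne_zero_of_mem_outer hα hx h.mem) h.integrable_cCharge
    h.mem_of_cCharge_ne_zero).differentiableWithinAt

/-- The limit equation extends from large real `x`. -/
lemma limit_eq_of_eventually {α : ℝ} (hα : 0 ≤ α)
    (hM : ∀ᶠ x : ℝ in atTop, trG α c (cCharge c w) x * kerE α (x - trG α c (cCharge c w) x) = 1)
    {x : ℂ} (hx : x ∈ outer α a b) :
    trG α c (cCharge c w) x * kerE α (x - trG α c (cCharge c w) x) = 1 := by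
  have hd := h.differentiableOn_trG hα
  have hE : Differentiable ℂ (kerE α) := fun y => (hasDerivAt_kerE α y).differentiableAt
  obtain ⟨M, hM⟩ := eventually_atTop.1 hM
  refine eqOn_of_eventually_line (isOpen_outer α a b) (isPreconnected_outer hα a b)
    (f := fun x => trG α c (cCharge c w) x * kerE α (x - trG α c (cCharge c w) x)) (g := fun _ => 1)
    (hd.mul (hE.comp_differentiableOn (differentiableOn_id.sub hd))) (differentiableOn_const _)
    (x₀ := (max M b + 1 : ℝ)) (Or.inr ?_) ?_ hx
  · simp only [mem_ofPred_eq, Complex.ofReal_re]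
    linarith [le_max_right M b]
  · filter_upwards [lt_mem_nhds (show (-1 : ℝ) < 0 by norm_num)] with t ht
    have := hM (max M b + 1 + t) (by linarith [le_max_left M b])
    rw [← Complex.ofReal_add]
    exact this

end IsDiagramWith

/-- The real kernel `-(kerR α)'`. -/
def kerRD (α y : ℝ) : ℝ := kerR α y * (kerR α y - α)

lemma kerRD_eq {α y : ℝ} (hα : α ≠ 0) (hy : y ≠ 0) :
    kerRD α y = α ^ 2 * Real.exp (-(α * y)) / (1 - Real.exp (-(α * y))) ^ 2 := by
  have := one_sub_exp_ne_zero hα hy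
  unfold kerRD kerR
  field_simp
  ring

lemma le_kerRD_of_pos {α y : ℝ} (hα : 0 < α) (hy : 0 < y) :
    α ^ 2 * Real.exp (-(α * y)) ≤ kerRD α y := by
  rw [kerRD_eq hα.ne' hy.ne']
  have h1 : Real.exp (-(α * y)) < 1 := by
    rw [Real.exp_lt_one_iff]; have := mul_pos hα hy; linarith
  have h2 := Real.exp_pos (-(α * y))
  rw [le_div_iff₀ (by nlinarith)]
  have : (1 - Real.exp (-(α * y))) ^ 2 ≤ 1 := by nlinarith
  have : 0 ≤ α ^ 2 * Real.exp (-(α * y)) := by positivity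
  nlinarith

lemma le_kerRD_of_neg {α y : ℝ} (hα : 0 < α) (hy : y < 0) :
    α ^ 2 * Real.exp (α * y) ≤ kerRD α y := by
  have h := le_kerRD_of_pos hα (y := -y) (by linarith)
  have : kerRD α (-y) = kerRD α y := by
    rw [kerRD_eq hα.ne' hy.ne, kerRD_eq hα.ne' (by linarith)]
    rw [mul_neg, neg_neg, Real.exp_neg]
    have h1 := one_sub_exp_ne_zero hα.ne' hy.ne
    rw [Real.exp_neg] at h1
    have h2 : 1 - Real.exp (α * y) ≠ 0 := by
      have := one_sub_exp_ne_zero hα.ne' (y := -y) (by linarith)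
      rwa [mul_neg, neg_neg] at this
    have h3 := Real.exp_pos (α * y)
    have h4 : Real.exp (α * y) - 1 ≠ 0 := by intro h; apply h2; linarith
    field_simp
    ring
  rw [this] at h
  simpa using h

/-- The exponent in the transform, at real points. -/
def potR (α : ℝ) (e : ℝ → ℝ) (x : ℝ) : ℝ := ∫ s, e s * kerRD α (x - s)

lemma integral_kerD_ofReal {α : ℝ} (hα : α ≠ 0) (e : ℝ → ℝ) (x : ℝ) :
    ∫ s, (e s : ℂ) * kerD α (x - s) = (potR α e x : ℝ) := by
  unfold potR
  refine Eq.trans ?_ integral_ofReal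
  congr 1
  ext s
  rw [← Complex.ofReal_sub, kerD_ofReal hα, kerRD]
  push_cast
  rfl

lemma trG_ofReal_eq {α c : ℝ} (hα : α ≠ 0) (e : ℝ → ℝ) (x : ℝ) :
    trG α c e x = ((Real.exp (α * c) * kerR α (x - c) * Real.exp (potR α e x) : ℝ) : ℂ) := by
  unfold trG
  rw [integral_kerD_ofReal hα, ← Complex.ofReal_sub, kerK_ofReal hα]
  push_cast
  rfl

lemma abs_kerR_le {α y : ℝ} (hα : 0 < α) (hy : 1 ≤ |y|) :
    |kerR α y| ≤ α / (1 - Real.exp (-α)) := by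
  have h1 : Real.exp (-α) < 1 := by rw [Real.exp_lt_one_iff]; linarith
  unfold kerR
  rw [abs_div, abs_of_pos hα]
  apply div_le_div_of_nonneg_left hα.le (by linarith)
  rcases le_abs'.1 hy with h | h
  · have h2 : Real.exp α ≤ Real.exp (-(α * y)) := Real.exp_le_exp.2 (by nlinarith)
    have h3 : 1 ≤ Real.exp α := Real.one_le_exp hα.le
    rw [abs_of_nonpos (by linarith)]
    have h4 : Real.exp (-α) * Real.exp α = 1 := by rw [← Real.exp_add]; simp
    nlinarith
  · have h2 : Real.exp (-(α * y)) ≤ Real.exp (-α) := Real.exp_le_exp.2 (by nlinarith)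
    rw [abs_of_nonneg (by linarith)]
    linarith

lemma tendsto_kerR_atTop {α : ℝ} (hα : 0 < α) : Tendsto (kerR α) atTop (𝓝 α) := by
  have h1 : Tendsto (fun y : ℝ => Real.exp (-(α * y))) atTop (𝓝 0) :=
    Real.tendsto_exp_neg_atTop_nhds_zero.comp (tendsto_id.const_mul_atTop hα)
  have := (tendsto_const_nhds (x := α)).div (h1.const_sub 1) (by norm_num)
  rw [sub_zero, div_one] at this
  exact this

lemma tendsto_kerR_atBot {α : ℝ} (hα : 0 < α) : Tendsto (kerR α) atBot (𝓝 0) := by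
  have h1 : Tendsto (fun y : ℝ => Real.exp (-(α * y)) - 1) atBot atTop := by
    refine tendsto_atTop_add_const_right _ _ (Real.tendsto_exp_atTop.comp ?_)
    exact tendsto_neg_atBot_atTop.comp (tendsto_id.const_mul_atBot hα)
  have h2 := (h1.inv_tendsto_atTop).const_mul (-α)
  rw [mul_zero] at h2
  refine h2.congr fun y => ?_
  simp only [kerR, Pi.inv_apply]
  rw [show 1 - Real.exp (-(α * y)) = -(Real.exp (-(α * y)) - 1) by ring, div_neg, neg_mul,
    div_eq_mul_inv]

lemma measurable_kerRD (α : ℝ) : Measurable (kerRD α) :=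
  (measurable_kerR α).mul ((measurable_kerR α).sub_const _)

lemma tendsto_potR {α a b : ℝ} (hα : 0 < α) {e : ℝ → ℝ} (he : Integrable e)
    (hs : ∀ s, e s ≠ 0 → s ∈ Icc a b) {l : Filter ℝ} [l.IsCountablyGenerated]
    (hl : ∀ s : ℝ, Tendsto (fun x => kerRD α (x - s)) l (𝓝 0))
    (hl' : ∀ᶠ x in l, ∀ s ∈ Icc a b, 1 ≤ |x - s|) :
    Tendsto (potR α e) l (𝓝 0) := by
  set B := α / (1 - Real.exp (-α))
  have := tendsto_integral_filter_of_dominated_convergence (l := l) (μ := volume)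
    (F := fun x s => e s * kerRD α (x - s)) (f := fun s => e s * 0)
    (fun s => ‖e s‖ * (B * (B + α)))
    (Eventually.of_forall fun x => he.aestronglyMeasurable.mul
      ((measurable_kerRD α).comp (by fun_prop)).aestronglyMeasurable)
    (by
      filter_upwards [hl'] with x hx
      refine Eventually.of_forall fun s => ?_
      by_cases h0 : e s = 0
      · simp [h0]
      · rw [norm_mul]
        refine mul_le_mul_of_nonneg_left ?_ (norm_nonneg _)
        have h1 := abs_kerR_le hα (hx s (hs s h0))
        rw [kerRD, norm_mul, Real.norm_eq_abs, Real.norm_eq_abs]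
        have h2 : |kerR α (x - s) - α| ≤ B + α := by
          refine (abs_sub _ _).trans ?_
          rw [abs_of_pos hα]
          linarith
        have := abs_nonneg (kerR α (x - s))
        gcongr
        exact this.trans h1)
    (he.norm.mul_const _)
    (Eventually.of_forall fun s => (hl s).const_mul _)
  simp only [mul_zero, integral_zero] at this
  exact this

lemma tendsto_kerRD_sub_atTop {α : ℝ} (hα : 0 < α) (s : ℝ) :
    Tendsto (fun x => kerRD α (x - s)) atTop (𝓝 0) := by
  have h := (tendsto_kerR_atTop hα).comp (tendsto_sub_const_atTop s)
  simpa [kerRD, Function.comp_def] using h.mul (h.sub_const α)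

lemma tendsto_kerRD_sub_atBot {α : ℝ} (hα : 0 < α) (s : ℝ) :
    Tendsto (fun x => kerRD α (x - s)) atBot (𝓝 0) := by
  have h := (tendsto_kerR_atBot hα).comp (tendsto_sub_const_atBot s)
  simpa [kerRD, Function.comp_def] using h.mul (h.sub_const α)

namespace IsDiagramWith

variable {a b c : ℝ} {w : ℝ → ℝ} (h : IsDiagramWith a b c w)

include h

lemma tendsto_potR_atTop {α : ℝ} (hα : 0 < α) : Tendsto (potR α (cCharge c w)) atTop (𝓝 0) := by
  refine tendsto_potR hα h.integrable_cCharge h.mem_of_cCharge_ne_zero (tendsto_kerRD_sub_atTop hα) ?_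
  filter_upwards [eventually_ge_atTop (b + 1)] with x hx s hs
  rw [abs_of_nonneg (by linarith [hs.2])]; linarith [hs.2]

lemma tendsto_potR_atBot {α : ℝ} (hα : 0 < α) : Tendsto (potR α (cCharge c w)) atBot (𝓝 0) := by
  refine tendsto_potR hα h.integrable_cCharge h.mem_of_cCharge_ne_zero (tendsto_kerRD_sub_atBot hα) ?_
  filter_upwards [eventually_le_atBot (a - 1)] with x hx s hs
  rw [abs_of_nonpos (by linarith [hs.1])]; linarith [hs.1]

lemma tendsto_trG_atTop {α : ℝ} (hα : 0 < α) :
    Tendsto (fun x : ℝ => Real.exp (α * c) * kerR α (x - c) * Real.exp (potR α (cCharge c w) x))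
      atTop (𝓝 (Real.exp (α * c) * α)) := by
  have h1 := ((tendsto_kerR_atTop hα).comp (tendsto_sub_const_atTop c)).const_mul (Real.exp (α * c))
  have h2 := h1.mul ((Real.continuous_exp.tendsto 0).comp (h.tendsto_potR_atTop hα))
  simpa using h2

/-- The factor e^{αc} in `trG` cancels the shift by the center here, whereas at +∞ it survives in
the limit α e^{αc}. This is how the limit equation at +∞ can detect the center. -/
lemma tendsto_trG_atBot {α : ℝ} (hα : 0 < α) :
    Tendsto (fun x : ℝ => Real.exp (-(α * x)) * (Real.exp (α * c) * kerR α (x - c)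
      * Real.exp (potR α (cCharge c w) x))) atBot (𝓝 (-α)) := by
  have h1 : Tendsto (fun x : ℝ => α / (Real.exp (α * x) * Real.exp (-(α * c)) - 1)) atBot
      (𝓝 (α / (0 * Real.exp (-(α * c)) - 1))) := by
    refine tendsto_const_nhds.div (((Real.tendsto_exp_atBot.comp
      (tendsto_id.const_mul_atBot hα)).mul_const _).sub_const 1) (by norm_num)
  have h2 := h1.mul ((Real.continuous_exp.tendsto 0).comp (h.tendsto_potR_atBot hα))
  have h3 : α / (0 * Real.exp (-(α * c)) - 1) * Real.exp 0 = -α := by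
    rw [Real.exp_zero, zero_mul, zero_sub, div_neg, div_one, mul_one]
  rw [h3] at h2
  refine h2.congr' ?_
  filter_upwards [eventually_lt_atBot c] with x hx
  have hne := one_sub_exp_ne_zero hα.ne' (y := x - c) (by linarith)
  simp only [Function.comp_apply]
  rw [← mul_assoc]
  congr 1
  unfold kerR
  have e1 : Real.exp (-(α * (x - c))) = Real.exp (α * c) / Real.exp (α * x) := by
    rw [← Real.exp_sub]; congr 1; ring
  rw [e1] at hne ⊢
  rw [Real.exp_neg, Real.exp_neg]
  have p1 := Real.exp_pos (α * x)
  have p2 := Real.exp_pos (α * c)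
  have e2 : Real.exp (α * x) - Real.exp (α * c) ≠ 0 := by
    intro h; apply hne; rw [sub_eq_zero.1 h]; field_simp; ring
  have e3 : Real.exp (α * x) * (Real.exp (α * c))⁻¹ - 1 ≠ 0 := by
    intro h; apply e2; field_simp at h; linarith
  field_simp

/-- A diagram whose transform solves the limit equation has its center at the origin. -/
lemma center_eq_zero {α : ℝ} (hα : 0 < α)
    (hM : ∀ᶠ x : ℝ in atTop, trG α c (cCharge c w) x * kerE α (x - trG α c (cCharge c w) x) = 1) :
    c = 0 := by
  set g : ℝ → ℝ := fun x => Real.exp (α * c) * kerR α (x - c) * Real.exp (potR α (cCharge c w) x)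
    with hg
  have hlim := h.tendsto_trG_atTop hα
  have h1 : Tendsto (fun x => Real.exp (-(α * (x - g x)))) atTop (𝓝 0) := by
    have e1 : Tendsto (fun x : ℝ => Real.exp (-(α * x))) atTop (𝓝 0) :=
      Real.tendsto_exp_neg_atTop_nhds_zero.comp (tendsto_id.const_mul_atTop hα)
    have e2 := e1.mul ((Real.continuous_exp.tendsto _).comp (hlim.const_mul α))
    rw [zero_mul] at e2
    refine e2.congr fun x => ?_
    simp only [Function.comp_apply]
    rw [← Real.exp_add]
    congr 1
    simp only [hg]
    ring
  -- The left side of the limit equation tends to e^{αc}, and it is eventually equal to 1.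
  have h2 : Tendsto (fun x => g x * ((1 - Real.exp (-(α * (x - g x)))) / α)) atTop
      (𝓝 (Real.exp (α * c) * α * ((1 - 0) / α))) := hlim.mul ((h1.const_sub 1).div_const α)
  have h3 : Tendsto (fun x => g x * ((1 - Real.exp (-(α * (x - g x)))) / α)) atTop (𝓝 1) := by
    refine tendsto_const_nhds.congr' ?_
    filter_upwards [hM] with x hx
    rw [trG_ofReal_eq hα.ne'] at hx
    rw [kerE, if_neg hα.ne'] at hx
    exact_mod_cast hx.symm
  have h4 := tendsto_nhds_unique h2 h3
  have h5 : Real.exp (α * c) = 1 := by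
    field_simp at h4; linarith
  rw [Real.exp_eq_one_iff] at h5
  rcases mul_eq_zero.1 h5 with h | h
  · linarith
  · exact h

/-- Exponential moments of the charge, from the behaviour of the transform at `+∞`. -/
lemma mul_integral_exp_le_potR_right {α x : ℝ} (hα : 0 < α) (hx : b < x) :
    α ^ 2 * Real.exp (-(α * x)) * ∫ s, Real.exp (α * s) * cCharge c w s ≤ potR α (cCharge c w) x := by
  rw [← integral_const_mul]
  have hc := h.continuous_cCharge
  refine integral_mono_of_nonneg (Eventually.of_forall fun s => ?_) ?_ (Eventually.of_forall fun s => ?_)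
  · have := h.cCharge_nonneg s
    simp only [Pi.zero_apply]
    positivity
  · refine Continuous.integrable_of_hasCompactSupport ?_ (h.hasCompactSupport_cCharge.mul_right)
    rw [continuous_iff_continuousAt]
    intro s
    by_cases hs : s ∈ Icc a b
    · have hne : x - s ≠ 0 := by linarith [hs.2]
      have h1 : ContinuousAt (kerR α) (x - s) := (hasDerivAt_kerR hα.ne' hne).continuousAt
      have h2 : ContinuousAt (fun s => kerR α (x - s)) s := h1.comp (by fun_prop)
      exact hc.continuousAt.mul (h2.mul (h2.sub continuousAt_const))
    · refine (continuousAt_const (y := (0 : ℝ))).congr ?_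
      filter_upwards [isClosed_Icc.isOpen_compl.mem_nhds hs] with t ht
      rw [h.cCharge_eq_zero fun h' => ht (Ioo_subset_Icc_self h'), zero_mul]
  · by_cases h0 : cCharge c w s = 0
    · simp [h0]
    · have hs := h.mem_of_cCharge_ne_zero s h0
      have h1 := le_kerRD_of_pos (y := x - s) hα (by linarith [hs.2])
      have h2 := mul_le_mul_of_nonneg_left h1 (h.cCharge_nonneg s)
      refine le_trans (le_of_eq ?_) h2
      have : Real.exp (-(α * (x - s))) = Real.exp (-(α * x)) * Real.exp (α * s) := by
        rw [← Real.exp_add]; congr 1; ring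
      rw [this]; ring

/-- The mirror image of `mul_integral_exp_le_potR_right`: to the left of the support the kernel is
at least α² e^{α(x-s)}. -/
lemma mul_integral_exp_le_potR_left {α x : ℝ} (hα : 0 < α) (hx : x < a) :
    α ^ 2 * Real.exp (α * x) * ∫ s, Real.exp (-(α * s)) * cCharge c w s ≤ potR α (cCharge c w) x := by
  rw [← integral_const_mul]
  have hc := h.continuous_cCharge
  refine integral_mono_of_nonneg (Eventually.of_forall fun s => ?_) ?_ (Eventually.of_forall fun s => ?_)
  · have := h.cCharge_nonneg s
    simp only [Pi.zero_apply]
    positivity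
  · refine Continuous.integrable_of_hasCompactSupport ?_ (h.hasCompactSupport_cCharge.mul_right)
    rw [continuous_iff_continuousAt]
    intro s
    by_cases hs : s ∈ Icc a b
    · have hne : x - s ≠ 0 := by linarith [hs.1]
      have h1 : ContinuousAt (kerR α) (x - s) := (hasDerivAt_kerR hα.ne' hne).continuousAt
      have h2 : ContinuousAt (fun s => kerR α (x - s)) s := h1.comp (by fun_prop)
      exact hc.continuousAt.mul (h2.mul (h2.sub continuousAt_const))
    · refine (continuousAt_const (y := (0 : ℝ))).congr ?_
      filter_upwards [isClosed_Icc.isOpen_compl.mem_nhds hs] with t ht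
      rw [h.cCharge_eq_zero fun h' => ht (Ioo_subset_Icc_self h'), zero_mul]
  · by_cases h0 : cCharge c w s = 0
    · simp [h0]
    · have hs := h.mem_of_cCharge_ne_zero s h0
      have h1 := le_kerRD_of_neg (y := x - s) hα (by linarith [hs.1])
      have h2 := mul_le_mul_of_nonneg_left h1 (h.cCharge_nonneg s)
      refine le_trans (le_of_eq ?_) h2
      have : Real.exp (α * (x - s)) = Real.exp (α * x) * Real.exp (-(α * s)) := by
        rw [← Real.exp_add]; congr 1; ring
      rw [this]; ring

end IsDiagramWith

end

end QPlancherel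

/-! ### A priori bounds for charges, in particular for solutions of the limit equation. -/

namespace QPlancherel

noncomputable section

namespace IsDiagramWith

variable {a b c : ℝ} {w : ℝ → ℝ} (h : IsDiagramWith a b c w)

include h

lemma cCharge_le_center (s : ℝ) : cCharge c w s ≤ cCharge c w c := by
  rcases le_total s c with hs | hs
  · exact h.monotoneOn_cCharge hs (mem_Iic.2 le_rfl) hs
  · exact h.antitoneOn_cCharge (mem_Ici.2 le_rfl) hs hs

/-- By unimodality the charge is at least its value at s on the whole segment between s and c. -/
lemma mul_cCharge_le_integral (s : ℝ) : |s - c| * cCharge c w s ≤ ∫ t, cCharge c w t := by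
  have hi := h.integrable_cCharge
  have key : ∀ u v : ℝ, u ≤ v → (∀ t ∈ Icc u v, cCharge c w s ≤ cCharge c w t) →
      (v - u) * cCharge c w s ≤ ∫ t, cCharge c w t := by
    intro u v huv hle
    calc (v - u) * cCharge c w s = ∫ t in Icc u v, cCharge c w s := by
          rw [setIntegral_const, measureReal_def, Real.volume_Icc,
            ENNReal.toReal_ofReal (by linarith), smul_eq_mul]
      _ ≤ ∫ t in Icc u v, cCharge c w t :=
          setIntegral_mono_on (integrableOn_const (by simp) (by finiteness)) hi.integrableOn
            measurableSet_Icc hle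
      _ ≤ ∫ t, cCharge c w t :=
          setIntegral_le_integral hi (Eventually.of_forall h.cCharge_nonneg)
  rcases le_total s c with hs | hs
  · rw [abs_of_nonpos (by linarith), neg_sub]
    exact key s c hs fun t ht => h.monotoneOn_cCharge hs ht.2 ht.1
  · rw [abs_of_nonneg (by linarith)]
    exact key c s hs fun t ht => h.antitoneOn_cCharge ht.1 hs ht.2

lemma abs_cCharge_sub_le (s t : ℝ) : |cCharge c w s - cCharge c w t| ≤ |s - t| :=
  abs_sub_le_of_lip h.lip_cCharge s t

/-- The area bounds the value at c - 1, and the Lipschitz property adds at most 1 on the way to the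
peak. -/
lemma cCharge_le (s : ℝ) : cCharge c w s ≤ 1 + ∫ t, cCharge c w t := by
  have h1 := h.mul_cCharge_le_integral (c - 1)
  have h2 := (abs_le.1 (h.abs_cCharge_sub_le c (c - 1))).2
  rw [show c - 1 - c = -1 by ring, abs_neg, abs_one, one_mul] at h1
  rw [show c - (c - 1) = 1 by ring, abs_one] at h2
  linarith [h.cCharge_le_center s]

lemma integrable_exp_mul_cCharge (β : ℝ) :
    Integrable fun s => Real.exp (β * s) * cCharge c w s :=
  (Continuous.mul (by fun_prop) h.continuous_cCharge).integrable_of_hasCompactSupport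
    h.hasCompactSupport_cCharge.mul_left

/-- The charge is small if its left exponential moment is bounded and `α` is large. -/
lemma cCharge_le_of_left_moment {α δ m : ℝ} (hα : 0 ≤ α) (hδ : 0 < δ)
    (hm : ∫ s, Real.exp (-(α * s)) * cCharge c w s ≤ m) (s : ℝ) :
    cCharge c w s ≤ 2 * δ + Real.exp (α * (c - δ)) * m / δ := by
  have hi := h.integrable_cCharge
  have hi2 : Integrable fun s => Real.exp (-(α * s)) * cCharge c w s := by
    simpa using h.integrable_exp_mul_cCharge (-α)
  -- On [c - 2δ, c - δ] the weight e^{-αt} is at least e^{-α(c-δ)} and the charge is at least its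
  -- value at the left end.
  have h1 : δ * cCharge c w (c - 2 * δ) ≤ Real.exp (α * (c - δ)) * m := by
    calc δ * cCharge c w (c - 2 * δ) = ∫ t in Icc (c - 2 * δ) (c - δ), cCharge c w (c - 2 * δ) := by
          rw [setIntegral_const, measureReal_def, Real.volume_Icc,
            ENNReal.toReal_ofReal (by linarith), smul_eq_mul]
          ring
      _ ≤ ∫ t in Icc (c - 2 * δ) (c - δ),
            Real.exp (α * (c - δ)) * (Real.exp (-(α * t)) * cCharge c w t) := by
          refine setIntegral_mono_on (integrableOn_const (by simp) (by finiteness))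
            (hi2.const_mul _).integrableOn measurableSet_Icc fun t ht => ?_
          have e1 : cCharge c w (c - 2 * δ) ≤ cCharge c w t :=
            h.monotoneOn_cCharge (by simp; linarith) (by simp only [mem_Iic]; linarith [ht.2]) ht.1
          have e2 : 1 ≤ Real.exp (α * (c - δ)) * Real.exp (-(α * t)) := by
            rw [← Real.exp_add]
            apply Real.one_le_exp
            nlinarith [ht.2]
          rw [← mul_assoc]
          nlinarith [h.cCharge_nonneg t]
      _ ≤ ∫ t, Real.exp (α * (c - δ)) * (Real.exp (-(α * t)) * cCharge c w t) :=
          setIntegral_le_integral (hi2.const_mul _) (Eventually.of_forall fun t => by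
            have := h.cCharge_nonneg t
            simp only [Pi.zero_apply]
            positivity)
      _ ≤ Real.exp (α * (c - δ)) * m := by
          rw [integral_const_mul]
          gcongr
  have h2 := (abs_le.1 (h.abs_cCharge_sub_le c (c - 2 * δ))).2
  rw [show c - (c - 2 * δ) = 2 * δ by ring, abs_of_pos (by linarith : 0 < 2 * δ)] at h2
  have h3 : cCharge c w (c - 2 * δ) ≤ Real.exp (α * (c - δ)) * m / δ := by
    rw [le_div_iff₀ hδ]; linarith
  linarith [h.cCharge_le_center s]

end IsDiagramWith

namespace IsDiagramWith

variable {a b : ℝ} {w : ℝ → ℝ} (h : IsDiagramWith a b 0 w) {α : ℝ} (hα : 0 < α)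
  (heq : ∀ x ∈ outer α a b,
    trG α 0 (cCharge 0 w) x * kerE α (x - trG α 0 (cCharge 0 w) x) = 1)

include h hα heq

/-- The limit equation at real points. -/
lemma real_limit_eq {x : ℝ} (hx : x ∉ Icc a b) :
    ∃ ρ : ℝ, α * ρ = kerR α x * Real.exp (potR α (cCharge 0 w) x) ∧
      ρ * (1 - Real.exp (-(α * x)) * Real.exp (α ^ 2 * ρ)) = 1 ∧
      Real.exp (potR α (cCharge 0 w) x) = ρ * (1 - Real.exp (-(α * x))) := by
  refine ⟨kerR α x * Real.exp (potR α (cCharge 0 w) x) / α, by field_simp, ?_, ?_⟩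
  · have h1 := heq x (ofReal_mem_outer hx)
    rw [trG_ofReal_eq hα.ne', kerE, if_neg hα.ne'] at h1
    simp only [mul_zero, Real.exp_zero, one_mul, sub_zero] at h1
    set g := kerR α x * Real.exp (potR α (cCharge 0 w) x)
    have h2 : g * ((1 - Real.exp (-(α * (x - g)))) / α) = 1 := by exact_mod_cast h1
    have h3 : Real.exp (-(α * x)) * Real.exp (α ^ 2 * (g / α)) = Real.exp (-(α * (x - g))) := by
      rw [← Real.exp_add]; congr 1; field_simp; ring
    rw [h3]
    linarith [h2, show g / α * (1 - Real.exp (-(α * (x - g))))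
      = g * ((1 - Real.exp (-(α * (x - g)))) / α) by ring]
  · have hx0 : x ≠ 0 := fun h0 => hx (h0 ▸ ⟨h.neg.le, h.pos.le⟩)
    have := one_sub_exp_ne_zero hα.ne' hx0
    unfold kerR
    field_simp

/-- With ρ = G/α and z = e^{-αx} the limit equation gives e^V - 1 = zρ(e^{α²ρ} - 1) for the
potential V. Since α² z times the moment is at most V ≤ e^V - 1, dividing by z and letting x → +∞,
where ρ → 1, gives the bound. -/
lemma integral_exp_right_le :
    ∫ s, Real.exp (α * s) * cCharge 0 w s ≤ (Real.exp (α ^ 2) - 1) / α ^ 2 := by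
  have hlim := h.tendsto_trG_atTop hα
  simp only [mul_zero, Real.exp_zero, one_mul, sub_zero] at hlim
  have hρ := hlim.div_const α
  rw [div_self hα.ne'] at hρ
  have hρ2 : Tendsto (fun x => kerR α x * Real.exp (potR α (cCharge 0 w) x) / α *
      (Real.exp (α ^ 2 * (kerR α x * Real.exp (potR α (cCharge 0 w) x) / α)) - 1)) atTop
      (𝓝 (1 * (Real.exp (α ^ 2 * 1) - 1))) :=
    hρ.mul (((Real.continuous_exp.tendsto _).comp (hρ.const_mul (α ^ 2))).sub_const 1)
  rw [le_div_iff₀ (by positivity)]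
  rw [one_mul, mul_one] at hρ2
  refine ge_of_tendsto hρ2 ?_
  filter_upwards [eventually_gt_atTop b] with x hx
  obtain ⟨ρ, h1, h2, h3⟩ := h.real_limit_eq hα heq (x := x) fun h' => by linarith [h'.2]
  have h4 : kerR α x * Real.exp (potR α (cCharge 0 w) x) / α = ρ := by
    rw [← h1]; field_simp
  rw [h4]
  have h5 := h.mul_integral_exp_le_potR_right hα hx
  have h6 := Real.add_one_le_exp (potR α (cCharge 0 w) x)
  set z := Real.exp (-(α * x))
  have hz : 0 < z := Real.exp_pos _
  have h7 : potR α (cCharge 0 w) x ≤ z * (ρ * (Real.exp (α ^ 2 * ρ) - 1)) := by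
    nlinarith
  have h8 := h5.trans h7
  have h9 : z * ((∫ s, Real.exp (α * s) * cCharge 0 w s) * α ^ 2)
      ≤ z * (ρ * (Real.exp (α ^ 2 * ρ) - 1)) := by linarith
  exact le_of_mul_le_mul_left h9 hz

/-- The comparison is now made at x → -∞, where ρ → 0 through negative values. With u = -α²ρ and ζ =
e^{αx} one has e^V - 1 = (1-ρ)(e^u - 1) ≤ (1-ρ)u e^u = α²ζ(1-ρ)² e^{2u}, and the last factor tends
to 1 after division by α²ζ. That the bound is free of α is what makes the charges small for large α.
-/
lemma integral_exp_left_le : ∫ s, Real.exp (-(α * s)) * cCharge 0 w s ≤ 1 := by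
  have hlim := h.tendsto_trG_atBot hα
  simp only [mul_zero, Real.exp_zero, one_mul, sub_zero] at hlim
  have he : Tendsto (fun x => Real.exp (α * x)) atBot (𝓝 0) :=
    Real.tendsto_exp_atBot.comp (tendsto_id.const_mul_atBot hα)
  have hg : Tendsto (fun x => kerR α x * Real.exp (potR α (cCharge 0 w) x) / α) atBot (𝓝 0) := by
    have h1 := (he.mul hlim).div_const α
    rw [zero_mul, zero_div] at h1
    refine h1.congr fun x => ?_
    rw [← mul_assoc, ← Real.exp_add, add_neg_cancel, Real.exp_zero, one_mul]
  have hρ2 : Tendsto (fun x => (1 - kerR α x * Real.exp (potR α (cCharge 0 w) x) / α) ^ 2 *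
      Real.exp (2 * (-(α ^ 2 * (kerR α x * Real.exp (potR α (cCharge 0 w) x) / α))))) atBot
      (𝓝 ((1 - 0) ^ 2 * Real.exp (2 * (-(α ^ 2 * 0))))) :=
    ((hg.const_sub 1).pow 2).mul
      ((Real.continuous_exp.tendsto _).comp (((hg.const_mul (α ^ 2)).neg).const_mul 2))
  simp only [sub_zero, one_pow, mul_zero, neg_zero, Real.exp_zero, mul_one] at hρ2
  refine ge_of_tendsto hρ2 ?_
  filter_upwards [eventually_lt_atBot a] with x hx
  obtain ⟨ρ, h1, h2, h3⟩ := h.real_limit_eq hα heq (x := x) fun h' => by linarith [h'.1]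
  have h4 : kerR α x * Real.exp (potR α (cCharge 0 w) x) / α = ρ := by
    rw [← h1]; field_simp
  rw [h4]
  have h5 := h.mul_integral_exp_le_potR_left hα hx
  have h6 := Real.add_one_le_exp (potR α (cCharge 0 w) x)
  rw [h3] at h6
  set z := Real.exp (-(α * x)) with hz
  set ζ := Real.exp (α * x) with hζ
  have hzζ : z * ζ = 1 := by rw [hz, hζ, ← Real.exp_add]; simp
  have hζ0 : 0 < ζ := Real.exp_pos _
  have hx0 : x < 0 := hx.trans h.neg
  have hz1 : 1 < z := by
    rw [hz, Real.one_lt_exp_iff]; nlinarith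
  have hρ0 : ρ < 0 := by
    have := Real.exp_pos (potR α (cCharge 0 w) x)
    rw [h3] at this
    by_contra h'
    nlinarith
  set u := -(α ^ 2 * ρ) with hu
  have hu0 : 0 ≤ u := by rw [hu]; nlinarith [sq_nonneg α]
  have heu : Real.exp (α ^ 2 * ρ) * Real.exp u = 1 := by rw [← Real.exp_add, hu]; simp
  have hE : 1 ≤ Real.exp u := Real.one_le_exp hu0
  have h7 : z * ρ = (ρ - 1) * Real.exp u := by
    linear_combination (-Real.exp u) * h2 - z * ρ * heu
  have h8 : Real.exp u - 1 ≤ u * Real.exp u := by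
    have h8' := Real.add_one_le_exp (-u)
    have h8'' : Real.exp (-u) * Real.exp u = 1 := by rw [← Real.exp_add]; simp
    nlinarith
  have h9 : u = α ^ 2 * ζ * ((1 - ρ) * Real.exp u) := by
    linear_combination hu + α ^ 2 * ρ * hzζ - α ^ 2 * ζ * h7
  have h10 : potR α (cCharge 0 w) x ≤ (1 - ρ) * (Real.exp u - 1) := by nlinarith
  have h11 : (1 - ρ) * (Real.exp u - 1) ≤ (1 - ρ) * (u * Real.exp u) :=
    mul_le_mul_of_nonneg_left h8 (by linarith)
  have h12 : (1 - ρ) * (u * Real.exp u)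
      = α ^ 2 * ζ * ((1 - ρ) ^ 2 * Real.exp (2 * u)) := by
    have : Real.exp (2 * u) = Real.exp u * Real.exp u := by rw [← Real.exp_add]; ring_nf
    rw [this]
    linear_combination (1 - ρ) * Real.exp u * h9
  have h13 := h5.trans (h10.trans (h11.trans h12.le))
  exact le_of_mul_le_mul_left h13 (by positivity)

/-- Since cosh(αs) ≥ 1, the area is at most the mean of the two exponential moments. -/
lemma integral_cCharge_le : ∫ s, cCharge 0 w s ≤ Real.exp (α ^ 2) := by
  have h1 := h.integral_exp_right_le hα heq
  have h2 := h.integral_exp_left_le hα heq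
  have i1 := h.integrable_exp_mul_cCharge α
  have i2 : Integrable fun s => Real.exp (-(α * s)) * cCharge 0 w s := by
    simpa using h.integrable_exp_mul_cCharge (-α)
  have h3 : ∫ s, cCharge 0 w s ≤ ∫ s, (1 / 2) *
      (Real.exp (α * s) * cCharge 0 w s + Real.exp (-(α * s)) * cCharge 0 w s) := by
    refine integral_mono h.integrable_cCharge ((i1.add i2).const_mul (1 / 2)) fun s => ?_
    have e1 := Real.add_one_le_exp (α * s)
    have e2 := Real.add_one_le_exp (-(α * s))
    have e3 := h.cCharge_nonneg s
    simp only
    nlinarith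
  rw [integral_const_mul, integral_add i1 i2] at h3
  have h4 : (Real.exp (α ^ 2) - 1) / α ^ 2 ≤ Real.exp (α ^ 2) := by
    rw [div_le_iff₀ (by positivity)]
    have h8' := Real.add_one_le_exp (-α ^ 2)
    have h8'' : Real.exp (-α ^ 2) * Real.exp (α ^ 2) = 1 := by rw [← Real.exp_add]; simp
    nlinarith [Real.exp_pos (α ^ 2)]
  have h5 : 1 ≤ Real.exp (α ^ 2) := Real.one_le_exp (by positivity)
  linarith

end IsDiagramWith

end

end QPlancherel

/-! ### Growing families with a fixed center, and smooth test functions without compact support. -/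

namespace QPlancherel

noncomputable section

namespace IsDiagramWith

variable {a b c a' b' c' : ℝ} {w w' : ℝ → ℝ}

/-- Comparison far to the right gives c' ≤ c, and far to the left c ≤ c'. Hence the center of an
increasing family does not move. -/
lemma center_eq_of_le (h : IsDiagramWith a b c w) (h' : IsDiagramWith a' b' c' w')
    (hle : ∀ s, w s ≤ w' s) : c' = c := by
  have key : ∀ {u : ℝ}, u ∉ Icc a' b' → |u - c| ≤ |u - c'| := fun {u} hu => by
    rw [← h'.out u hu]; exact (h.abs_sub_le u).trans (hle u)
  have h1 := key (u := max b b' + 1) (by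
    simp only [mem_Icc, not_and, not_le]; intro; linarith [le_max_right b b'])
  have h2 := key (u := min a a' - 1) (by
    simp only [mem_Icc, not_and, not_le]; intro; linarith [min_le_right a a'])
  rw [abs_of_pos (by linarith [le_max_left b b', h.mem.2]),
    abs_of_pos (by linarith [le_max_right b b', h'.mem.2])] at h1
  rw [abs_of_neg (by linarith [min_le_left a a', h.mem.1]),
    abs_of_neg (by linarith [min_le_right a a', h'.mem.1])] at h2
  linarith

/-- Outside [a',b'] the smaller diagram is squeezed between |s - c| and w'. This gives one common
interval for all times up to a given one. -/
lemma of_le (h : IsDiagramWith a b c w) (h' : IsDiagramWith a' b' c w') (hle : ∀ s, w s ≤ w' s) :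
    IsDiagramWith a' b' c w :=
  ⟨h'.neg, h'.pos, h.lip, h'.mem, fun s hs =>
    le_antisymm ((hle s).trans_eq (h'.out s hs)) (h.abs_sub_le s)⟩

lemma deriv_charge_eq_zero (h : IsDiagramWith a b c w) {s : ℝ} (hs : s ∉ Icc a b) :
    deriv (charge w) s = 0 := by
  have hab : a ≤ b := h.neg.le.trans h.pos.le
  have key : ∃ k : ℝ, charge w =ᶠ[𝓝 s] fun _ => k := by
    rcases lt_or_ge s a with hsa | hsa
    · refine ⟨c / 2, ?_⟩
      filter_upwards [gt_mem_nhds hsa] with t ht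
      rw [charge, h.out t fun h' => absurd h'.1 (not_le.2 ht),
        abs_of_neg (by linarith [h.mem.1]), abs_of_neg (by linarith [h.neg])]
      ring
    · have hsb : b < s := by
        by_contra h'; exact hs ⟨hsa, not_lt.1 h'⟩
      refine ⟨-c / 2, ?_⟩
      filter_upwards [lt_mem_nhds hsb] with t ht
      rw [charge, h.out t fun h' => absurd h'.2 (not_le.2 ht),
        abs_of_pos (by linarith [h.mem.2]), abs_of_pos (by linarith [h.pos])]
      ring
  obtain ⟨k, hk⟩ := key
  rw [hk.deriv_eq, deriv_const]

end IsDiagramWith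

/-- A growing family of diagrams with center `c`, and the measures `μ t = (∂σ/∂t) ds`, that
satisfies the dynamic equation. -/
structure IsGrowth (α c t₀ : ℝ) (w : ℝ → ℝ → ℝ) (A B : ℝ → ℝ) (μ : ℝ → Measure ℝ) : Prop where
  diag : ∀ t, t₀ ≤ t → IsDiagramWith (A t) (B t) c (w t)
  mono : ∀ s, MonotoneOn (fun t => w t s) (Ici t₀)
  fin : ∀ t, t₀ ≤ t → IsFiniteMeasure (μ t)
  supp : ∀ t, t₀ ≤ t → μ t (Icc (A t) (B t))ᶜ = 0
  deriv : ∀ t, t₀ ≤ t → ∀ φ : ℝ → ℝ, ContDiff ℝ ∞ φ → HasCompactSupport φ →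
    HasDerivWithinAt (fun u => ∫ s, φ s * cCharge c (w u) s) (∫ s, φ s ∂μ t) (Ici t₀) t
  eqn : ∀ t, t₀ ≤ t → ∀ x : ℝ, x ∉ Icc (A t) (B t) → ∫ s, kerR α (x - s) ∂μ t
    = Real.exp (α * c) * kerR α (x - c) * Real.exp (potR α (cCharge c (w t)) x)

/-- The charge relative to the constant center c differs from the charge relative to 0 by a function
independent of t, so the time derivatives are the same. Multiplying the dynamic equation by α turns
(1 - q^y)⁻¹ into `kerR`. -/
lemma SolvesDynamicEquation.exists_isGrowth {q t₀ a b : ℝ} {w : ℝ → ℝ → ℝ}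
    (hq : q ∈ Ioo (0 : ℝ) 1) (h : SolvesDynamicEquation q t₀ w)
    (h0 : InDiagramSpace a b fun s => w s t₀) :
    ∃ c A B μ, IsDiagramWith a b c (fun s => w s t₀) ∧
      IsGrowth (-Real.log q) c t₀ (fun t s => w s t) A B μ := by
  have hα := neg_log_pos hq
  obtain ⟨c, hc⟩ := h0.exists_center
  have key : ∀ t, ∃ A B : ℝ, ∃ μ : Measure ℝ, t₀ ≤ t → IsDiagramWith A B c (fun s => w s t) ∧
      IsFiniteMeasure μ ∧ μ (Icc A B)ᶜ = 0 ∧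
      IsTimeDerivative t₀ (fun s u => charge (fun s' => w s' u) s) t μ ∧
      ∀ x, x ∉ Icc A B → ∫ s in Icc A B, (1 - q ^ (x - s))⁻¹ ∂μ =
        (1 - q ^ x)⁻¹ * Real.exp (-Real.log q⁻¹ *
          ∫ s in Icc A B, (1 - q ^ (x - s))⁻¹ * _root_.deriv (charge (fun s' => w s' t)) s) := by
    intro t
    by_cases ht : t₀ ≤ t
    · obtain ⟨A, B, μ, hd, hr⟩ := h.equation t ht
      obtain ⟨c', hc'⟩ := hd.exists_center
      have : c' = c := hc.center_eq_of_le hc' fun s =>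
        h.increasing s (mem_Ici.2 le_rfl) (mem_Ici.2 ht) ht
      exact ⟨A, B, μ, fun _ => ⟨this ▸ hc', hr⟩⟩
    -- Times before t₀ are never used; the values there are arbitrary.
    · exact ⟨0, 0, 0, fun h' => absurd h' ht⟩
  choose A B μ H using key
  refine ⟨c, A, B, μ, hc, fun t ht => (H t ht).1, h.increasing, fun t ht => (H t ht).2.1,
    fun t ht => (H t ht).2.2.1, fun t ht φ hφ hφc => ?_, fun t ht x hx => ?_⟩
  · have hd := (H t ht).2.2.2.1 φ hφ hφc
    refine (hd.sub_const (∫ s, φ s * ((|s - c| - |s|) / 2))).congr_of_mem (fun u hu => ?_) ht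
    have hint : ∀ g : ℝ → ℝ, Continuous g → Integrable fun s => φ s * g s := fun g hg =>
      (hφ.continuous.mul hg).integrable_of_hasCompactSupport hφc.mul_right
    rw [← integral_sub (hint _ ?_) (hint _ (by fun_prop))]
    · congr 1
      ext s
      simp only [charge, cCharge]
      ring
    · have := (H u hu).1.lip.continuous
      unfold charge
      fun_prop
  · obtain ⟨hd, hf, hs, -, he⟩ := H t ht
    have e1 := hd.trG_ofReal hα hx
    rw [trG_ofReal_eq hα.ne', Complex.ofReal_inj] at e1
    rw [e1]
    have hres : (μ t).restrict (Icc (A t) (B t)) = μ t :=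
      Measure.restrict_eq_self_of_ae_mem (by rwa [ae_iff])
    have e2 := he x hx
    rw [hres, setIntegral_eq_integral_of_forall_compl_eq_zero (fun s hs => by
      rw [hd.deriv_charge_eq_zero hs, mul_zero])] at e2
    have e3 : ∀ y, kerR (-Real.log q) y = -Real.log q * (1 - q ^ y)⁻¹ := fun y => by
      rw [rpow_eq_exp hq.1, kerR, div_eq_mul_inv]
    simp_rw [e3]
    rw [integral_const_mul, e2, Real.log_inv]
    have e4 : ∀ s, _root_.deriv (charge fun s' => w s' t) s * (-Real.log q * (1 - q ^ (x - s))⁻¹)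
        = -Real.log q * ((1 - q ^ (x - s))⁻¹ * _root_.deriv (charge fun s' => w s' t) s) :=
      fun s => by ring
    simp_rw [e4]
    rw [integral_const_mul, mul_assoc]
    congr 3
    ring

namespace IsGrowth

variable {α c t₀ : ℝ} {w : ℝ → ℝ → ℝ} {A B : ℝ → ℝ} {μ : ℝ → Measure ℝ}
  (G : IsGrowth α c t₀ w A B μ)

include G

lemma diag_le {t T : ℝ} (ht : t₀ ≤ t) (hT : t ≤ T) : IsDiagramWith (A T) (B T) c (w t) :=
  (G.diag t ht).of_le (G.diag T (ht.trans hT)) fun s => G.mono s ht (ht.trans hT) hT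

lemma cCharge_mono {t u : ℝ} (ht : t₀ ≤ t) (hu : t ≤ u) (s : ℝ) :
    cCharge c (w t) s ≤ cCharge c (w u) s := by
  have := G.mono s (mem_Ici.2 ht) (mem_Ici.2 (ht.trans hu)) hu
  unfold cCharge
  simp only at this
  linarith

lemma ae_mem {t : ℝ} (ht : t₀ ≤ t) : ∀ᵐ s ∂μ t, s ∈ Icc (A t) (B t) := by
  rw [ae_iff]; exact G.supp t ht

lemma hasDerivWithinAt_integral {t : ℝ} (ht : t₀ ≤ t) {φ : ℝ → ℝ} (hφ : ContDiff ℝ ∞ φ) :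
    HasDerivWithinAt (fun u => ∫ s, φ s * cCharge c (w u) s) (∫ s, φ s ∂μ t) (Ici t₀) t := by
  -- The interval at time t carries μ t. The interval at time t + 1 carries all charges up to that
  -- time by monotonicity, so a cut-off equal to 1 on [-R,R] changes nothing near t.
  set R := |A t| + |B t| + |A (t + 1)| + |B (t + 1)| + 1 with hR
  have hRp : 0 < R := by positivity
  let χ : ContDiffBump (0 : ℝ) := ⟨R, R + 1, hRp, by linarith⟩
  have hχ : ∀ s, |s| ≤ R → χ s = 1 := fun s hs => χ.one_of_mem_closedBall (by
    simpa [Real.dist_eq] using hs)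
  have habs : ∀ {s u v : ℝ}, s ∈ Icc u v → |s| ≤ |u| + |v| := fun {s u v} hs => by
    rw [abs_le]
    constructor <;> linarith [hs.1, hs.2, neg_abs_le u, le_abs_self v, abs_nonneg u, abs_nonneg v]
  have hd := G.deriv t ht (fun s => χ s * φ s) (χ.contDiff.mul hφ) χ.hasCompactSupport.mul_right
  have e1 : ∫ s, χ s * φ s ∂μ t = ∫ s, φ s ∂μ t := by
    refine integral_congr_ae ?_
    filter_upwards [G.ae_mem ht] with s hs
    rw [hχ s (by have := habs hs; have := abs_nonneg (A (t + 1)); have := abs_nonneg (B (t + 1)); linarith),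
      one_mul]
  rw [e1] at hd
  have e2 : ∀ u ∈ Icc t₀ (t + 1), ∫ s, χ s * φ s * cCharge c (w u) s
      = ∫ s, φ s * cCharge c (w u) s := fun u hu => by
    congr 1
    ext s
    by_cases h0 : cCharge c (w u) s = 0
    · rw [h0]; simp
    · have hs := habs ((G.diag_le hu.1 hu.2).mem_of_cCharge_ne_zero s h0)
      rw [hχ s (by have := abs_nonneg (A t); have := abs_nonneg (B t); linarith), one_mul]
  refine hd.congr_of_eventuallyEq ?_ (e2 t ⟨ht, by linarith⟩).symm
  filter_upwards [self_mem_nhdsWithin, nhdsWithin_le_nhds (gt_mem_nhds (show t < t + 1 by linarith))]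
    with u hu hu'
  exact (e2 u ⟨hu, le_of_lt hu'⟩).symm

lemma integrable_mul {t : ℝ} (ht : t₀ ≤ t) {φ : ℝ → ℂ} (hφ : Continuous φ) :
    Integrable fun s => φ s * (cCharge c (w t) s : ℂ) :=
  (hφ.mul (Complex.continuous_ofReal.comp
    (G.diag t ht).continuous_cCharge)).integrable_of_hasCompactSupport
      ((G.diag t ht).hasCompactSupport_cCharge.comp_left (g := fun x : ℝ => (x : ℂ))
        Complex.ofReal_zero).mul_left

lemma integrable_measure {E : Type*} [NormedAddCommGroup E] {t : ℝ} (ht : t₀ ≤ t) {φ : ℝ → E}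
    (hφ : ContinuousOn φ (Icc (A t) (B t))) : Integrable φ (μ t) := by
  have hres : (μ t).restrict (Icc (A t) (B t)) = μ t :=
    Measure.restrict_eq_self_of_ae_mem (G.ae_mem ht)
  have := G.fin t ht
  rw [← hres]
  exact hφ.integrableOn_Icc

lemma hasDerivWithinAt_integral_complex {t : ℝ} (ht : t₀ ≤ t) {φ : ℝ → ℂ} (hφ : ContDiff ℝ ∞ φ) :
    HasDerivWithinAt (fun u => ∫ s, φ s * (cCharge c (w u) s : ℂ)) (∫ s, φ s ∂μ t) (Ici t₀) t := by
  have hre := G.hasDerivWithinAt_integral ht (φ := fun s => (φ s).re) (Complex.reCLM.contDiff.comp hφ)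
  have him := G.hasDerivWithinAt_integral ht (φ := fun s => (φ s).im) (Complex.imCLM.contDiff.comp hφ)
  have h := hre.ofReal_comp.add (him.ofReal_comp.mul_const Complex.I)
  have e0 : ∫ s, φ s ∂μ t = ((∫ s, (φ s).re ∂μ t : ℝ) : ℂ) + ((∫ s, (φ s).im ∂μ t : ℝ) : ℂ) * Complex.I :=
    (integral_re_add_im (𝕜 := ℂ) (G.integrable_measure ht hφ.continuous.continuousOn)).symm
  rw [e0]
  refine h.congr_of_mem (fun u hu => ?_) ht
  have := (integral_re_add_im (𝕜 := ℂ) (G.integrable_mul hu hφ.continuous)).symm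
  simpa using this

end IsGrowth

end

end QPlancherel

/-! ### Consequences of the dynamic equation at one time: mass, exponential moment, sign of `Im G`.
-/

namespace QPlancherel

noncomputable section

namespace IsGrowth

variable {α c t₀ : ℝ} {w : ℝ → ℝ → ℝ} {A B : ℝ → ℝ} {μ : ℝ → Measure ℝ}
  (G : IsGrowth α c t₀ w A B μ)

include G

lemma hasDerivAt_integral_kerK {t : ℝ} (ht : t₀ ≤ t) (hα : 0 ≤ α) {x : ℂ}
    (hx : x ∈ outer α (A t) (B t)) :
    HasDerivAt (fun x : ℂ => ∫ s, kerK α (x - s) ∂μ t) (-∫ s, kerD α (x - s) ∂μ t) x := by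
  have := G.fin t ht
  have h := QPlancherel.hasDerivAt_integral_kerK (f := fun _ => 1) (μ := μ t) (A := Icc (A t) (B t))
    (kernelBddNear_Icc fun s hs => kerE_ne_zero_of_mem_outer hα hx hs) (integrable_const 1)
    ((G.ae_mem ht).mono fun s hs _ => hs)
  simpa using h

/-- The dynamic equation is given at real points; both sides are holomorphic on `outer`, so the
identity theorem carries it into the strip. -/
lemma integral_kerK_eq {t : ℝ} (ht : t₀ ≤ t) (hα : 0 < α) {x : ℂ}
    (hx : x ∈ outer α (A t) (B t)) :
    ∫ s, kerK α (x - s) ∂μ t = trG α c (cCharge c (w t)) x := by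
  have hx0 : ((B t + 1 : ℝ) : ℂ) ∈ outer α (A t) (B t) := Or.inr (by simp)
  refine eqOn_of_eventually_line (isOpen_outer α (A t) (B t)) (isPreconnected_outer hα.le _ _)
    (fun x hx => (G.hasDerivAt_integral_kerK ht hα.le hx).differentiableAt.differentiableWithinAt)
    ((G.diag t ht).differentiableOn_trG hα.le) hx0 ?_ hx
  filter_upwards [lt_mem_nhds (show (-1 : ℝ) < 0 by norm_num)] with r hr
  have hxr : B t + 1 + r ∉ Icc (A t) (B t) := fun h => by linarith [h.2]
  have h1 := G.eqn t ht _ hxr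
  have h2 := trG_ofReal_eq (c := c) hα.ne' (cCharge c (w t)) (B t + 1 + r)
  rw [← h1] at h2
  rw [← Complex.ofReal_add, h2, ← integral_complex_ofReal]
  congr 1
  ext s
  rw [← Complex.ofReal_sub, kerK_ofReal hα.ne']

/-- To the right of the support `kerR` is at least α, and the right side of the dynamic equation
tends to α e^{αc}. -/
lemma mass_le {t : ℝ} (ht : t₀ ≤ t) (hα : 0 < α) : (μ t).real univ ≤ Real.exp (α * c) := by
  have := G.fin t ht
  have h := (G.diag t ht).tendsto_trG_atTop hα
  have h2 : α * (μ t).real univ ≤ Real.exp (α * c) * α := by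
    refine ge_of_tendsto h ?_
    filter_upwards [eventually_gt_atTop (B t)] with x hx
    have hxn : x ∉ Icc (A t) (B t) := fun h => by linarith [h.2]
    rw [← G.eqn t ht x hxn]
    have hcont : ContinuousOn (fun s => kerR α (x - s)) (Icc (A t) (B t)) :=
      (continuousOn_kerR hα.ne').comp (by fun_prop) fun s hs => by
        have := hs.2
        simp only [mem_compl_iff, mem_singleton_iff]
        linarith
    calc α * (μ t).real univ = ∫ _, α ∂μ t := by rw [integral_const, smul_eq_mul, mul_comm]
      _ ≤ _ := by
        refine integral_mono_ae (integrable_const _) (G.integrable_measure ht hcont) ?_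
        filter_upwards [G.ae_mem ht] with s hs
        have hxs : 0 < x - s := by linarith [hs.2]
        have h1 : Real.exp (-(α * (x - s))) < 1 := by
          rw [Real.exp_lt_one_iff]; linarith [mul_pos hα hxs]
        unfold kerR
        rw [le_div_iff₀ (by linarith)]
        nlinarith [Real.exp_pos (-(α * (x - s)))]
  nlinarith

/-- The dynamic equation multiplied by e^{-αx}, as x → -∞. Unlike the mass bound, this one depends
neither on α nor on c. -/
lemma integral_exp_le_one {t : ℝ} (ht : t₀ ≤ t) (hα : 0 < α) :
    ∫ s, Real.exp (-(α * s)) ∂μ t ≤ 1 := by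
  have := G.fin t ht
  have h := (G.diag t ht).tendsto_trG_atBot hα
  have h2 : -α ≤ -(α * ∫ s, Real.exp (-(α * s)) ∂μ t) := by
    refine le_of_tendsto h ?_
    filter_upwards [eventually_lt_atBot (A t)] with x hx
    have hxn : x ∉ Icc (A t) (B t) := fun h => by linarith [h.1]
    rw [← G.eqn t ht x hxn]
    have hcont : ContinuousOn (fun s => kerR α (x - s)) (Icc (A t) (B t)) :=
      (continuousOn_kerR hα.ne').comp (by fun_prop) fun s hs => by
        have := hs.1
        simp only [mem_compl_iff, mem_singleton_iff]
        linarith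
    rw [← integral_const_mul, ← integral_const_mul, ← integral_neg]
    refine integral_mono_ae ((G.integrable_measure ht hcont).const_mul _)
      ((G.integrable_measure ht (by fun_prop)).const_mul _).neg ?_
    filter_upwards [G.ae_mem ht] with s hs
    have hxs : x - s < 0 := by linarith [hs.1]
    have h1 : 1 < Real.exp (-(α * (x - s))) := by
      rw [Real.one_lt_exp_iff]; nlinarith
    have h3 : Real.exp (-(α * s)) = Real.exp (-(α * x)) * (Real.exp (-(α * (x - s))))⁻¹ := by
      rw [← Real.exp_neg, ← Real.exp_add]; congr 1; ring
    rw [h3]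
    have h4 : kerR α (x - s) ≤ -(α * (Real.exp (-(α * (x - s))))⁻¹) := by
      unfold kerR
      rw [div_le_iff_of_neg (by linarith)]
      field_simp
      nlinarith
    calc _ ≤ Real.exp (-(α * x)) * -(α * (Real.exp (-(α * (x - s))))⁻¹) :=
          mul_le_mul_of_nonneg_left h4 (Real.exp_pos _).le
      _ = _ := by ring
  nlinarith

lemma integral_mul_le {φ : ℝ → ℝ} (hφ : ContDiff ℝ ∞ φ) {M : ℝ}
    (hM : ∀ t, t₀ ≤ t → ∫ s, φ s ∂μ t ≤ M) {T : ℝ} (hT : t₀ ≤ T) :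
    ∫ s, φ s * cCharge c (w T) s ≤ (∫ s, φ s * cCharge c (w t₀) s) + M * (T - t₀) := by
  have hd : ∀ t ∈ Icc t₀ T, HasDerivWithinAt (fun u => ∫ s, φ s * cCharge c (w u) s)
      (∫ s, φ s ∂μ t) (Ici t₀) t := fun t ht => G.hasDerivWithinAt_integral ht.1 hφ
  refine image_le_of_deriv_right_le_deriv_boundary
    (f' := fun t => ∫ s, φ s ∂μ t) (B' := fun _ => M)
    (B := fun t => (∫ s, φ s * cCharge c (w t₀) s) + M * (t - t₀))
    (fun t ht => (hd t ht).continuousWithinAt.mono Icc_subset_Ici_self)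
    (fun t ht => (hd t ⟨ht.1, ht.2.le⟩).mono (Ici_subset_Ici.2 ht.1)) (by simp)
    (by fun_prop) (fun t _ => ?_) (fun t ht => hM t ht.1) ⟨hT, le_rfl⟩
  have h1 : HasDerivAt (fun t => M * (t - t₀)) M t := by
    simpa using ((hasDerivAt_id t).sub_const t₀).const_mul M
  exact (h1.const_add _).hasDerivWithinAt

lemma integral_cCharge_le {T : ℝ} (hT : t₀ ≤ T) (hα : 0 < α) :
    ∫ s, cCharge c (w T) s ≤ (∫ s, cCharge c (w t₀) s) + Real.exp (α * c) * (T - t₀) := by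
  have := G.integral_mul_le (φ := fun _ => 1) contDiff_const (M := Real.exp (α * c))
    (fun t ht => by
      have := G.mass_le ht hα
      simpa using this) hT
  simpa using this

lemma integral_exp_mul_cCharge_le {T : ℝ} (hT : t₀ ≤ T) (hα : 0 < α) :
    ∫ s, Real.exp (-(α * s)) * cCharge c (w T) s
      ≤ (∫ s, Real.exp (-(α * s)) * cCharge c (w t₀) s) + (T - t₀) := by
  have := G.integral_mul_le (φ := fun s => Real.exp (-(α * s))) (by fun_prop) (M := 1)
    (fun t ht => G.integral_exp_le_one ht hα) hT
  simpa using this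

/-- By the dynamic equation G is an integral of `kerK`, whose imaginary part is negative on the
strip, against a positive measure. This measure is nonzero because G, a product of nonzero factors,
does not vanish. -/
lemma trG_im_neg {t : ℝ} (ht : t₀ ≤ t) (hα : 0 < α) {x : ℂ} (hx : x ∈ strip α) :
    (trG α c (cCharge c (w t)) x).im < 0 := by
  have hfin := G.fin t ht
  have hxo := strip_subset_outer (A t) (B t) hx
  have hne : ∀ s : ℝ, kerE α (x - s) ≠ 0 := fun s => kerE_ne_zero_of_im hα.le (by simpa using hx.1)
    (by simpa using hx.2.trans (by linarith [Real.pi_pos]))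
  have hcont : ContinuousOn (fun s : ℝ => kerK α (x - s)) (Icc (A t) (B t)) :=
    ContinuousOn.inv₀ ((continuous_kerE α).comp (by fun_prop)).continuousOn fun s _ => hne s
  have hneg : ∀ s : ℝ, (kerK α (x - s)).im < 0 := fun s => by
    rw [kerK_im hα (hne s), neg_lt_zero]
    have h1 : 0 < ‖kerD α (x - s)‖ := by
      rw [norm_pos_iff, kerD_eq (hne s)]
      exact div_ne_zero (Complex.exp_ne_zero _) (pow_ne_zero _ (hne s))
    have h2 : (x - s : ℂ).im = x.im := by simp
    rw [h2]
    exact mul_pos h1 (div_pos (Real.sin_pos_of_pos_of_lt_pi (mul_pos hα hx.1) hx.2) hα)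
  have hint := G.integrable_measure ht hcont
  have h0 : trG α c (cCharge c (w t)) x ≠ 0 := by
    unfold trG
    refine mul_ne_zero (mul_ne_zero ?_ ?_) (Complex.exp_ne_zero _)
    · exact_mod_cast (Real.exp_pos _).ne'
    · exact inv_ne_zero (hne c)
  rw [← G.integral_kerK_eq ht hα hxo] at h0 ⊢
  have him : (∫ s, kerK α (x - s) ∂μ t).im = ∫ s, (kerK α (x - s)).im ∂μ t :=
    (integral_im (𝕜 := ℂ) hint).symm
  rw [him]
  have h1 : 0 < ∫ s, -(kerK α (x - s)).im ∂μ t := by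
    rw [integral_pos_iff_support_of_nonneg (f := fun s : ℝ => -(kerK α (x - s)).im)
      (fun s => by simpa using (hneg s).le) hint.im.neg]
    have : Function.support (fun s : ℝ => -(kerK α (x - s)).im) = univ :=
      eq_univ_of_forall fun s => by simpa using (hneg s).ne
    rw [this]
    by_contra hz
    have : μ t = 0 := Measure.measure_univ_eq_zero.1 (le_antisymm (not_lt.1 hz) bot_le)
    exact h0 (by rw [this]; simp)
  rw [integral_neg] at h1
  linarith

/-- `kerK` is real on this line, because e^{-iπ} = -1. -/
lemma trG_im_eq_zero {t : ℝ} (ht : t₀ ≤ t) (hα : 0 < α) {x : ℂ} (hx : α * x.im = Real.pi) :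
    (trG α c (cCharge c (w t)) x).im = 0 := by
  have hx0 : 0 < x.im := by
    by_contra h
    have := mul_nonpos_of_nonneg_of_nonpos hα.le (not_lt.1 h)
    linarith [Real.pi_pos]
  have hxo : x ∈ outer α (A t) (B t) := Or.inl (Or.inr ⟨hx0, by linarith [Real.pi_pos]⟩)
  have hne : ∀ s : ℝ, kerE α (x - s) ≠ 0 := fun s => kerE_ne_zero_of_im hα.le (by simpa using hx0)
    (by simpa using (by linarith [Real.pi_pos] : α * x.im < 2 * Real.pi))
  rw [← G.integral_kerK_eq ht hα hxo]
  have him : (∫ s, kerK α (x - s) ∂μ t).im = ∫ s, (kerK α (x - s)).im ∂μ t :=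
    (integral_im (𝕜 := ℂ) (G.integrable_measure ht
      (ContinuousOn.inv₀ ((continuous_kerE α).comp (by fun_prop)).continuousOn fun s _ => hne s))).symm
  rw [him]
  refine integral_eq_zero_of_ae (Eventually.of_forall fun s => ?_)
  have h2 : (x - s : ℂ).im = x.im := by simp
  simp [kerK_im hα (hne s), h2, hx]

end IsGrowth

end

end QPlancherel

/-! ### The Burgers equation and its characteristics. -/

namespace QPlancherel

noncomputable section

lemma norm_kerD_sub_le {α η : ℝ} (hα : 0 ≤ α) (hη : 0 < η) :
    ∃ C, 0 ≤ C ∧ ∀ y z : ℂ, η ≤ y.im → α * y.im ≤ Real.pi → η ≤ z.im → α * z.im ≤ Real.pi →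
      ‖kerD α y - kerD α z‖ ≤ C * ‖y - z‖ := by
  set M := (Real.pi / (2 * η)) ^ 2 with hM
  have hM0 : 0 ≤ M := sq_nonneg _
  refine ⟨M * (2 * (M + 1 + α) + α), by positivity, fun y z h1 h2 h3 h4 => ?_⟩
  have hconv : Convex ℝ {x : ℂ | η ≤ x.im ∧ α * x.im ≤ Real.pi} := by
    intro x hx y hy a b ha hb hab
    have him : (a • x + b • y).im = a * x.im + b * y.im := by simp
    simp only [mem_ofPred_eq] at hx hy ⊢
    rw [him]
    constructor
    · calc η = a * η + b * η := by rw [← add_mul, hab, one_mul]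
        _ ≤ _ := add_le_add (mul_le_mul_of_nonneg_left hx.1 ha) (mul_le_mul_of_nonneg_left hy.1 hb)
    · calc α * (a * x.im + b * y.im) = a * (α * x.im) + b * (α * y.im) := by ring
        _ ≤ a * Real.pi + b * Real.pi :=
          add_le_add (mul_le_mul_of_nonneg_left hx.2 ha) (mul_le_mul_of_nonneg_left hy.2 hb)
        _ = Real.pi := by rw [← add_mul, hab, one_mul]
  refine hconv.norm_image_sub_le_of_norm_hasDerivWithin_le
    (f' := fun x => -(kerD α x * (2 * kerK α x - α)))
    (fun x hx => (hasDerivAt_kerD (kerE_ne_zero_of_im hα (hη.trans_le hx.1)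
      (hx.2.trans_lt (by linarith [Real.pi_pos])))).hasDerivWithinAt) (fun x hx => ?_) ⟨h3, h4⟩ ⟨h1, h2⟩
  have hD := norm_kerD_le_of_le_im hα hη hx.1 hx.2
  have hK := norm_kerK_le (y := x) hα
  rw [norm_neg, norm_mul]
  refine mul_le_mul hD ?_ (norm_nonneg _) hM0
  refine (norm_sub_le _ _).trans ?_
  rw [norm_mul, Complex.norm_ofNat, Complex.norm_real, Real.norm_eq_abs, abs_of_nonneg hα]
  linarith

lemma contDiff_kerD_line {α : ℝ} {x : ℂ} (hx : ∀ s : ℝ, kerE α (x - s) ≠ 0) :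
    ContDiff ℝ ∞ fun s : ℝ => kerD α (x - s) := by
  have hE : ContDiff ℝ ∞ fun s : ℝ => kerE α (x - s) := by
    unfold kerE
    have h0 : ContDiff ℝ ∞ fun s : ℝ => (x - s : ℂ) := contDiff_const.sub Complex.ofRealCLM.contDiff
    split_ifs with h
    · exact h0
    · exact (contDiff_const.sub (contDiff_const.mul h0).neg.cexp).div_const _
  have hK : ContDiff ℝ ∞ fun s : ℝ => kerK α (x - s) := hE.inv hx
  exact hK.mul (hK.sub contDiff_const)

namespace IsGrowth

variable {α c t₀ : ℝ} {w : ℝ → ℝ → ℝ} {A B : ℝ → ℝ} {μ : ℝ → Measure ℝ}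
  (G : IsGrowth α c t₀ w A B μ)

include G

/-- The family is monotone in time, so the L¹ distance is the difference of the areas, and the area
is continuous in t. -/
lemma integral_abs_sub_tendsto {t : ℝ} (ht : t₀ ≤ t) :
    Tendsto (fun u => ∫ s, |cCharge c (w u) s - cCharge c (w t) s|) (𝓝[Ici t₀] t) (𝓝 0) := by
  have h1 := (G.hasDerivWithinAt_integral ht (φ := fun _ => 1) contDiff_const).continuousWithinAt
  have h2 : Tendsto (fun u => |(∫ s, (1 : ℝ) * cCharge c (w u) s) - ∫ s, (1 : ℝ) * cCharge c (w t) s|)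
      (𝓝[Ici t₀] t) (𝓝 0) := by
    have := (h1.tendsto.sub_const (∫ s, (1 : ℝ) * cCharge c (w t) s)).abs
    simpa using this
  refine h2.congr' ?_
  filter_upwards [self_mem_nhdsWithin] with u hu
  simp only [one_mul]
  have iu := (G.diag u hu).integrable_cCharge
  have it := (G.diag t ht).integrable_cCharge
  rw [← integral_sub iu it]
  rcases le_total t u with h | h
  · have h0 : ∀ s, 0 ≤ cCharge c (w u) s - cCharge c (w t) s := fun s =>
      sub_nonneg.2 (G.cCharge_mono ht h s)
    rw [abs_of_nonneg (integral_nonneg h0)]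
    exact integral_congr_ae (Eventually.of_forall fun s => (abs_of_nonneg (h0 s)).symm)
  · have h0 : ∀ s, cCharge c (w u) s - cCharge c (w t) s ≤ 0 := fun s =>
      sub_nonpos.2 (G.cCharge_mono hu h s)
    rw [abs_of_nonpos (integral_nonpos h0), ← integral_neg]
    exact integral_congr_ae (Eventually.of_forall fun s => (abs_of_nonpos (h0 s)).symm)

/-- The derivative of the potential along a moving point. -/
lemma hasDerivWithinAt_potential (hα : 0 ≤ α) {S : Set ℝ} (hS : S ⊆ Ici t₀) {t : ℝ} (ht : t ∈ S)
    {X : ℝ → ℂ} {v : ℂ} (hX : HasDerivWithinAt X v S t) {η : ℝ} (hη : 0 < η)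
    (hXS : ∀ u ∈ S, η ≤ (X u).im ∧ α * (X u).im ≤ Real.pi) :
    HasDerivWithinAt (fun u => ∫ s, (cCharge c (w u) s : ℂ) * kerD α (X u - s))
      ((∫ s, kerD α (X t - s) ∂μ t) + (∫ s, (cCharge c (w t) s : ℂ)
        * -(kerD α (X t - s) * (2 * kerK α (X t - s) - α))) * v) S t := by
  have ht0 : t₀ ≤ t := hS ht
  have hne : ∀ u ∈ S, ∀ s : ℝ, kerE α (X u - s) ≠ 0 := fun u hu s =>
    kerE_ne_zero_of_im hα (by simpa using hη.trans_le (hXS u hu).1)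
      (by simpa using (hXS u hu).2.trans_lt (by linarith [Real.pi_pos]))
  have d1 := (G.hasDerivWithinAt_integral_complex ht0 (contDiff_kerD_line (hne t ht))).mono hS
  have d2 := (hasDerivAt_integral_kerD (f := cCharge c (w t)) (μ := volume) (A := Icc (A t) (B t))
    (kernelBddNear_Icc fun s _ => hne t ht s) (G.diag t ht0).integrable_cCharge
    (Eventually.of_forall (G.diag t ht0).mem_of_cCharge_ne_zero)).comp_hasDerivWithinAt t hX
  obtain ⟨C, hC, hlip⟩ := norm_kerD_sub_le hα hη
  -- The mixed second difference, the only obstacle to adding the two partial derivatives. It is o(u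
  -- - t), because the charge difference tends to 0 in L¹ and the kernel difference is O(u - t).
  let R : ℝ → ℂ := fun u => ∫ s, ((cCharge c (w u) s - cCharge c (w t) s : ℝ) : ℂ)
    * (kerD α (X u - s) - kerD α (X t - s))
  have hRb : ∀ u ∈ S, ‖R u‖ ≤ C * (∫ s, |cCharge c (w u) s - cCharge c (w t) s|) * ‖X u - X t‖ := by
    intro u hu
    have hi : Integrable fun s => cCharge c (w u) s - cCharge c (w t) s :=
      (G.diag u (hS hu)).integrable_cCharge.sub (G.diag t ht0).integrable_cCharge
    have : C * (∫ s, |cCharge c (w u) s - cCharge c (w t) s|) * ‖X u - X t‖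
        = ∫ s, |cCharge c (w u) s - cCharge c (w t) s| * (C * ‖X u - X t‖) := by
      rw [integral_mul_const]; ring
    rw [this]
    refine norm_integral_le_of_norm_le (hi.abs.mul_const _) (Eventually.of_forall fun s => ?_)
    rw [norm_mul, Complex.norm_real, Real.norm_eq_abs]
    refine mul_le_mul_of_nonneg_left ?_ (abs_nonneg _)
    refine (hlip _ _ (by simpa using (hXS u hu).1) (by simpa using (hXS u hu).2)
      (by simpa using (hXS t ht).1) (by simpa using (hXS t ht).2)).trans_eq ?_
    congr 2
    ring
  have hRt : R t = 0 := by simp [R]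
  have d3 : HasDerivWithinAt R 0 S t := by
    rw [hasDerivWithinAt_iff_isLittleO, hRt]
    simp only [sub_zero, smul_zero]
    have o1 : (fun u => C * ∫ s, |cCharge c (w u) s - cCharge c (w t) s|)
        =o[𝓝[S] t] fun _ => (1 : ℝ) := by
      rw [Asymptotics.isLittleO_one_iff]
      simpa using ((G.integral_abs_sub_tendsto ht0).mono_left (nhdsWithin_mono t hS)).const_mul C
    have o2 : (fun u => ‖X u - X t‖) =O[𝓝[S] t] fun u => u - t := hX.hasFDerivWithinAt.isBigO_sub.norm_left
    have o3 := o1.mul_isBigO o2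
    simp only [one_mul] at o3
    refine Asymptotics.IsBigO.trans_isLittleO (Asymptotics.IsBigO.of_bound 1 ?_) o3
    filter_upwards [self_mem_nhdsWithin] with u hu
    rw [one_mul]
    exact (hRb u hu).trans (le_abs_self _)
  have d := ((d1.add d2).add d3).sub_const
    (∫ s, (cCharge c (w t) s : ℂ) * kerD α (X t - s))
  rw [add_zero] at d
  refine d.congr_of_mem (fun u hu => ?_) ht
  have hcD : ∀ u ∈ S, Continuous fun s : ℝ => kerD α (X u - s) := fun u hu =>
    (contDiff_kerD_line (hne u hu)).continuous
  have i1 : ∀ u' ∈ S, ∀ u ∈ S, Integrable fun s : ℝ => (cCharge c (w u') s : ℂ) * kerD α (X u - s) :=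
    fun u' hu' u hu => (G.integrable_mul (hS hu') (hcD u hu)).congr
      (Eventually.of_forall fun s => mul_comm _ _)
  have e1 : ∫ s : ℝ, kerD α (X t - s) * (cCharge c (w u) s : ℂ)
      = ∫ s, (cCharge c (w u) s : ℂ) * kerD α (X t - s) := by simp_rw [mul_comm]
  simp only [Pi.add_apply, Function.comp_apply, R]
  rw [e1, ← integral_add (i1 u hu t ht) (i1 t ht u hu), ← integral_add, ← integral_sub _ (i1 t ht t ht)]
  · congr 1
    ext s
    push_cast
    ring
  · refine ((i1 u hu t ht).add (i1 t ht u hu)).add ?_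
    refine (((i1 u hu u hu).sub (i1 u hu t ht)).sub ((i1 t ht u hu).sub (i1 t ht t ht))).congr
      (Eventually.of_forall fun s => ?_)
    simp only [Pi.sub_apply]
    push_cast
    ring
  · exact (i1 u hu t ht).add (i1 t ht u hu)
  · refine (((i1 u hu u hu).sub (i1 u hu t ht)).sub ((i1 t ht u hu).sub (i1 t ht t ht))).congr
      (Eventually.of_forall fun s => ?_)
    simp only [Pi.sub_apply]
    push_cast
    ring

/-- The dynamic equation gives ∂G/∂x = -∫ `kerD` dμ, and the exponential form of G gives ∂G/∂t = G ∫
`kerD` dμ. Along a path of velocity v the two combine with the factor G - v, which vanishes on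
characteristics. -/
lemma hasDerivWithinAt_trG (hα : 0 < α) {S : Set ℝ} (hS : S ⊆ Ici t₀) {t : ℝ} (ht : t ∈ S)
    {X : ℝ → ℂ} {v : ℂ} (hX : HasDerivWithinAt X v S t) {η : ℝ} (hη : 0 < η)
    (hXS : ∀ u ∈ S, η ≤ (X u).im ∧ α * (X u).im ≤ Real.pi) :
    HasDerivWithinAt (fun u => trG α c (cCharge c (w u)) (X u))
      ((trG α c (cCharge c (w t)) (X t) - v) * ∫ s, kerD α (X t - s) ∂μ t) S t := by
  have ht0 : t₀ ≤ t := hS ht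
  have hne : ∀ s : ℝ, kerE α (X t - s) ≠ 0 := fun s =>
    kerE_ne_zero_of_im hα.le (by simpa using hη.trans_le (hXS t ht).1)
      (by simpa using (hXS t ht).2.trans_lt (by linarith [Real.pi_pos]))
  have hout : X t ∈ outer α (A t) (B t) :=
    Or.inl (Or.inr ⟨hη.trans_le (hXS t ht).1, (hXS t ht).2.trans_lt (by linarith [Real.pi_pos])⟩)
  set D := ∫ s, kerD α (X t - s) ∂μ t with hD
  set I := ∫ s, (cCharge c (w t) s : ℂ) * kerD α (X t - s) with hI
  set J := ∫ s, (cCharge c (w t) s : ℂ) * -(kerD α (X t - s) * (2 * kerK α (X t - s) - α)) with hJ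
  have hKid : HasDerivAt (fun x : ℂ => Real.exp (α * c) * kerK α (x - c))
      (Real.exp (α * c) * -kerD α (X t - c)) (X t) :=
    ((hasDerivAt_kerK (hne c)).comp_sub_const (X t) c).const_mul _
  -- the derivative in `x` at the fixed time `t`, computed in two ways
  have f1 : HasDerivAt (trG α c (cCharge c (w t))) (-D) (X t) := by
    refine (G.hasDerivAt_integral_kerK ht0 hα.le hout).congr_of_eventuallyEq ?_
    filter_upwards [(isOpen_outer α (A t) (B t)).mem_nhds hout] with x hx
    exact (G.integral_kerK_eq ht0 hα hx).symm
  have f2 : HasDerivAt (trG α c (cCharge c (w t)))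
      (Real.exp (α * c) * -kerD α (X t - c) * Complex.exp I
        + Real.exp (α * c) * kerK α (X t - c) * (Complex.exp I * J)) (X t) :=
    hKid.mul (hasDerivAt_integral_kerD (f := cCharge c (w t)) (μ := volume) (A := Icc (A t) (B t))
      (kernelBddNear_Icc fun s _ => hne s) (G.diag t ht0).integrable_cCharge
      (Eventually.of_forall (G.diag t ht0).mem_of_cCharge_ne_zero)).cexp
  have hu := f1.unique f2
  have d := (hKid.comp_hasDerivWithinAt t hX).mul
    (G.hasDerivWithinAt_potential hα.le hS ht hX hη hXS).cexp
  refine d.congr_deriv ?_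
  have hGt : trG α c (cCharge c (w t)) (X t)
      = Real.exp (α * c) * kerK α (X t - c) * Complex.exp I := rfl
  rw [hGt]
  simp only [Function.comp_apply]
  rw [← hD, ← hI, ← hJ]
  linear_combination (-v) * hu

lemma norm_integral_kerD_le {t : ℝ} (ht : t₀ ≤ t) (hα : 0 < α) {η : ℝ} (hη : 0 < η) {x : ℂ}
    (h1 : η ≤ x.im) (h2 : α * x.im ≤ Real.pi) :
    ‖∫ s, kerD α (x - s) ∂μ t‖ ≤ (Real.pi / (2 * η)) ^ 2 * Real.exp (α * c) := by
  have := G.fin t ht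
  refine (norm_integral_le_of_norm_le_const (C := (Real.pi / (2 * η)) ^ 2)
    (Eventually.of_forall fun s => ?_)).trans
    (mul_le_mul_of_nonneg_left (G.mass_le ht hα) (sq_nonneg _))
  exact norm_kerD_le_of_le_im hα.le hη (by simpa using h1) (by simpa using h2)

/-- The transform is constant along the characteristics. -/
theorem trG_characteristic {T : ℝ} (hT : t₀ ≤ T) (hα : 0 < α) {x : ℂ} (hx : x ∈ strip α) :
    let y := x - (T - t₀) * trG α c (cCharge c (w T)) x
    x.im ≤ y.im ∧ α * y.im < Real.pi ∧
      trG α c (cCharge c (w t₀)) y = trG α c (cCharge c (w T)) x := by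
  have hg := G.trG_im_neg hT hα hx
  set g := trG α c (cCharge c (w T)) x with hgdef
  let X : ℝ → ℂ := fun u => x - ((T - u : ℝ) : ℂ) * g
  have hXim : ∀ u, (X u).im = x.im - (T - u) * g.im := fun u => by
    simp [X]
  have hXd : ∀ u, HasDerivAt X g u := fun u => by
    have h1 : HasDerivAt (fun u : ℝ => ((T - u : ℝ) : ℂ)) ((-1 : ℝ) : ℂ) u :=
      ((hasDerivAt_id u).const_sub T).ofReal_comp
    refine ((h1.mul_const g).const_sub x).congr_deriv ?_
    simp
  have hXT : X T = x := by simp [X]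
  have hge : ∀ u, u ≤ T → x.im ≤ (X u).im := fun u hu => by
    rw [hXim]
    have := mul_nonpos_of_nonneg_of_nonpos (sub_nonneg.2 hu) hg.le
    linarith
  -- X moves with the constant velocity g. The value G(X) satisfies a linear equation with bounded
  -- coefficient of which the constant g is a solution, and both agree at T; backward uniqueness
  -- gives equality as long as X stays in the closed strip.
  have key : ∀ t₁ ∈ Icc t₀ T, α * (X t₁).im ≤ Real.pi → trG α c (cCharge c (w t₁)) (X t₁) = g := by
    intro t₁ ht₁ hle
    have hS : Icc t₁ T ⊆ Ici t₀ := fun u hu => ht₁.1.trans hu.1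
    have hXS : ∀ u ∈ Icc t₁ T, x.im ≤ (X u).im ∧ α * (X u).im ≤ Real.pi := fun u hu => by
      refine ⟨hge u hu.2, le_trans (mul_le_mul_of_nonneg_left ?_ hα.le) hle⟩
      rw [hXim, hXim]
      have := mul_nonneg_of_nonpos_of_nonpos (sub_nonpos.2 hu.1) hg.le
      linarith
    have hd : ∀ t ∈ Icc t₁ T, HasDerivWithinAt (fun u => trG α c (cCharge c (w u)) (X u))
        ((trG α c (cCharge c (w t)) (X t) - g) * ∫ s, kerD α (X t - s) ∂μ t) (Icc t₁ T) t :=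
      fun t ht => G.hasDerivWithinAt_trG hα hS ht (hXd t).hasDerivWithinAt hx.1 hXS
    refine ODE_solution_unique_of_mem_Icc_left
      (v := fun t y => (y - g) * ∫ s, kerD α (X t - s) ∂μ t) (s := fun _ => univ)
      (K := ⟨(Real.pi / (2 * x.im)) ^ 2 * Real.exp (α * c), by positivity⟩)
      (f := fun u => trG α c (cCharge c (w u)) (X u)) (g := fun _ => g)
      (a := t₁) (b := T) (fun t ht => ?_)
      (fun t ht => (hd t ht).continuousWithinAt) (fun t ht => ?_) (fun _ _ => mem_univ _)
      continuousOn_const (fun t _ => ?_) (fun _ _ => mem_univ _) ?_ ⟨le_rfl, ht₁.2⟩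
    · have ht' : t ∈ Icc t₁ T := Ioc_subset_Icc_self ht
      refine LipschitzOnWith.of_dist_le_mul fun y _ z _ => ?_
      rw [dist_eq_norm, dist_eq_norm, ← sub_mul, norm_mul, mul_comm, sub_sub_sub_cancel_right]
      exact mul_le_mul_of_nonneg_right
        (G.norm_integral_kerD_le (hS ht') hα hx.1 (hXS t ht').1 (hXS t ht').2) (norm_nonneg _)
    · have h1 := hd t (Ioc_subset_Icc_self ht)
      refine h1.mono_of_mem_nhdsWithin ?_
      exact mem_of_superset (Ioc_mem_nhdsLE ht.1 |> fun h => h)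
        (fun u hu => ⟨hu.1.le, hu.2.trans ht.2⟩)
    · simpa using hasDerivWithinAt_const t (Iic t) g
    · simp only [hXT, ← hgdef]
  -- If X reached the upper edge, it would do so at the time T - d. There G is real, but it also
  -- equals g, whose imaginary part is negative.
  have hlt : α * (X t₀).im < Real.pi := by
    by_contra hcon
    have hcon := not_lt.1 hcon
    have hgp : 0 < -g.im := by linarith
    set d := (Real.pi / α - x.im) / (-g.im) with hd
    have hd0 : 0 ≤ d := by
      refine div_nonneg ?_ hgp.le
      rw [sub_nonneg, le_div_iff₀ hα, mul_comm]
      exact hx.2.le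
    have hdg : d * -g.im = Real.pi / α - x.im := div_mul_cancel₀ _ hgp.ne'
    have him : α * (X (T - d)).im = Real.pi := by
      rw [hXim]
      have : x.im - (T - (T - d)) * g.im = Real.pi / α := by linarith
      rw [this]
      field_simp
    have hdT : d ≤ T - t₀ := by
      rw [hd, div_le_iff₀ hgp]
      rw [hXim] at hcon
      have : Real.pi / α ≤ x.im - (T - t₀) * g.im := by rwa [div_le_iff₀ hα, mul_comm]
      linarith
    have hmem : T - d ∈ Icc t₀ T := ⟨by linarith, by linarith⟩
    have h1 := key (T - d) hmem him.le
    have h2 := G.trG_im_eq_zero hmem.1 hα him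
    rw [h1] at h2
    exact hg.ne h2
  have hXt : X t₀ = x - (T - t₀) * g := by simp [X]
  intro y
  have hy : y = X t₀ := hXt.symm
  rw [hy]
  exact ⟨hge t₀ hT, hlt, key t₀ ⟨le_rfl, hT⟩ hlt.le⟩

end IsGrowth

end

end QPlancherel

/-! ### Compactness: asymptotic solutions of the limit equation with the same parameters are close.
-/

namespace QPlancherel

noncomputable section

lemma integrable_inv_sq_add_sq (x : ℝ) {h : ℝ} (hh : 0 < h) :
    Integrable fun s : ℝ => ((x - s) ^ 2 + h ^ 2)⁻¹ := by
  have h1 := ((integrable_inv_one_add_sq.comp_div hh.ne').comp_sub_left x).const_mul (h ^ 2)⁻¹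
  refine h1.congr (Eventually.of_forall fun s => ?_)
  simp only
  rw [← mul_inv]
  congr 1
  field_simp
  ring

/-- Fatou's lemma. It is needed because the supports may grow without bound along the sequence. -/
lemma integrable_of_tendsto_of_integral_le {f : ℕ → ℝ → ℝ} {g : ℝ → ℝ} {M : ℝ}
    (hf : ∀ n, Integrable (f n)) (h0 : ∀ n s, 0 ≤ f n s) (hM : ∀ n, ∫ s, f n s ≤ M)
    (hg : ∀ s, Tendsto (fun n => f n s) atTop (𝓝 (g s))) (hgc : Continuous g) : Integrable g := by
  have hg0 : ∀ s, 0 ≤ g s := fun s => ge_of_tendsto' (hg s) fun n => h0 n s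
  refine ⟨hgc.aestronglyMeasurable, ?_⟩
  rw [hasFiniteIntegral_iff_ofReal (Eventually.of_forall hg0)]
  have e1 : ∀ s, ENNReal.ofReal (g s) = liminf (fun n => ENNReal.ofReal (f n s)) atTop := fun s =>
    ((ENNReal.continuous_ofReal.tendsto _).comp (hg s)).liminf_eq.symm
  simp_rw [e1]
  refine (lintegral_liminf_le' fun n => (hf n).aemeasurable.ennreal_ofReal).trans_lt ?_
  refine lt_of_le_of_lt (b := ENNReal.ofReal M) ?_ ENNReal.ofReal_lt_top
  refine (liminf_le_liminf (v := fun _ => ENNReal.ofReal M) (Eventually.of_forall fun n => ?_)).trans_eq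
    (liminf_const _)
  rw [← ofReal_integral_eq_lintegral_ofReal (hf n) (Eventually.of_forall (h0 n))]
  exact ENNReal.ofReal_le_ofReal (hM n)

/-- Equicontinuity extends convergence from the rationals to all points, so a countable product of
intervals suffices for compactness. -/
lemma exists_limit_of_lipschitz {f : ℕ → ℝ → ℝ} (hf : ∀ n s t, |f n s - f n t| ≤ |s - t|)
    {g : ℚ → ℝ} (hg : ∀ r : ℚ, Tendsto (fun n => f n r) atTop (𝓝 (g r))) :
    ∃ G : ℝ → ℝ, (∀ s, Tendsto (fun n => f n s) atTop (𝓝 (G s))) ∧ ∀ s t, |G s - G t| ≤ |s - t| := by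
  have key : ∀ s, ∃ L, Tendsto (fun n => f n s) atTop (𝓝 L) := fun s => by
    refine cauchySeq_tendsto_of_complete (Metric.cauchySeq_iff'.2 fun ε hε => ?_)
    obtain ⟨r, hr⟩ := exists_rat_btwn (show s < s + ε / 4 by linarith)
    have hrs : |s - r| ≤ ε / 4 := by rw [abs_le]; constructor <;> linarith [hr.1, hr.2]
    obtain ⟨N, hN⟩ := Metric.cauchySeq_iff'.1 (hg r).cauchySeq (ε / 4) (by linarith)
    refine ⟨N, fun n hn => ?_⟩
    have h1 := hN n hn
    rw [Real.dist_eq] at h1 ⊢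
    have h2 := hf n s r
    have h3 := hf N r s
    rw [abs_sub_comm (r : ℝ) s] at h3
    have e : f n s - f N s = (f n s - f n r) + (f n r - f N r) + (f N r - f N s) := by ring
    rw [e]
    refine (abs_add_three _ _ _).trans_lt ?_
    linarith
  choose G hG using key
  exact ⟨G, hG, fun s t => le_of_tendsto' ((hG s).sub (hG t)).abs fun n => hf n s t⟩

/-- A sequence of diagrams whose transforms satisfy the limit equation asymptotically. -/
structure IsApproxSeq (α c : ℕ → ℝ) (W : ℕ → ℝ → ℝ) : Prop where
  pos : ∀ n, 0 < α n
  diag : ∀ n, ∃ a b, IsDiagramWith a b (c n) (W n)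
  center : Tendsto c atTop (𝓝 0)
  bound : ∀ A, ∃ M, ∀ᶠ n in atTop, α n ≤ A → ∫ s, cCharge (c n) (W n) s ≤ M
  small : ∀ δ > 0, ∃ A, ∀ᶠ n in atTop, A ≤ α n → ∀ s, cCharge (c n) (W n) s ≤ δ
  eqn : ∃ κ : ℕ → ℝ, Tendsto κ atTop (𝓝 1) ∧ ∀ X : ℂ, 0 < X.im → ∃ Z : ℕ → ℂ,
    Tendsto Z atTop (𝓝 1) ∧ ∀ᶠ n in atTop, X ∈ strip (α n) →
      trG (α n) (c n) (cCharge (c n) (W n)) X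
        * kerE (α n) (X - κ n * trG (α n) (c n) (cCharge (c n) (W n)) X - c n)
      = Complex.exp (α n * c n) * Z n

namespace IsApproxSeq

variable {α c : ℕ → ℝ} {W : ℕ → ℝ → ℝ} (H : IsApproxSeq α c W)

include H

lemma comp {φ : ℕ → ℕ} (hφ : Tendsto φ atTop atTop) :
    IsApproxSeq (α ∘ φ) (c ∘ φ) (W ∘ φ) where
  pos _ := H.pos _
  diag _ := H.diag _
  center := H.center.comp hφ
  bound A := let ⟨M, hM⟩ := H.bound A; ⟨M, hφ.eventually hM⟩
  small δ hδ := let ⟨A, hA⟩ := H.small δ hδ; ⟨A, hφ.eventually hA⟩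
  eqn := let ⟨κ, h1, h2⟩ := H.eqn
    ⟨κ ∘ φ, h1.comp hφ, fun X hX => let ⟨Z, h3, h4⟩ := h2 X hX
      ⟨Z ∘ φ, h3.comp hφ, hφ.eventually h4⟩⟩

lemma charge_nonneg (n : ℕ) (s : ℝ) : 0 ≤ cCharge (c n) (W n) s := by
  obtain ⟨a, b, h⟩ := H.diag n
  exact h.cCharge_nonneg s

lemma charge_lip (n : ℕ) (s t : ℝ) :
    |cCharge (c n) (W n) s - cCharge (c n) (W n) t| ≤ |s - t| := by
  obtain ⟨a, b, h⟩ := H.diag n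
  exact h.abs_cCharge_sub_le s t

/-- Dominated convergence in the potential: the charges are bounded by 1 + M, and the kernels by a
majorant independent of n. The kernels are jointly continuous in α and the point, so the case a = 0
needs no separate treatment. -/
lemma limit_equation {a M : ℝ} (ha : Tendsto α atTop (𝓝 a))
    (hM : ∀ n, ∫ s, cCharge (c n) (W n) s ≤ M) {e : ℝ → ℝ}
    (he : ∀ s, Tendsto (fun n => cCharge (c n) (W n) s) atTop (𝓝 (e s))) (hc : Continuous e) :
    Integrable e ∧ ∀ x ∈ strip a, trG a 0 e x * kerE a (x - trG a 0 e x) = 1 := by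
  have ha0 : 0 ≤ a := ge_of_tendsto' ha fun n => (H.pos n).le
  have hint : ∀ n, Integrable (cCharge (c n) (W n)) := fun n => by
    obtain ⟨a, b, h⟩ := H.diag n
    exact h.integrable_cCharge
  refine ⟨integrable_of_tendsto_of_integral_le hint H.charge_nonneg hM he hc, fun x hx => ?_⟩
  have hstrip : ∀ᶠ n in atTop, x ∈ strip (α n) := by
    have : Tendsto (fun n => α n * x.im) atTop (𝓝 (a * x.im)) := ha.mul_const _
    filter_upwards [this.eventually_lt_const hx.2] with n hn using ⟨hx.1, hn⟩
  have hne : ∀ s : ℝ, kerE a (x - s) ≠ 0 := fun s => kerE_ne_zero_of_im ha0 (by simpa using hx.1)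
    (by simpa using hx.2.trans (by linarith [Real.pi_pos]))
  -- With this width `norm_kerD_le` gives the majorant 1/((Re x - s)² + h²).
  set h := 2 * x.im / Real.pi with hh
  have hh0 : 0 < h := div_pos (mul_pos two_pos hx.1) Real.pi_pos
  have hI : Tendsto (fun n => ∫ s, (cCharge (c n) (W n) s : ℂ) * kerD (α n) (x - s)) atTop
      (𝓝 (∫ s, (e s : ℂ) * kerD a (x - s))) := by
    refine tendsto_integral_filter_of_dominated_convergence
      (fun s => (1 + M) * ((x.re - s) ^ 2 + h ^ 2)⁻¹) (Eventually.of_forall fun n =>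
        aestronglyMeasurable_weight_mul (hint n) (measurable_kerD _) x) ?_
      ((integrable_inv_sq_add_sq _ hh0).const_mul _) (Eventually.of_forall fun s => ?_)
    · filter_upwards [hstrip] with n hn
      refine Eventually.of_forall fun s => ?_
      obtain ⟨a', b', hd⟩ := H.diag n
      rw [norm_mul, Complex.norm_real, Real.norm_eq_abs, abs_of_nonneg (H.charge_nonneg n s)]
      refine mul_le_mul ((hd.cCharge_le s).trans (by linarith [hM n])) ?_ (norm_nonneg _)
        (by
          have : 0 ≤ ∫ s, cCharge (c n) (W n) s := integral_nonneg (H.charge_nonneg n)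
          linarith [hM n])
      have := norm_kerD_le (y := x - s) (H.pos n).le (by simpa using hn.1) (by simpa using hn.2.le)
      rw [← one_div, le_div_iff₀ (by positivity)]
      simpa using this
    · exact ((Complex.continuous_ofReal.tendsto _).comp (he s)).mul
        (tendsto_kerD ha tendsto_const_nhds (hne s))
  have hcc : Tendsto (fun n => (c n : ℂ)) atTop (𝓝 0) :=
    (Complex.continuous_ofReal.tendsto 0).comp H.center
  have haa : Tendsto (fun n => (α n : ℂ)) atTop (𝓝 a) :=
    (Complex.continuous_ofReal.tendsto a).comp ha
  have hac : Tendsto (fun n => Complex.exp (α n * c n)) atTop (𝓝 1) := by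
    have := (Complex.continuous_exp.tendsto _).comp (haa.mul hcc)
    simpa [Function.comp_def] using this
  have hG : Tendsto (fun n => trG (α n) (c n) (cCharge (c n) (W n)) x) atTop (𝓝 (trG a 0 e x)) := by
    have hE0 : kerE a (x - 0) ≠ 0 := by simpa using hne 0
    have hexp : Tendsto (fun n => ((Real.exp (α n * c n) : ℝ) : ℂ)) atTop
        (𝓝 ((Real.exp (a * 0) : ℝ) : ℂ)) := by
      simpa using hac
    have h2 := (hexp.mul (tendsto_kerK ha ((tendsto_const_nhds (x := x)).sub hcc) hE0)).mul
      ((Complex.continuous_exp.tendsto _).comp hI)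
    have e0 : trG a 0 e x = ((Real.exp (a * 0) : ℝ) : ℂ) * kerK a (x - 0)
        * Complex.exp (∫ s, (e s : ℂ) * kerD a (x - s)) := by
      simp [trG]
    rw [e0]
    exact h2
  obtain ⟨κ, hκ, hZ⟩ := H.eqn
  obtain ⟨Z, hZ1, hZ2⟩ := hZ x hx.1
  have hκ' : Tendsto (fun n => (κ n : ℂ)) atTop (𝓝 1) := by
    simpa [Function.comp_def] using (Complex.continuous_ofReal.tendsto 1).comp hκ
  have hL := hG.mul (tendsto_kerE ha (((tendsto_const_nhds (x := x)).sub (hκ'.mul hG)).sub hcc))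
  have hR := hac.mul hZ1
  have := tendsto_nhds_unique_of_eventuallyEq hL hR (by
    filter_upwards [hstrip, hZ2] with n h1 h2 using h2 h1)
  simpa using this

end IsApproxSeq

/-- Suppose that the difference is at least ε at points S n along a subsequence. Then α n stays
bounded, since both charges are small otherwise, and S n stays bounded, since the charges decay away
from the centers. A further subsequence of parameters, points and charges converges, both limits
solve the same limit equation, and `charge_unique` contradicts the gap. -/
lemma IsApproxSeq.asymptotically_eq {α c₁ c₂ : ℕ → ℝ} {W₁ W₂ : ℕ → ℝ → ℝ}
    (H₁ : IsApproxSeq α c₁ W₁) (H₂ : IsApproxSeq α c₂ W₂) {ε : ℝ} (hε : 0 < ε) :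
    ∀ᶠ n in atTop, ∀ s, |W₁ n s - W₂ n s| < ε := by
  by_contra hcon
  obtain ⟨φ, hφ, hbad⟩ := extraction_of_frequently_atTop (not_eventually.1 hcon)
  replace H₁ := H₁.comp hφ.tendsto_atTop
  replace H₂ := H₂.comp hφ.tendsto_atTop
  have hbad' : ∀ n, ∃ s, ε ≤ |W₁ (φ n) s - W₂ (φ n) s| := fun n => by
    have := hbad n
    push Not at this
    exact this
  choose S hS using hbad'
  have hdiff : ∀ n s, |W₁ (φ n) s - W₂ (φ n) s| ≤ |c₁ (φ n)| + |c₂ (φ n)|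
      + 2 * |cCharge (c₁ (φ n)) (W₁ (φ n)) s - cCharge (c₂ (φ n)) (W₂ (φ n)) s| := fun n s => by
    have e : W₁ (φ n) s - W₂ (φ n) s = (|s - c₁ (φ n)| - |s - c₂ (φ n)|)
        + 2 * (cCharge (c₁ (φ n)) (W₁ (φ n)) s - cCharge (c₂ (φ n)) (W₂ (φ n)) s) := by
      unfold cCharge; ring
    rw [e]
    refine (abs_add_le _ _).trans ?_
    rw [abs_mul, abs_two]
    have h1 := abs_abs_sub_abs_le (s - c₁ (φ n)) (s - c₂ (φ n))
    have h2 : s - c₁ (φ n) - (s - c₂ (φ n)) = c₂ (φ n) - c₁ (φ n) := by ring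
    rw [h2] at h1
    have h3 := abs_sub (c₂ (φ n)) (c₁ (φ n))
    linarith
  have hc : ∀ᶠ n in atTop, |c₁ (φ n)| + |c₂ (φ n)| < min (ε / 2) 1 := by
    have := H₁.center.abs.add H₂.center.abs
    simp only [abs_zero, add_zero] at this
    exact this.eventually_lt_const (by positivity)
  -- the charges differ by at least `ε / 4` at `S n`
  have hgap : ∀ᶠ n in atTop,
      ε / 4 < |cCharge (c₁ (φ n)) (W₁ (φ n)) (S n) - cCharge (c₂ (φ n)) (W₂ (φ n)) (S n)| := by
    filter_upwards [hc] with n hn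
    have h1 := hdiff n (S n)
    have h2 := hS n
    have h3 := min_le_left (ε / 2) 1
    linarith
  obtain ⟨A₁, hA₁⟩ := H₁.small (ε / 8) (by linarith)
  obtain ⟨A₂, hA₂⟩ := H₂.small (ε / 8) (by linarith)
  set A := max A₁ A₂ with hA
  -- Beyond both thresholds the two charges lie in [0, ε/8], too close to each other for a gap of
  -- ε/4.
  have hαA : ∀ᶠ n in atTop, α (φ n) ≤ A := by
    filter_upwards [hA₁, hA₂, hgap] with n h1 h2 h3
    by_contra hlt
    push Not at hlt
    have h4 := h1 ((le_max_left _ _).trans hlt.le) (S n)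
    have h5 := h2 ((le_max_right _ _).trans hlt.le) (S n)
    have h6 := H₁.charge_nonneg n (S n)
    have h7 := H₂.charge_nonneg n (S n)
    simp only [Function.comp_apply] at h4 h5 h6 h7
    rcases lt_abs.1 h3 with h | h <;> linarith
  obtain ⟨M₁, hM₁⟩ := H₁.bound A
  obtain ⟨M₂, hM₂⟩ := H₂.bound A
  set M := max M₁ M₂ with hM
  have hMev : ∀ᶠ n in atTop, ∫ s, cCharge (c₁ (φ n)) (W₁ (φ n)) s ≤ M ∧
      ∫ s, cCharge (c₂ (φ n)) (W₂ (φ n)) s ≤ M := by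
    filter_upwards [hαA, hM₁, hM₂] with n h1 h2 h3
    exact ⟨(h2 h1).trans (le_max_left _ _), (h3 h1).trans (le_max_right _ _)⟩
  -- A point beyond R is at distance at least 8|M|/ε from a center in (-1,1), where the area bound
  -- keeps the charge below ε/8.
  set R := 1 + 8 * |M| / ε with hR
  have hSR : ∀ᶠ n in atTop, S n ∈ Icc (-R) R := by
    filter_upwards [hMev, hgap, hc] with n h1 h2 h3
    refine abs_le.1 ?_
    by_contra hlt
    push Not at hlt
    have hb : ∀ {cc : ℝ} {WW : ℝ → ℝ}, |cc| < 1 → (∃ a b, IsDiagramWith a b cc WW) →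
        ∫ s, cCharge cc WW s ≤ M → cCharge cc WW (S n) ≤ ε / 8 := by
      rintro cc WW hcc ⟨a, b, hd⟩ hle
      have h4 := hd.mul_cCharge_le_integral (S n)
      have h5 : 8 * |M| / ε ≤ |S n - cc| := by
        have := abs_sub_abs_le_abs_sub (S n) cc
        linarith
      have h5' : 0 < |S n - cc| := by
        have := abs_sub_abs_le_abs_sub (S n) cc
        have : 0 ≤ 8 * |M| / ε := by positivity
        linarith
      rw [div_le_iff₀ hε] at h5
      have h6 : |S n - cc| * cCharge cc WW (S n) ≤ |S n - cc| * (ε / 8) :=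
        h4.trans (hle.trans ((le_abs_self M).trans (by linarith)))
      exact le_of_mul_le_mul_left h6 h5'
    have hmin := min_le_right (ε / 2) 1
    have h4 := hb (cc := c₁ (φ n)) (WW := W₁ (φ n)) (by linarith [abs_nonneg (c₂ (φ n))]) (H₁.diag n) h1.1
    have h5 := hb (cc := c₂ (φ n)) (WW := W₂ (φ n)) (by linarith [abs_nonneg (c₁ (φ n))]) (H₂.diag n) h1.2
    have h6 := H₁.charge_nonneg n (S n)
    have h7 := H₂.charge_nonneg n (S n)
    simp only [Function.comp_apply] at h4 h5 h6 h7
    rcases lt_abs.1 h2 with h | h <;> linarith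
  obtain ⟨N, hN⟩ := eventually_atTop.1 ((hαA.and hMev).and (hSR.and hgap))
  have hψ0 : Tendsto (fun n : ℕ => n + N) atTop atTop := tendsto_add_atTop_nat N
  -- a subsequence along which everything converges
  set e₁ : ℕ → ℝ → ℝ := fun n => cCharge (c₁ (φ (n + N))) (W₁ (φ (n + N))) with he₁
  set e₂ : ℕ → ℝ → ℝ := fun n => cCharge (c₂ (φ (n + N))) (W₂ (φ (n + N))) with he₂
  have hbd₁ : ∀ n s, e₁ n s ∈ Icc 0 (1 + M) := fun n s => by
    obtain ⟨a, b, hd⟩ := H₁.diag (n + N)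
    exact ⟨hd.cCharge_nonneg s, (hd.cCharge_le s).trans
      (add_le_add le_rfl (hN (n + N) (Nat.le_add_left _ _)).1.2.1)⟩
  have hbd₂ : ∀ n s, e₂ n s ∈ Icc 0 (1 + M) := fun n s => by
    obtain ⟨a, b, hd⟩ := H₂.diag (n + N)
    exact ⟨hd.cCharge_nonneg s, (hd.cCharge_le s).trans
      (add_le_add le_rfl (hN (n + N) (Nat.le_add_left _ _)).1.2.2)⟩
  have hpi : IsCompact (univ.pi fun _ : ℚ => Icc (0 : ℝ) (1 + M)) :=
    isCompact_univ_pi fun _ => isCompact_Icc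
  obtain ⟨⟨⟨a, Sl⟩, g₁, g₂⟩, -, ψ, hψ, hlim⟩ :=
    (((isCompact_Icc (a := (0 : ℝ)) (b := A)).prod (isCompact_Icc (a := -R) (b := R))).prod
      (hpi.prod hpi)).tendsto_subseq (x := fun n =>
        ((α (φ (n + N)), S (n + N)), (fun r : ℚ => e₁ n r), (fun r : ℚ => e₂ n r)))
      fun n => ⟨⟨⟨(H₁.pos (n + N)).le, (hN (n + N) (Nat.le_add_left _ _)).1.1⟩,
        (hN (n + N) (Nat.le_add_left _ _)).2.1⟩, fun r _ => hbd₁ n r, fun r _ => hbd₂ n r⟩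
  have hla := ((continuous_fst.comp continuous_fst).tendsto _).comp hlim
  have hlS := ((continuous_snd.comp continuous_fst).tendsto _).comp hlim
  have hl1 := ((continuous_fst.comp continuous_snd).tendsto _).comp hlim
  have hl2 := ((continuous_snd.comp continuous_snd).tendsto _).comp hlim
  simp only [Function.comp_def] at hla hlS hl1 hl2
  rw [tendsto_pi_nhds] at hl1 hl2
  replace H₁ := (H₁.comp hψ0).comp hψ.tendsto_atTop
  replace H₂ := (H₂.comp hψ0).comp hψ.tendsto_atTop
  obtain ⟨G₁, hG₁, hG₁l⟩ := exists_limit_of_lipschitz (f := fun n => e₁ (ψ n))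
    (fun n s t => H₁.charge_lip n s t) hl1
  obtain ⟨G₂, hG₂, hG₂l⟩ := exists_limit_of_lipschitz (f := fun n => e₂ (ψ n))
    (fun n s t => H₂.charge_lip n s t) hl2
  have hcont : ∀ {G : ℝ → ℝ}, (∀ s t, |G s - G t| ≤ |s - t|) → Continuous G := fun {G} hG =>
    (LipschitzWith.of_dist_le_mul (K := 1) fun s t => by
      simpa [Real.dist_eq] using hG s t).continuous
  obtain ⟨hi₁, hq₁⟩ := H₁.limit_equation (M := M) hla
    (fun n => (hN (ψ n + N) (Nat.le_add_left _ _)).1.2.1) hG₁ (hcont hG₁l)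
  obtain ⟨hi₂, hq₂⟩ := H₂.limit_equation (M := M) hla
    (fun n => (hN (ψ n + N) (Nat.le_add_left _ _)).1.2.2) hG₂ (hcont hG₂l)
  have ha0 : 0 ≤ a := ge_of_tendsto' hla fun n => (H₁.pos n).le
  -- The limit parameter a may be 0, where the equation is G(x)(x - G(x)) = 1.
  have hGG := charge_unique ha0 hi₁ hi₂ (hcont hG₁l) (hcont hG₂l) hq₁ hq₂
  have hmove : ∀ {f : ℕ → ℝ → ℝ} {G : ℝ → ℝ}, (∀ n s t, |f n s - f n t| ≤ |s - t|) →
      (∀ s, Tendsto (fun n => f n s) atTop (𝓝 (G s))) →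
      Tendsto (fun n => f n (S (ψ n + N))) atTop (𝓝 (G Sl)) := fun {f G} hf hG => by
    have h1 : Tendsto (fun n => f n (S (ψ n + N)) - f n Sl) atTop (𝓝 0) := by
      refine squeeze_zero_norm (a := fun n => |S (ψ n + N) - Sl|) (fun n => hf n _ _) ?_
      have := (hlS.sub_const Sl).abs
      simpa using this
    simpa using h1.add (hG Sl)
  have hfin := ((hmove (fun n s t => H₁.charge_lip n s t) hG₁).sub
    (hmove (fun n s t => H₂.charge_lip n s t) hG₂)).abs
  rw [hGG, sub_self, abs_zero] at hfin
  have := ge_of_tendsto' hfin fun n => (hN (ψ n + N) (Nat.le_add_left _ _)).2.2.le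
  linarith

end

end QPlancherel

/-! ### Rescaling: solutions of the dynamic equation and exact solutions are both `IsApproxSeq`. -/

namespace QPlancherel

noncomputable section

section Rescaling

variable {a b c l : ℝ} {w : ℝ → ℝ}

lemma IsDiagramWith.rescale (h : IsDiagramWith a b c w) (hl : 0 < l) :
    IsDiagramWith (a / l) (b / l) (c / l) fun s => 1 / l * w (s * l) := by
  refine ⟨div_neg_of_neg_of_pos h.neg hl, div_pos h.pos hl, ?_, ⟨?_, ?_⟩, fun s hs => ?_⟩
  · refine LipschitzWith.of_dist_le_mul fun s t => ?_
    have h1 := abs_sub_le_of_lip h.lip (s * l) (t * l)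
    rw [Real.dist_eq, Real.dist_eq, NNReal.coe_one, one_mul, ← mul_sub, abs_mul,
      abs_of_pos (one_div_pos.2 hl)]
    rw [← sub_mul, abs_mul, abs_of_pos hl] at h1
    calc _ ≤ 1 / l * (|s - t| * l) := mul_le_mul_of_nonneg_left h1 (one_div_pos.2 hl).le
      _ = _ := by field_simp
  · exact div_le_div_of_nonneg_right h.mem.1 hl.le
  · exact div_le_div_of_nonneg_right h.mem.2 hl.le
  · have : s * l ∉ Icc a b := fun hm => hs ⟨(div_le_iff₀ hl).2 hm.1, (le_div_iff₀ hl).2 hm.2⟩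
    rw [h.out _ this]
    have e : s * l - c = (s - c / l) * l := by field_simp
    rw [e, abs_mul, abs_of_pos hl]
    field_simp

lemma cCharge_rescale (hl : 0 < l) (s : ℝ) :
    cCharge (c / l) (fun s => 1 / l * w (s * l)) s = cCharge c w (s * l) / l := by
  unfold cCharge
  have e : s * l - c = (s - c / l) * l := by field_simp
  rw [e, abs_mul, abs_of_pos hl]
  field_simp

/-- The kernels are homogeneous when α scales inversely to length. This is why q is replaced by its
power 1/√t. -/
lemma trG_rescale {α : ℝ} (hl : 0 < l) (X : ℂ) :
    trG α (c / l) (cCharge (c / l) fun s => 1 / l * w (s * l)) X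
      = l * trG (α / l) c (cCharge c w) (l * X) := by
  have hlc : (l : ℂ) ≠ 0 := by exact_mod_cast hl.ne'
  unfold trG
  have e1 : α * (c / l) = α / l * c := by ring
  have e2 : (l : ℂ) * X - c = l * (X - (c / l : ℝ)) := by
    push_cast; field_simp
  rw [e1, e2, kerK_scale hl]
  have e3 : ∫ s, ((cCharge (c / l) (fun s => 1 / l * w (s * l)) s : ℝ) : ℂ) * kerD α (X - s)
      = ∫ s, (cCharge c w s : ℂ) * kerD (α / l) (l * X - s) := by
    have h := Measure.integral_comp_mul_right
      (fun s => (cCharge c w s : ℂ) * kerD (α / l) (l * X - s)) l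
    have h2 : ∀ s : ℝ, (cCharge c w (s * l) : ℂ) * kerD (α / l) (l * X - (s * l : ℝ))
        = (l⁻¹ : ℝ) • (((cCharge (c / l) (fun s => 1 / l * w (s * l)) s : ℝ) : ℂ) * kerD α (X - s)) := by
      intro s
      have e4 : (l : ℂ) * X - (s * l : ℝ) = l * (X - s) := by push_cast; ring
      rw [e4, kerD_scale hl, cCharge_rescale hl, Complex.real_smul]
      push_cast
      field_simp
    simp_rw [h2] at h
    rw [integral_smul, abs_of_pos (inv_pos.2 hl)] at h
    exact smul_right_injective ℂ (inv_pos.2 hl).ne' h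
  rw [e3]
  field_simp

lemma integral_cCharge_rescale (hl : 0 < l) :
    ∫ s, cCharge (c / l) (fun s => 1 / l * w (s * l)) s = (∫ s, cCharge c w s) / l ^ 2 := by
  simp_rw [cCharge_rescale hl]
  rw [integral_div, Measure.integral_comp_mul_right (fun s => cCharge c w s) l,
    abs_of_pos (inv_pos.2 hl), smul_eq_mul]
  field_simp

lemma integral_exp_mul_cCharge_rescale {α : ℝ} (hl : 0 < l) :
    ∫ s, Real.exp (-(α * s)) * cCharge (c / l) (fun s => 1 / l * w (s * l)) s
      = (∫ s, Real.exp (-(α / l * s)) * cCharge c w s) / l ^ 2 := by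
  have h := Measure.integral_comp_mul_right (fun s => Real.exp (-(α / l * s)) * cCharge c w s) l
  rw [abs_of_pos (inv_pos.2 hl), smul_eq_mul] at h
  have e : ∀ s, Real.exp (-(α * s)) * cCharge (c / l) (fun s => 1 / l * w (s * l)) s
      = (Real.exp (-(α / l * (s * l))) * cCharge c w (s * l)) / l := fun s => by
    rw [cCharge_rescale hl]
    have : α / l * (s * l) = α * s := by field_simp
    rw [this]; ring
  simp_rw [e]
  rw [integral_div, h]
  field_simp

lemma IsDiagramWith.cCharge_le_sub (h : IsDiagramWith a b c w) (s : ℝ) :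
    cCharge c w s ≤ b - a := by
  have hab : a < b := h.neg.trans h.pos
  by_cases hs : s ∈ Ioo a b
  · have h1 := h.abs_cCharge_sub_le s a
    rw [h.cCharge_eq_zero (s := a) (by simp), sub_zero, abs_of_pos (sub_pos.2 hs.1)] at h1
    linarith [le_abs_self (cCharge c w s), hs.2]
  · rw [h.cCharge_eq_zero hs]; linarith

lemma IsDiagramWith.integral_mul_cCharge_le (h : IsDiagramWith a b c w) {φ : ℝ → ℝ} {K : ℝ}
    (hφ : Continuous φ) (hK : ∀ s ∈ Icc a b, φ s ≤ K) (hK0 : 0 ≤ K) :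
    ∫ s, φ s * cCharge c w s ≤ K * (b - a) ^ 2 := by
  have hab : 0 < b - a := by linarith [h.neg, h.pos]
  have hint : Integrable fun s => φ s * cCharge c w s :=
    (hφ.mul h.continuous_cCharge).integrable_of_hasCompactSupport h.hasCompactSupport_cCharge.mul_left
  rw [← setIntegral_eq_integral_of_forall_compl_eq_zero (s := Icc a b) fun s hs => by
    rw [h.cCharge_eq_zero fun h' => hs (Ioo_subset_Icc_self h'), mul_zero]]
  calc ∫ s in Icc a b, φ s * cCharge c w s ≤ ∫ s in Icc a b, K * (b - a) := by
        refine setIntegral_mono_on hint.integrableOn continuousOn_const.integrableOn_Icc measurableSet_Icc fun s hs => ?_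
        have h0 := h.cCharge_nonneg s
        have h1 := h.cCharge_le_sub s
        exact (mul_le_mul_of_nonneg_right (hK s hs) h0).trans (mul_le_mul_of_nonneg_left h1 hK0)
    _ = K * (b - a) ^ 2 := by
        rw [setIntegral_const, Real.volume_real_Icc_of_le (by linarith), smul_eq_mul]
        ring

end Rescaling

lemma exp_neg_le_of_div_le {x y : ℝ} (hx : 0 < x) (hy : 1 / x ≤ y) : Real.exp (-y) ≤ x := by
  rw [Real.exp_neg]
  have h1 : y ≤ Real.exp y := by linarith [Real.add_one_le_exp y]
  have h2 : 0 < 1 / x := one_div_pos.2 hx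
  calc (Real.exp y)⁻¹ ≤ (1 / x)⁻¹ := inv_anti₀ h2 (hy.trans h1)
    _ = x := by simp

/-- Area and left exponential moment grow at most linearly in time, hence are bounded after division
by t n; at time t₀ they are controlled by the common interval [a,b]. The asymptotic limit equation
is the constancy of G along characteristics, with the initial transform written out. -/
theorem IsGrowth.isApproxSeq {a b t₀ : ℝ} {α c t : ℕ → ℝ} {A B : ℕ → ℝ → ℝ}
    {W : ℕ → ℝ → ℝ → ℝ} {μ : ℕ → ℝ → Measure ℝ} (hα : ∀ n, 0 < α n) (ht : Tendsto t atTop atTop)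
    (ht1 : ∀ n, 1 ≤ t n) (ht0 : ∀ n, t₀ ≤ t n) (h0 : ∀ n, IsDiagramWith a b (c n) (W n t₀))
    (G : ∀ n, IsGrowth (α n / √(t n)) (c n) t₀ (W n) (A n) (B n) (μ n)) :
    IsApproxSeq α (fun n => c n / √(t n)) (fun n s => 1 / √(t n) * W n (t n) (s * √(t n))) := by
  have htp : ∀ n, 0 < t n := fun n => one_pos.trans_le (ht1 n)
  have hl : ∀ n, 0 < √(t n) := fun n => Real.sqrt_pos.2 (htp n)
  have hl1 : ∀ n, 1 ≤ √(t n) := fun n => by rw [Real.one_le_sqrt]; exact ht1 n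
  have hl2 : ∀ n, √(t n) ^ 2 = t n := fun n => Real.sq_sqrt (htp n).le
  have hlt : Tendsto (fun n => √(t n)) atTop atTop := Real.tendsto_sqrt_atTop.comp ht
  have hα' : ∀ n, 0 < α n / √(t n) := fun n => div_pos (hα n) (hl n)
  have hneg := (h0 0).neg
  have hpos := (h0 0).pos
  set C := |a| + |b| with hC
  have hcC : ∀ n, |c n| ≤ C := fun n => by
    have := (h0 n).mem
    rw [abs_le]; constructor <;>
      linarith [this.1, this.2, neg_abs_le a, le_abs_self b, abs_nonneg a, abs_nonneg b]
  have hC0 : 0 ≤ C := by positivity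
  have hctend : ∀ K : ℝ, Tendsto (fun n => K / √(t n)) atTop (𝓝 0) := fun K =>
    tendsto_const_nhds.div_atTop hlt
  have hT : ∀ n, (t n - t₀) / t n ≤ 1 + |t₀| := fun n => by
    rw [div_le_iff₀ (htp n)]
    have := neg_abs_le t₀
    nlinarith [ht1 n, abs_nonneg t₀]
  have harea0 : ∀ n, ∫ s, cCharge (c n) (W n t₀) s ≤ (b - a) ^ 2 := fun n => by
    simpa using (h0 n).integral_mul_cCharge_le (φ := fun _ => 1) (K := 1) continuous_const
      (fun _ _ => le_rfl) zero_le_one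
  refine ⟨hα, fun n => ⟨_, _, ((G n).diag (t n) (ht0 n)).rescale (hl n)⟩, ?_, fun K => ?_,
    fun δ hδ => ?_, ?_⟩
  · refine squeeze_zero_norm (fun n => ?_) (hctend C)
    rw [Real.norm_eq_abs, abs_div, abs_of_pos (hl n)]
    exact div_le_div_of_nonneg_right (hcC n) (hl n).le
  · refine ⟨(b - a) ^ 2 + Real.exp (|K| * C) * (1 + |t₀|), Eventually.of_forall fun n hn => ?_⟩
    rw [integral_cCharge_rescale (hl n), hl2]
    have h1 := (G n).integral_cCharge_le (ht0 n) (hα' n)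
    have h2 : Real.exp (α n / √(t n) * c n) ≤ Real.exp (|K| * C) := by
      refine Real.exp_le_exp.2 ?_
      have h3 : α n / √(t n) ≤ |K| := (div_le_self (hα n).le (hl1 n)).trans (hn.trans (le_abs_self K))
      calc _ ≤ α n / √(t n) * C :=
            mul_le_mul_of_nonneg_left ((le_abs_self _).trans (hcC n)) (hα' n).le
        _ ≤ _ := mul_le_mul_of_nonneg_right h3 hC0
    have h3 : (∫ s, cCharge (c n) (W n (t n)) s) / t n
        ≤ ((b - a) ^ 2 + Real.exp (|K| * C) * (t n - t₀)) / t n :=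
      div_le_div_of_nonneg_right (h1.trans (add_le_add (harea0 n)
        (mul_le_mul_of_nonneg_right h2 (sub_nonneg.2 (ht0 n))))) (htp n).le
    refine h3.trans ?_
    rw [add_div, mul_div_assoc]
    exact add_le_add (div_le_self (sq_nonneg _) (ht1 n))
      (mul_le_mul_of_nonneg_left (hT n) (Real.exp_pos _).le)
  · set K := (b - a) ^ 2 + 1 + |t₀| with hK
    have hK0 : 0 < K := by positivity
    set δ₁ := δ / 3 with hδ₁
    have hδ₁0 : 0 < δ₁ := by positivity
    have hev : ∀ᶠ n in atTop, (C + |a|) / √(t n) < δ₁ / 2 :=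
      (hctend _).eventually_lt_const (by positivity)
    -- Above this threshold e^{-αδ₁/2} ≤ δ₁²/K; the other half of the exponent absorbs the rescaled
    -- centers and |a|. The two terms of `cCharge_le_of_left_moment` are then at most 2δ₁ and δ₁,
    -- with sum δ.
    refine ⟨2 / δ₁ * (1 / (δ₁ ^ 2 / K)), ?_⟩
    filter_upwards [hev] with n hn hA s
    have hm : ∫ s, Real.exp (-(α n * s)) * cCharge (c n / √(t n))
        (fun s => 1 / √(t n) * W n (t n) (s * √(t n))) s ≤ Real.exp (α n * (|a| / √(t n))) * K := by
      rw [integral_exp_mul_cCharge_rescale (hl n), hl2]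
      have h1 := (G n).integral_exp_mul_cCharge_le (ht0 n) (hα' n)
      have h2 := (h0 n).integral_mul_cCharge_le (φ := fun s => Real.exp (-(α n / √(t n) * s)))
        (K := Real.exp (α n * (|a| / √(t n)))) (by fun_prop) (fun s hs => by
          refine Real.exp_le_exp.2 ?_
          have : α n * (|a| / √(t n)) = α n / √(t n) * |a| := by ring
          rw [this, ← mul_neg]
          exact mul_le_mul_of_nonneg_left (by linarith [hs.1, neg_le_abs a]) (hα' n).le)
        (Real.exp_pos _).le
      have h3 : 1 ≤ Real.exp (α n * (|a| / √(t n))) :=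
        Real.one_le_exp (mul_nonneg (hα n).le (div_nonneg (abs_nonneg _) (hl n).le))
      have h4 := div_le_div_of_nonneg_right (h1.trans (add_le_add_left h2 _)) (htp n).le
      refine h4.trans ?_
      rw [add_div, hK]
      have h5 := hT n
      have h6 : Real.exp (α n * (|a| / √(t n))) * (b - a) ^ 2 / t n
          ≤ Real.exp (α n * (|a| / √(t n))) * (b - a) ^ 2 :=
        div_le_self (by positivity) (ht1 n)
      nlinarith [abs_nonneg t₀]
    have h1 := (((G n).diag (t n) (ht0 n)).rescale (hl n)).cCharge_le_of_left_moment (hα n).le hδ₁0 hm s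
    refine h1.trans ?_
    have h2 : Real.exp (α n * (c n / √(t n) - δ₁)) * (Real.exp (α n * (|a| / √(t n))) * K) / δ₁
        = Real.exp (α n * (c n / √(t n) + |a| / √(t n) - δ₁)) * (K / δ₁) := by
      rw [← mul_assoc, ← Real.exp_add, mul_div_assoc]
      congr 2
      ring
    have h3 : Real.exp (α n * (c n / √(t n) + |a| / √(t n) - δ₁)) ≤ δ₁ ^ 2 / K := by
      refine (Real.exp_le_exp.2 ?_).trans
        (exp_neg_le_of_div_le (y := α n * (δ₁ / 2)) (by positivity) ?_)
      · rw [← mul_neg]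
        refine mul_le_mul_of_nonneg_left ?_ (hα n).le
        have h4 : c n / √(t n) ≤ C / √(t n) :=
          div_le_div_of_nonneg_right ((le_abs_self _).trans (hcC n)) (hl n).le
        rw [add_div] at hn
        linarith
      · calc 1 / (δ₁ ^ 2 / K) = 2 / δ₁ * (1 / (δ₁ ^ 2 / K)) * (δ₁ / 2) := by field_simp
          _ ≤ _ := mul_le_mul_of_nonneg_right hA (by positivity)
    rw [h2]
    calc _ ≤ 2 * δ₁ + δ₁ ^ 2 / K * (K / δ₁) :=
          add_le_add_right (mul_le_mul_of_nonneg_right h3 (by positivity)) _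
      _ = δ := by rw [hδ₁]; field_simp; ring
  -- The elapsed time in units of t n; it would be exactly 1 for t₀ = 0.
  · refine ⟨fun n => (t n - t₀) / t n, ?_, fun X hX => ?_⟩
    · have h1 : Tendsto (fun n => 1 - t₀ / t n) atTop (𝓝 (1 - 0)) :=
        tendsto_const_nhds.sub (tendsto_const_nhds.div_atTop ht)
      rw [sub_zero] at h1
      refine h1.congr fun n => ?_
      have := (htp n).ne'
      field_simp
    let g : ℕ → ℂ := fun n => trG (α n) (c n / √(t n))
      (cCharge (c n / √(t n)) fun s => 1 / √(t n) * W n (t n) (s * √(t n))) X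
    let Y : ℕ → ℂ := fun n => X - ((t n - t₀) / t n : ℝ) * g n
    let I : ℕ → ℂ := fun n => ∫ s, ((cCharge (c n / √(t n))
      (fun s => 1 / √(t n) * W n t₀ (s * √(t n))) s : ℝ) : ℂ) * kerD (α n) (Y n - s)
    have key : ∀ n, X ∈ strip (α n) → X.im ≤ (Y n).im ∧ α n * (Y n).im < Real.pi ∧
        trG (α n) (c n / √(t n))
          (cCharge (c n / √(t n)) fun s => 1 / √(t n) * W n t₀ (s * √(t n))) (Y n) = g n := by
      intro n hn
      have hlX : ((√(t n) : ℝ) : ℂ) * X ∈ strip (α n / √(t n)) := by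
        constructor
        · rw [Complex.im_ofReal_mul]; exact mul_pos (hl n) hX
        · rw [Complex.im_ofReal_mul]
          have : α n / √(t n) * (√(t n) * X.im) = α n * X.im := by
            have := (hl n).ne'; field_simp
          rw [this]; exact hn.2
      have hlc : ((√(t n) : ℝ) : ℂ) ≠ 0 := by exact_mod_cast (hl n).ne'
      have hg : g n = √(t n) * trG (α n / √(t n)) (c n) (cCharge (c n) (W n (t n))) (√(t n) * X) :=
        trG_rescale (hl n) X
      obtain ⟨h1, h2, h3⟩ := (G n).trG_characteristic (ht0 n) (hα' n) hlX
      have hy : ((√(t n) : ℝ) : ℂ) * X - (t n - t₀)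
          * trG (α n / √(t n)) (c n) (cCharge (c n) (W n (t n))) (√(t n) * X) = √(t n) * Y n := by
        simp only [Y]
        rw [hg]
        have : ((t n : ℝ) : ℂ) = ((√(t n) : ℝ) : ℂ) ^ 2 := by
          rw [← Complex.ofReal_pow, hl2]
        push_cast
        rw [this]
        field_simp
      rw [hy] at h1 h2 h3
      rw [Complex.im_ofReal_mul, Complex.im_ofReal_mul] at h1
      rw [Complex.im_ofReal_mul] at h2
      refine ⟨le_of_mul_le_mul_left h1 (hl n), ?_, ?_⟩
      · have : α n / √(t n) * (√(t n) * (Y n).im) = α n * (Y n).im := by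
          have := (hl n).ne'; field_simp
        rwa [this] at h2
      · rw [trG_rescale (hl n), h3, hg]
    classical
    -- The exponential factor of the initial transform at the foot Y n of the characteristic. Since
    -- Im (Y n) ≥ Im X and the rescaled initial area is O(1/t n), its exponent tends to 0. Outside
    -- the strip nothing is claimed, and 1 is a default value.
    refine ⟨fun n => if X ∈ strip (α n) then Complex.exp (I n) else 1, ?_,
      Eventually.of_forall fun n hn => ?_⟩
    · have h1 : Tendsto (fun n => if X ∈ strip (α n) then I n else 0) atTop (𝓝 0) := by
        refine squeeze_zero_norm (a := fun n => (Real.pi / (2 * X.im)) ^ 2 * ((b - a) ^ 2 / t n))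
          (fun n => ?_) ?_
        · split_ifs with hn
          · obtain ⟨h1, h2, -⟩ := key n hn
            have hd := (h0 n).rescale (hl n)
            have h3 : ∀ s : ℝ, ‖((cCharge (c n / √(t n))
                (fun s => 1 / √(t n) * W n t₀ (s * √(t n))) s : ℝ) : ℂ) * kerD (α n) (Y n - s)‖
                ≤ (Real.pi / (2 * X.im)) ^ 2 * cCharge (c n / √(t n))
                (fun s => 1 / √(t n) * W n t₀ (s * √(t n))) s := fun s => by
              rw [norm_mul, Complex.norm_real, Real.norm_eq_abs, abs_of_nonneg (hd.cCharge_nonneg s),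
                mul_comm]
              exact mul_le_mul_of_nonneg_right (norm_kerD_le_of_le_im (hα n).le hX
                (by simpa using h1) (by simpa using h2.le)) (hd.cCharge_nonneg s)
            refine (norm_integral_le_of_norm_le (hd.integrable_cCharge.const_mul _)
              (Eventually.of_forall h3)).trans ?_
            rw [integral_const_mul, integral_cCharge_rescale (hl n), hl2]
            exact mul_le_mul_of_nonneg_left (div_le_div_of_nonneg_right (harea0 n) (htp n).le)
              (sq_nonneg _)
          · rw [norm_zero]
            have := htp n
            positivity
        · have := (tendsto_const_nhds (x := (b - a) ^ 2)).div_atTop ht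
          simpa using this.const_mul ((Real.pi / (2 * X.im)) ^ 2)
      have h2 := (Complex.continuous_exp.tendsto 0).comp h1
      rw [Complex.exp_zero] at h2
      refine h2.congr fun n => ?_
      simp only [Function.comp_apply]
      split_ifs <;> simp
    · obtain ⟨h1, h2, h3⟩ := key n hn
      simp only [if_pos hn]
      have hne : kerE (α n) (Y n - (c n / √(t n) : ℝ)) ≠ 0 :=
        kerE_ne_zero_of_im (hα n).le (by simpa using hX.trans_le h1)
          (by simpa using h2.trans (by linarith [Real.pi_pos]))
      change g n * kerE (α n) (Y n - (c n / √(t n) : ℝ)) = _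
      rw [← h3, trG, kerK]
      rw [mul_right_comm, mul_assoc _ _ (kerE _ _), inv_mul_cancel₀ hne, mul_one]
      push_cast
      rfl

/-- Here the equation is exact, so κ = Z = 1. The bounds come from the limit equation itself,
through `integral_cCharge_le` and `integral_exp_left_le`. -/
theorem isApproxSeq_of_limit_equation {α : ℕ → ℝ} {W : ℕ → ℝ → ℝ} (hα : ∀ n, 0 < α n)
    (hd : ∀ n, ∃ a b, IsDiagramWith a b 0 (W n))
    (heq : ∀ n, ∀ᶠ x : ℝ in atTop, trG (α n) 0 (cCharge 0 (W n)) x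
      * kerE (α n) (x - trG (α n) 0 (cCharge 0 (W n)) x) = 1) :
    IsApproxSeq α (fun _ => 0) W := by
  have hout : ∀ n, ∃ a b, IsDiagramWith a b 0 (W n) ∧ ∀ x ∈ outer (α n) a b,
      trG (α n) 0 (cCharge 0 (W n)) x * kerE (α n) (x - trG (α n) 0 (cCharge 0 (W n)) x) = 1 :=
    fun n => by
      obtain ⟨a, b, h⟩ := hd n
      exact ⟨a, b, h, fun x hx => h.limit_eq_of_eventually (hα n).le (heq n) hx⟩
  refine ⟨hα, hd, tendsto_const_nhds, fun A => ⟨Real.exp (A ^ 2), Eventually.of_forall fun n hn => ?_⟩,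
    fun δ hδ => ⟨3 / δ * (1 / ((δ / 3) ^ 2)), Eventually.of_forall fun n hn s => ?_⟩,
    fun _ => 1, tendsto_const_nhds, fun X hX => ⟨fun _ => 1, tendsto_const_nhds,
      Eventually.of_forall fun n hn => ?_⟩⟩
  · obtain ⟨a, b, h, he⟩ := hout n
    refine (h.integral_cCharge_le (hα n) he).trans (Real.exp_le_exp.2 ?_)
    exact pow_le_pow_left₀ (hα n).le hn 2
  · obtain ⟨a, b, h, he⟩ := hout n
    have hδ3 : 0 < δ / 3 := by positivity
    have h1 := h.cCharge_le_of_left_moment (hα n).le hδ3 (h.integral_exp_left_le (hα n) he) s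
    have h2 : Real.exp (α n * (0 - δ / 3)) ≤ (δ / 3) ^ 2 := by
      rw [zero_sub, mul_neg]
      refine exp_neg_le_of_div_le (by positivity) ?_
      calc 1 / (δ / 3) ^ 2 = 3 / δ * (1 / ((δ / 3) ^ 2)) * (δ / 3) := by field_simp
        _ ≤ _ := mul_le_mul_of_nonneg_right hn hδ3.le
    refine h1.trans ?_
    calc _ ≤ 2 * (δ / 3) + (δ / 3) ^ 2 * 1 / (δ / 3) :=
          add_le_add_right (div_le_div_of_nonneg_right
            (mul_le_mul_of_nonneg_right h2 zero_le_one) hδ3.le) _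
      _ = δ := by field_simp; ring
  · obtain ⟨a, b, h, he⟩ := hout n
    have := he X (strip_subset_outer a b hn)
    simpa using this

end

end QPlancherel

/-! ### The function `xi` and the curve on which it is real. -/

namespace QPlancherel

noncomputable section

/-- A branch of `ςρ - log (1 - 1/ρ)`, analytic near the closed upper half-plane
without the points `0` and `1`. -/
def xi (ς : ℝ) (ρ : ℂ) : ℂ :=
  ς * ρ - Complex.log (-Complex.I * (1 - ρ⁻¹)) - Complex.I * (Real.pi / 2 : ℝ)

/-- The angle at which the segment `[0,1]` is seen from `ρ`. -/
def segAngle (ρ : ℂ) : ℝ := Complex.arg (-Complex.I * (1 - ρ⁻¹)) + Real.pi / 2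

/-- The logarithmic derivative of `xi`. -/
def xiD (ς : ℝ) (ρ : ℂ) : ℂ := ς * ρ - (ρ - 1)⁻¹

lemma negI_mul_re (z : ℂ) : (-Complex.I * (1 - z⁻¹)).re = z.im / ‖z‖ ^ 2 := by
  rw [← Complex.normSq_eq_norm_sq]
  simp [Complex.inv_im, neg_div]

lemma negI_mul_im (z : ℂ) : (-Complex.I * (1 - z⁻¹)).im = -(1 - z.re / ‖z‖ ^ 2) := by
  rw [← Complex.normSq_eq_norm_sq]
  simp [Complex.inv_re]

lemma one_sub_inv_ne_zero {ρ : ℂ} (h1 : ρ ≠ 1) : 1 - ρ⁻¹ ≠ 0 := by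
  rw [sub_ne_zero]
  intro h
  exact h1 (by rw [← inv_inv ρ, ← h, inv_one])

lemma norm_one_sub_inv {ρ : ℂ} (h0 : ρ ≠ 0) : ‖1 - ρ⁻¹‖ = ‖ρ - 1‖ / ‖ρ‖ := by
  rw [← norm_div]
  congr 1
  field_simp

/-- The map ρ ↦ 1 - 1/ρ preserves the upper half-plane, and the rotation by -i takes it to the right
half-plane. Real ρ go to nonzero imaginary numbers, so the principal logarithm is analytic up to the
real axis. -/
lemma mem_slitPlane_xi {ρ : ℂ} (h0 : ρ ≠ 0) (h1 : ρ ≠ 1) (him : 0 ≤ ρ.im) :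
    -Complex.I * (1 - ρ⁻¹) ∈ Complex.slitPlane := by
  have hn : 0 < ‖ρ‖ ^ 2 := by have := norm_pos_iff.2 h0; positivity
  rw [Complex.mem_slitPlane_iff]
  rcases him.eq_or_lt with h | h
  · right
    intro h'
    have hre : (-Complex.I * (1 - ρ⁻¹)).re = 0 := by rw [negI_mul_re, ← h, zero_div]
    have hz : -Complex.I * (1 - ρ⁻¹) = 0 := Complex.ext hre h'
    rcases mul_eq_zero.1 hz with h2 | h2
    · exact Complex.I_ne_zero (neg_eq_zero.1 h2)
    · exact one_sub_inv_ne_zero h1 h2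
  · left; rw [negI_mul_re]; positivity

lemma hasDerivAt_xi (ς : ℝ) {ρ : ℂ} (h0 : ρ ≠ 0) (h1 : ρ ≠ 1) (him : 0 ≤ ρ.im) :
    HasDerivAt (xi ς) (ρ⁻¹ * xiD ς ρ) ρ := by
  have hw := one_sub_inv_ne_zero h1
  have hd : HasDerivAt (fun ρ : ℂ => -Complex.I * (1 - ρ⁻¹)) (-Complex.I * (ρ ^ 2)⁻¹) ρ := by
    have := ((hasDerivAt_inv h0).const_sub 1).const_mul (-Complex.I)
    simpa using this
  have hl := hd.clog (mem_slitPlane_xi h0 h1 him)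
  have h := (((hasDerivAt_id ρ).const_mul (ς : ℂ)).sub hl).sub_const (Complex.I * (Real.pi / 2 : ℝ))
  refine h.congr_deriv ?_
  have h1' : ρ - 1 ≠ 0 := sub_ne_zero.2 h1
  have hI := Complex.I_ne_zero
  have e : (1 - ρ⁻¹) = (ρ - 1) / ρ := by field_simp
  unfold xiD
  rw [e]
  field_simp

lemma exp_xi (ς : ℝ) {ρ : ℂ} (h1 : ρ ≠ 1) :
    Complex.exp (xi ς ρ) = Complex.exp (ς * ρ) * (1 - ρ⁻¹)⁻¹ := by
  have hw := one_sub_inv_ne_zero h1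
  have hI := Complex.I_ne_zero
  unfold xi
  have e : Complex.I * ((Real.pi / 2 : ℝ) : ℂ) = (Real.pi / 2 : ℂ) * Complex.I := by push_cast; ring
  rw [Complex.exp_sub, Complex.exp_sub, Complex.exp_log (mul_ne_zero (neg_ne_zero.2 hI) hw), e,
    Complex.exp_pi_div_two_mul_I]
  field_simp
  rw [Complex.I_sq]
  ring

lemma xi_re (ς : ℝ) (ρ : ℂ) : (xi ς ρ).re = ς * ρ.re - Real.log ‖1 - ρ⁻¹‖ := by
  unfold xi
  simp only [Complex.sub_re, Complex.log_re, norm_mul, norm_neg, Complex.norm_I, one_mul]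
  simp

lemma xi_im (ς : ℝ) (ρ : ℂ) : (xi ς ρ).im = ς * ρ.im - segAngle ρ := by
  unfold xi segAngle
  simp only [Complex.sub_im, Complex.log_im]
  simp
  ring

lemma segAngle_mem {ρ : ℂ} (him : 0 ≤ ρ.im) : segAngle ρ ∈ Icc 0 Real.pi := by
  have h : |Complex.arg (-Complex.I * (1 - ρ⁻¹))| ≤ Real.pi / 2 := by
    rw [Complex.abs_arg_le_pi_div_two_iff, negI_mul_re]
    positivity
  rw [abs_le] at h
  unfold segAngle
  constructor <;> linarith [h.1, h.2]

lemma sin_segAngle {ρ : ℂ} (h0 : ρ ≠ 0) (h1 : ρ ≠ 1) :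
    Real.sin (segAngle ρ) = ρ.im / (‖ρ‖ * ‖ρ - 1‖) := by
  have hw := one_sub_inv_ne_zero h1
  have hz : -Complex.I * (1 - ρ⁻¹) ≠ 0 := mul_ne_zero (neg_ne_zero.2 Complex.I_ne_zero) hw
  have hn := norm_pos_iff.2 h0
  have hn1 := norm_pos_iff.2 (sub_ne_zero.2 h1)
  unfold segAngle
  rw [Real.sin_add_pi_div_two, Complex.cos_arg hz, negI_mul_re, norm_mul, norm_neg, Complex.norm_I,
    one_mul, norm_one_sub_inv h0]
  field_simp

/-- An angle is at least its sine, so ς Im ρ ≥ Im ρ / (|ρ||ρ-1|). This keeps the region Im `xi` ≥ 0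
away from the singular points 0 and 1. -/
lemma one_le_of_xi_im_nonneg {ς : ℝ} {ρ : ℂ} (h : 0 ≤ (xi ς ρ).im) (him : 0 < ρ.im) :
    1 ≤ ς * (‖ρ‖ * ‖ρ - 1‖) := by
  have h0 : ρ ≠ 0 := fun h => by simp [h] at him
  have h1 : ρ ≠ 1 := fun h => by simp [h] at him
  have hp : 0 < ‖ρ‖ * ‖ρ - 1‖ := mul_pos (norm_pos_iff.2 h0) (norm_pos_iff.2 (sub_ne_zero.2 h1))
  have h2 := Real.sin_le (segAngle_mem him.le).1
  rw [sin_segAngle h0 h1, div_le_iff₀ hp] at h2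
  rw [xi_im] at h
  have h3 : ρ.im * 1 ≤ ρ.im * (ς * (‖ρ‖ * ‖ρ - 1‖)) := by
    nlinarith
  exact le_of_mul_le_mul_left h3 him

/-- For |ρ| > 1 the segment is seen at an acute angle, so Jordan's inequality bounds the angle by
its sine, which is small compared with ς Im ρ. -/
lemma xi_im_pos_of_large {ς : ℝ} {ρ : ℂ} (hς : 0 < ς) (him : 0 < ρ.im)
    (hρ : 2 + 2 / ς ≤ ‖ρ‖) : 0 < (xi ς ρ).im := by
  have h2ς : 0 < 2 / ς := by positivity
  have h0 : ρ ≠ 0 := fun h => by simp [h] at him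
  have h1 : ρ ≠ 1 := fun h => by simp [h] at him
  have hn1 : ‖ρ‖ - 1 ≤ ‖ρ - 1‖ := by simpa using norm_sub_norm_le ρ 1
  have hp : 2 / ς * 1 ≤ ‖ρ‖ * ‖ρ - 1‖ :=
    mul_le_mul (by linarith) (by linarith) zero_le_one (norm_nonneg _)
  have hp0 : 0 < ‖ρ‖ * ‖ρ - 1‖ := by linarith
  have hA := segAngle_mem him.le
  have hlt : segAngle ρ ≤ Real.pi / 2 := by
    have : Complex.arg (-Complex.I * (1 - ρ⁻¹)) < 0 := by
      rw [Complex.arg_neg_iff, negI_mul_im, neg_lt_zero, sub_pos, div_lt_one (by positivity)]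
      have := Complex.re_le_norm ρ
      nlinarith
    unfold segAngle; linarith
  have h3 := Real.mul_le_sin hA.1 hlt
  rw [sin_segAngle h0 h1, le_div_iff₀ hp0] at h3
  rw [xi_im, sub_pos]
  have h4 : 2 / Real.pi * segAngle ρ * (2 / ς) ≤ ρ.im := by
    refine le_trans ?_ h3
    refine mul_le_mul_of_nonneg_left (by linarith) ?_
    exact mul_nonneg (by positivity) hA.1
  have h5 : segAngle ρ * 4 ≤ ρ.im * ς * Real.pi := by
    have : 2 / Real.pi * segAngle ρ * (2 / ς) = segAngle ρ * 4 / (ς * Real.pi) := by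
      field_simp; ring
    rw [this, div_le_iff₀ (by positivity)] at h4
    linarith
  have h6 : 0 < ρ.im * ς := mul_pos him hς
  nlinarith [Real.pi_lt_four]

lemma xi_im_neg_of_small {ς : ℝ} {ρ : ℂ} (hς : 0 < ς) (him : 0 < ρ.im)
    (hρ : ‖ρ‖ ≤ 1 / (2 * (1 + ς))) : (xi ς ρ).im < 0 := by
  by_contra h
  have h1 := one_le_of_xi_im_nonneg (not_lt.1 h) him
  have h2 : ‖ρ - 1‖ ≤ ‖ρ‖ + 1 := by simpa using norm_sub_le ρ 1
  have h3 : 1 / (2 * (1 + ς)) ≤ 1 / 2 := one_div_le_one_div_of_le (by norm_num) (by linarith)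
  have h4 : ‖ρ‖ * ‖ρ - 1‖ ≤ 1 / (2 * (1 + ς)) * (3 / 2) :=
    mul_le_mul hρ (by linarith) (norm_nonneg _) (by positivity)
  have h5 : ς * (‖ρ‖ * ‖ρ - 1‖) ≤ ς * (1 / (2 * (1 + ς)) * (3 / 2)) :=
    mul_le_mul_of_nonneg_left h4 hς.le
  have h6 : ς * (1 / (2 * (1 + ς)) * (3 / 2)) < 1 := by
    rw [← mul_assoc, mul_one_div, div_mul_eq_mul_div, div_lt_one (by positivity)]
    linarith
  linarith

lemma xiD_im (ς : ℝ) (ρ : ℂ) : (xiD ς ρ).im = ρ.im * (ς + (‖ρ - 1‖ ^ 2)⁻¹) := by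
  unfold xiD
  rw [← Complex.normSq_eq_norm_sq]
  simp [Complex.inv_im, neg_div]
  ring

/-- Logarithmic polar coordinates. -/
def polar (l θ : ℝ) : ℂ := Complex.exp (l + θ * Complex.I)

lemma norm_polar (l θ : ℝ) : ‖polar l θ‖ = Real.exp l := by
  simp [polar, Complex.norm_exp]

lemma polar_im (l θ : ℝ) : (polar l θ).im = Real.exp l * Real.sin θ := by
  simp [polar, Complex.exp_im]

lemma polar_re (l θ : ℝ) : (polar l θ).re = Real.exp l * Real.cos θ := by
  simp [polar, Complex.exp_re]

lemma polar_ne_zero (l θ : ℝ) : polar l θ ≠ 0 := Complex.exp_ne_zero _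

lemma polar_ne_one_of_ne {l : ℝ} (hl : l ≠ 0) (θ : ℝ) : polar l θ ≠ 1 := fun h => by
  have := norm_polar l θ
  rw [h, norm_one] at this
  exact hl (Real.exp_eq_one_iff l |>.1 this.symm)

lemma polar_im_pos (l : ℝ) {θ : ℝ} (hθ : θ ∈ Ioo 0 Real.pi) : 0 < (polar l θ).im := by
  rw [polar_im]; exact mul_pos (Real.exp_pos l) (Real.sin_pos_of_mem_Ioo hθ)

lemma polar_im_nonneg (l : ℝ) {θ : ℝ} (hθ : θ ∈ Icc 0 Real.pi) : 0 ≤ (polar l θ).im := by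
  rw [polar_im]; exact mul_nonneg (Real.exp_pos l).le (Real.sin_nonneg_of_mem_Icc hθ)

lemma polar_ne_one (l : ℝ) {θ : ℝ} (hθ : θ ∈ Ioo 0 Real.pi) : polar l θ ≠ 1 := fun h => by
  have := polar_im_pos l hθ
  simp [h] at this

lemma hasDerivAt_polar_left (l θ : ℝ) : HasDerivAt (fun l => polar l θ) (polar l θ) l := by
  have h : HasDerivAt (fun l : ℝ => (l : ℂ) + θ * Complex.I) 1 l :=
    (Complex.ofRealCLM.hasDerivAt (x := l)).add_const _
  exact h.cexp.congr_deriv (by simp [polar])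

lemma hasDerivAt_polar_right (l θ : ℝ) :
    HasDerivAt (fun θ => polar l θ) (polar l θ * Complex.I) θ := by
  have h : HasDerivAt (fun θ : ℝ => (l : ℂ) + θ * Complex.I) Complex.I θ := by
    simpa using ((Complex.ofRealCLM.hasDerivAt (x := θ)).mul_const Complex.I).const_add (l : ℂ)
  exact h.cexp

lemma continuous_polar : Continuous fun p : ℝ × ℝ => polar p.1 p.2 := by
  unfold polar; fun_prop

lemma hasDerivAt_xi_left (ς l : ℝ) {θ : ℝ} (hθ : θ ∈ Ioo 0 Real.pi) :
    HasDerivAt (fun l => xi ς (polar l θ)) (xiD ς (polar l θ)) l := by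
  have h := (hasDerivAt_xi ς (polar_ne_zero l θ) (polar_ne_one l hθ)
    (polar_im_pos l hθ).le).comp l (hasDerivAt_polar_left l θ)
  refine h.congr_deriv ?_
  have := polar_ne_zero l θ
  field_simp

lemma hasDerivAt_xi_right (ς : ℝ) {l θ : ℝ} (hl : l ≠ 0) (hθ : θ ∈ Icc 0 Real.pi) :
    HasDerivAt (fun θ => xi ς (polar l θ)) (Complex.I * xiD ς (polar l θ)) θ := by
  have h := (hasDerivAt_xi ς (polar_ne_zero l θ) (polar_ne_one_of_ne hl θ)
    (polar_im_nonneg l hθ)).comp θ (hasDerivAt_polar_right l θ)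
  refine h.congr_deriv ?_
  have := polar_ne_zero l θ
  field_simp

/-- The radial derivative of Im `xi` is Im `xiD`, which is positive by `xiD_im`. So each ray meets
the curve once, and the curve is a graph over the angle. -/
lemma strictMono_xi_im (ς : ℝ) (hς : 0 < ς) {θ : ℝ} (hθ : θ ∈ Ioo 0 Real.pi) :
    StrictMono fun l => (xi ς (polar l θ)).im := by
  have hd : ∀ l, HasDerivAt (fun l => (xi ς (polar l θ)).im) (xiD ς (polar l θ)).im l := fun l =>
    (Complex.imCLM.hasFDerivAt.comp_hasDerivAt l (hasDerivAt_xi_left ς l hθ))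
  refine strictMono_of_deriv_pos fun l => ?_
  rw [(hd l).deriv, xiD_im]
  have := polar_im_pos l hθ
  positivity

/-- Bounds for the radii of the curve `Im xi = 0`. -/
def radMin (ς : ℝ) : ℝ := Real.log (1 / (2 * (1 + ς)))

def radMax (ς : ℝ) : ℝ := Real.log (2 + 2 / ς)

lemma exists_xi_im_eq_zero {ς : ℝ} (hς : 0 < ς) {θ : ℝ} (hθ : θ ∈ Ioo 0 Real.pi) :
    ∃ l ∈ Ioo (radMin ς) (radMax ς), (xi ς (polar l θ)).im = 0 := by
  have h1 : (xi ς (polar (radMin ς) θ)).im < 0 := xi_im_neg_of_small hς (polar_im_pos _ hθ) (by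
    rw [norm_polar, radMin, Real.exp_log (by positivity)])
  have h2 : 0 < (xi ς (polar (radMax ς) θ)).im := xi_im_pos_of_large hς (polar_im_pos _ hθ) (by
    rw [norm_polar, radMax, Real.exp_log (by positivity)])
  have hmono := strictMono_xi_im ς hς hθ
  have hc : Continuous fun l => (xi ς (polar l θ)).im := Complex.continuous_im.comp
    (continuous_iff_continuousAt.2 fun l => (hasDerivAt_xi_left ς l hθ).continuousAt)
  have hle : radMin ς ≤ radMax ς := (hmono.lt_iff_lt.1 (h1.trans h2)).le
  obtain ⟨l, hl, h0⟩ := intermediate_value_Ioo hle hc.continuousOn ⟨h1, h2⟩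
  exact ⟨l, hl, h0⟩

open Classical in
/-- The logarithm of the radius of the curve `Im xi = 0` at the angle `θ`. -/
def curveLog (ς θ : ℝ) : ℝ :=
  if h : 0 < ς ∧ θ ∈ Ioo 0 Real.pi then (exists_xi_im_eq_zero h.1 h.2).choose else 0

lemma measurable_xi (ς : ℝ) : Measurable (xi ς) := by
  unfold xi; fun_prop

section Curve

variable {ς : ℝ} (hς : 0 < ς)

include hς

lemma curveLog_mem {θ : ℝ} (hθ : θ ∈ Ioo 0 Real.pi) :
    curveLog ς θ ∈ Ioo (radMin ς) (radMax ς) := by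
  rw [curveLog, dif_pos ⟨hς, hθ⟩]
  exact (exists_xi_im_eq_zero hς hθ).choose_spec.1

lemma xi_im_curve {θ : ℝ} (hθ : θ ∈ Ioo 0 Real.pi) : (xi ς (polar (curveLog ς θ) θ)).im = 0 := by
  rw [curveLog, dif_pos ⟨hς, hθ⟩]
  exact (exists_xi_im_eq_zero hς hθ).choose_spec.2

lemma curveLog_lt_iff {l θ : ℝ} (hθ : θ ∈ Ioo 0 Real.pi) :
    curveLog ς θ < l ↔ 0 < (xi ς (polar l θ)).im := by
  rw [← (strictMono_xi_im ς hς hθ).lt_iff_lt, xi_im_curve hς hθ]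

lemma curveLog_eq_iff {l θ : ℝ} (hθ : θ ∈ Ioo 0 Real.pi) :
    curveLog ς θ = l ↔ (xi ς (polar l θ)).im = 0 := by
  rw [← (strictMono_xi_im ς hς hθ).injective.eq_iff, xi_im_curve hς hθ, eq_comm]

lemma measurable_curveLog : Measurable (curveLog ς) := by
  have e : ∀ c, curveLog ς ⁻¹' Iio c = (Ioo 0 Real.pi ∩ {θ | 0 < (xi ς (polar c θ)).im}) ∪
      ((Ioo 0 Real.pi)ᶜ ∩ {_θ | 0 < c}) := by
    intro c
    ext θ
    by_cases hθ : θ ∈ Ioo 0 Real.pi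
    · simp [hθ, curveLog_lt_iff hς hθ]
    · have : curveLog ς θ = 0 := dif_neg fun h => hθ h.2
      simp [hθ, this]
  refine measurable_of_Iio fun c => ?_
  rw [e c]
  have hm : Measurable fun θ => (xi ς (polar c θ)).im := Complex.measurable_im.comp
    ((measurable_xi ς).comp (continuous_polar.comp (by fun_prop : Continuous fun θ : ℝ => (c, θ))).measurable)
  exact (measurableSet_Ioo.inter (measurableSet_lt measurable_const hm)).union
    (measurableSet_Ioo.compl.inter (MeasurableSet.const _))

end Curve

end

end QPlancherel

/-! ### Deformation of the curve to a large circle. -/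

namespace QPlancherel

noncomputable section

/-- The positive part always has a right derivative, even at zeros of N, and a right derivative is
enough for the fundamental theorem of calculus. -/
lemma hasDerivWithinAt_max_zero {N : ℝ → ℝ} {N' θ : ℝ} (h : HasDerivAt N N' θ) :
    HasDerivWithinAt (fun t => max (N t) 0)
      (if 0 < N θ then N' else if N θ = 0 then max N' 0 else 0) (Ioi θ) θ := by
  rcases lt_trichotomy (N θ) 0 with hN | hN | hN
  · rw [if_neg hN.not_gt, if_neg hN.ne]
    refine ((hasDerivAt_const θ (0 : ℝ)).congr_of_eventuallyEq ?_).hasDerivWithinAt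
    filter_upwards [h.continuousAt.eventually_lt_const hN] with t ht using max_eq_right ht.le
  · rw [if_neg hN.not_gt, if_pos hN]
    have h1 := (hasDerivAt_iff_isLittleO.1 h).mono (nhdsWithin_le_nhds (s := Ioi θ))
    rw [hasDerivWithinAt_iff_isLittleO]
    refine Asymptotics.IsBigO.trans_isLittleO (Asymptotics.IsBigO.of_bound 1 ?_) h1
    filter_upwards [self_mem_nhdsWithin] with t ht
    have ht' : 0 ≤ t - θ := (sub_pos.2 ht).le
    rw [hN, max_self, sub_zero, sub_zero, smul_eq_mul, smul_eq_mul, one_mul, mul_max_of_nonneg _ _ ht',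
      mul_zero]
    have := abs_max_sub_max_le_max (N t) 0 ((t - θ) * N') 0
    simpa using this
  · rw [if_pos hN]
    refine (h.congr_of_eventuallyEq ?_).hasDerivWithinAt
    filter_upwards [h.continuousAt.eventually_const_lt hN] with t ht using max_eq_left ht.le

lemma abs_log_le {x m M : ℝ} (hm : 0 < m) (h1 : m ≤ x) (h2 : x ≤ M) :
    |Real.log x| ≤ |Real.log m| + |Real.log M| := by
  have hx : 0 < x := hm.trans_le h1
  have h3 := Real.log_le_log hm h1
  have h4 := Real.log_le_log hx h2
  rw [abs_le]
  constructor
  · linarith [neg_abs_le (Real.log m), abs_nonneg (Real.log M)]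
  · linarith [le_abs_self (Real.log M), abs_nonneg (Real.log m)]

section Deformation

variable {ς : ℝ} (hς : 0 < ς)

include hς

/-- By `one_le_of_xi_im_nonneg` the distance |ρ - 1| is bounded below in this region, although the
annulus may contain the singular point 1. -/
lemma exists_bound_xi (L : ℝ) : ∃ C, ∀ l θ : ℝ, θ ∈ Ioo 0 Real.pi → radMin ς ≤ l → l ≤ L →
    0 ≤ (xi ς (polar l θ)).im → ‖xi ς (polar l θ)‖ ≤ C ∧ ‖xiD ς (polar l θ)‖ ≤ C := by
  set R := Real.exp L with hR
  have hRp : 0 < R := Real.exp_pos _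
  set r := Real.exp (radMin ς) with hr
  have hrp : 0 < r := Real.exp_pos _
  set K := |Real.log (1 / (ς * R ^ 2))| + |Real.log ((R + 1) / r)| with hK
  have hK0 : 0 ≤ K := by positivity
  refine ⟨2 * (ς * R) + K, fun l θ hθ h1 h2 hN => ?_⟩
  set ρ := polar l θ with hρ
  have h0 : ρ ≠ 0 := polar_ne_zero l θ
  have hne : ρ ≠ 1 := polar_ne_one l hθ
  have him := polar_im_pos l hθ
  have hn : ‖ρ‖ ≤ R := by rw [hρ, norm_polar]; exact Real.exp_le_exp.2 h2
  have hn' : r ≤ ‖ρ‖ := by rw [hρ, norm_polar]; exact Real.exp_le_exp.2 h1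
  have hnp : 0 < ‖ρ‖ := norm_pos_iff.2 h0
  have h1p : 0 < ‖ρ - 1‖ := norm_pos_iff.2 (sub_ne_zero.2 hne)
  have hone := one_le_of_xi_im_nonneg hN him
  have hinv : ‖ρ - 1‖⁻¹ ≤ ς * R := by
    rw [inv_le_iff_one_le_mul₀ h1p]
    calc 1 ≤ ς * (‖ρ‖ * ‖ρ - 1‖) := hone
      _ ≤ ς * (R * ‖ρ - 1‖) := by gcongr
      _ = _ := by ring
  have hlog : |Real.log ‖1 - ρ⁻¹‖| ≤ K := by
    rw [norm_one_sub_inv h0]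
    refine abs_log_le (by positivity) ?_ ?_
    · rw [div_le_div_iff₀ (by positivity) hnp, one_mul]
      calc ‖ρ‖ ≤ ‖ρ‖ * (ς * (‖ρ‖ * ‖ρ - 1‖)) := le_mul_of_one_le_right hnp.le hone
        _ = ‖ρ - 1‖ * (ς * ‖ρ‖ ^ 2) := by ring
        _ ≤ ‖ρ - 1‖ * (ς * R ^ 2) := by gcongr
    · have h3 : ‖ρ - 1‖ ≤ ‖ρ‖ + 1 := by simpa using norm_sub_le ρ 1
      exact div_le_div₀ (by positivity) (by linarith) hrp hn'
  have hre : |ρ.re| ≤ R := (Complex.abs_re_le_norm ρ).trans hn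
  have hims : ρ.im ≤ R := (Complex.im_le_norm ρ).trans hn
  constructor
  · refine (Complex.norm_le_abs_re_add_abs_im _).trans ?_
    have e1 : |(xi ς ρ).re| ≤ ς * R + K := by
      rw [xi_re]
      refine (abs_sub _ _).trans (add_le_add ?_ hlog)
      rw [abs_mul, abs_of_pos hς]
      exact mul_le_mul_of_nonneg_left hre hς.le
    have e2 : |(xi ς ρ).im| ≤ ς * R := by
      rw [abs_of_nonneg hN, xi_im]
      have := (segAngle_mem him.le).1
      have := mul_le_mul_of_nonneg_left hims hς.le
      linarith
    linarith
  · unfold xiD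
    refine (norm_sub_le _ _).trans ?_
    rw [norm_mul, norm_inv, Complex.norm_real, Real.norm_eq_abs, abs_of_pos hς]
    have := mul_le_mul_of_nonneg_left hn hς.le
    linarith

variable {f : ℂ → ℂ} (hf : Differentiable ℂ f) (hfr : ∀ x : ℝ, (f x).im = 0)

omit hς in
lemma continuousOn_xi_polar {l : ℝ} (hl : l ≠ 0) :
    ContinuousOn (fun θ => xi ς (polar l θ)) (Icc 0 Real.pi) := fun _ hθ =>
  (hasDerivAt_xi_right ς hl hθ).continuousAt.continuousWithinAt

omit hς in
lemma measurable_xi_polar (ς : ℝ) : Measurable fun p : ℝ × ℝ => xi ς (polar p.2 p.1) :=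
  (measurable_xi ς).comp (continuous_polar.comp continuous_swap).measurable

omit hς in
lemma measurable_xiD_polar (ς : ℝ) : Measurable fun p : ℝ × ℝ => xiD ς (polar p.2 p.1) := by
  have h : Measurable (xiD ς) := by unfold xiD; fun_prop
  exact h.comp (continuous_polar.comp continuous_swap).measurable

include hf hfr

omit hς in
/-- The integral over the part of a circle that lies outside of the curve. -/
lemma integral_circle_eq_zero {l : ℝ} (hl : l ≠ 0)
    (hnull : ∀ᵐ θ : ℝ, θ ∈ Ioo 0 Real.pi → (xi ς (polar l θ)).im ≠ 0) :
    ∫ θ in Ioo 0 Real.pi, (if 0 < (xi ς (polar l θ)).im then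
      (deriv f (xi ς (polar l θ)) * xiD ς (polar l θ)).re else 0) = 0 := by
  set X : ℝ → ℂ := fun θ => xi ς (polar l θ) with hX
  set D : ℝ → ℂ := fun θ => xiD ς (polar l θ) with hD
  have hXd : ∀ θ ∈ Icc 0 Real.pi, HasDerivAt X (Complex.I * D θ) θ := fun θ hθ =>
    hasDerivAt_xi_right ς hl hθ
  have hXc : ContinuousOn X (Icc 0 Real.pi) := continuousOn_xi_polar hl
  have hDc : Continuous D := by
    have hne : ∀ θ, polar l θ - 1 ≠ 0 := fun θ => sub_ne_zero.2 (polar_ne_one_of_ne hl θ)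
    have hp : Continuous fun θ => polar l θ := continuous_polar.comp (by fun_prop : Continuous fun θ : ℝ => (l, θ))
    exact (continuous_const.mul hp).sub ((hp.sub continuous_const).inv₀ hne)
  have hf'c : Continuous (deriv f) := (hf.contDiff (n := 1)).continuous_deriv le_rfl
  -- Truncating Im `xi` at 0 makes f(P) real wherever Im `xi` ≤ 0, in particular at both ends of the
  -- semicircle. So Im f(P) has total increment 0, while its derivative is the integrand outside the
  -- curve and 0 inside.
  let P : ℝ → ℂ := fun θ => ((X θ).re : ℂ) + (max (X θ).im 0 : ℝ) * Complex.I
  let N' : ℝ → ℝ := fun θ => if 0 < (X θ).im then (Complex.I * D θ).im else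
    if (X θ).im = 0 then max (Complex.I * D θ).im 0 else 0
  let V' : ℝ → ℝ := fun θ =>
    (deriv f (P θ) * (((Complex.I * D θ).re : ℂ) + (N' θ : ℂ) * Complex.I)).im
  have hPc : ContinuousOn P (Icc 0 Real.pi) := by
    have h1 : Continuous fun z : ℂ => (z.re : ℂ) + (max z.im 0 : ℝ) * Complex.I := by fun_prop
    exact h1.comp_continuousOn hXc
  have hd : ∀ θ ∈ Ioo 0 Real.pi, HasDerivWithinAt (fun θ => (f (P θ)).im) (V' θ) (Ioi θ) θ := by
    intro θ hθ
    have h1 := hXd θ (Ioo_subset_Icc_self hθ)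
    have hre : HasDerivAt (fun θ => (X θ).re) (Complex.I * D θ).re θ :=
      Complex.reCLM.hasFDerivAt.comp_hasDerivAt θ h1
    have him : HasDerivAt (fun θ => (X θ).im) (Complex.I * D θ).im θ :=
      Complex.imCLM.hasFDerivAt.comp_hasDerivAt θ h1
    have h2 : HasDerivWithinAt P (((Complex.I * D θ).re : ℂ) + (N' θ : ℂ) * Complex.I) (Ioi θ) θ :=
      hre.ofReal_comp.hasDerivWithinAt.add
        ((hasDerivWithinAt_max_zero him).ofReal_comp.mul_const Complex.I)
    have h3 := (hf (P θ)).hasDerivAt.comp_hasDerivWithinAt θ h2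
    exact Complex.imCLM.hasFDerivAt.comp_hasDerivWithinAt θ h3
  have hae : ∀ᵐ θ ∂volume.restrict (Icc 0 Real.pi), V' θ
      = {θ | 0 < (X θ).im}.indicator (fun θ => (deriv f (X θ) * D θ).re) θ := by
    have hne0 : ∀ᵐ θ : ℝ, θ ≠ 0 := by simp [ae_iff, measure_singleton]
    have hnepi : ∀ᵐ θ : ℝ, θ ≠ Real.pi := by simp [ae_iff, measure_singleton]
    filter_upwards [ae_restrict_mem measurableSet_Icc, ae_restrict_of_ae hnull, ae_restrict_of_ae hne0,
      ae_restrict_of_ae hnepi] with θ hθ hN h0 hpi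
    have hN' := hN ⟨lt_of_le_of_ne hθ.1 (Ne.symm h0), lt_of_le_of_ne hθ.2 hpi⟩
    have e0 : (Complex.I * D θ).re = -(D θ).im := by simp
    have e1 : (Complex.I * D θ).im = (D θ).re := by simp
    rcases lt_or_gt_of_ne hN' with h | h
    · have hP : P θ = ((X θ).re : ℝ) := by
        simp only [P]
        rw [max_eq_right (show (X θ).im ≤ 0 from h.le)]
        simp
      have hcr : (deriv f ((X θ).re : ℝ)).im = 0 := by
        have h1 : HasDerivAt (fun x : ℝ => (f x).im) (deriv f ((X θ).re : ℝ)).im (X θ).re :=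
          Complex.imCLM.hasFDerivAt.comp_hasDerivAt _ (hf ((X θ).re : ℝ)).hasDerivAt.comp_ofReal
        have h2 : (fun x : ℝ => (f x).im) = fun _ => 0 := funext hfr
        rw [h2] at h1
        exact h1.unique (hasDerivAt_const _ _)
      have hnm : θ ∉ {θ | 0 < (X θ).im} := not_lt.2 h.le
      rw [indicator_of_notMem hnm]
      simp only [V', N']
      rw [if_neg (show ¬ 0 < (X θ).im from not_lt.2 h.le), if_neg (show ¬ (X θ).im = 0 from h.ne), hP]
      simp [hcr]
    · have hP : P θ = X θ := by
        simp only [P]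
        rw [max_eq_left (show 0 ≤ (X θ).im from h.le), Complex.re_add_im]
      have hm : θ ∈ {θ | 0 < (X θ).im} := h
      rw [indicator_of_mem hm]
      simp only [V', N']
      rw [if_pos (show 0 < (X θ).im from h), hP, Complex.re_add_im]
      simp only [Complex.mul_im, Complex.mul_re, Complex.I_re, Complex.I_im]
      ring
  have hms : MeasurableSet {θ | 0 < (X θ).im} := by
    have : Measurable X := (measurable_xi ς).comp
      (continuous_polar.comp (by fun_prop : Continuous fun θ : ℝ => (l, θ))).measurable
    exact measurableSet_lt measurable_const (Complex.measurable_im.comp this)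
  have hint : IntegrableOn V' (Icc 0 Real.pi) := by
    have h1 : IntegrableOn (fun θ => (deriv f (X θ) * D θ).re) (Icc 0 Real.pi) :=
      (Complex.continuous_re.comp_continuousOn
        ((hf'c.comp_continuousOn hXc).mul hDc.continuousOn)).integrableOn_Icc
    exact (h1.indicator hms).congr (hae.mono fun θ h => h.symm)
  have hV0 : ∀ θ ∈ Icc 0 Real.pi, Real.sin θ = 0 → (f (P θ)).im = 0 := fun θ hθ hs => by
    have h1 : (X θ).im ≤ 0 := by
      simp only [X]
      rw [xi_im, polar_im, hs]
      have := (segAngle_mem (polar_im_nonneg l hθ)).1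
      linarith
    simp only [P]
    rw [max_eq_right h1]
    simpa using hfr _
  have hFTC := intervalIntegral.integral_eq_sub_of_hasDeriv_right_of_le Real.pi_pos.le
    (Complex.continuous_im.comp_continuousOn (hf.continuous.comp_continuousOn hPc)) hd
    ((intervalIntegrable_iff_integrableOn_Icc_of_le Real.pi_pos.le).2 hint)
  simp only [Function.comp_apply] at hFTC
  rw [hV0 0 ⟨le_rfl, Real.pi_pos.le⟩ Real.sin_zero, hV0 Real.pi ⟨Real.pi_pos.le, le_rfl⟩ Real.sin_pi,
    sub_zero, intervalIntegral.integral_of_le Real.pi_pos.le, integral_Ioc_eq_integral_Ioo] at hFTC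
  refine Eq.trans (integral_congr_ae ?_) hFTC
  have hae' := ae_restrict_of_ae_restrict_of_subset (Ioo_subset_Icc_self) hae
  filter_upwards [hae'] with θ hθ
  rw [hθ, indicator_apply]
  rfl

/-- Integrals of analytic functions over the curve `Im xi = 0` and over a large circle agree. -/
theorem integral_curve_eq {L : ℝ} (hL : radMax ς ≤ L) :
    (IntegrableOn (fun θ => (f (xi ς (polar (curveLog ς θ) θ))).re) (Ioo 0 Real.pi)) ∧
    ∫ θ in Ioo 0 Real.pi, (f (xi ς (polar (curveLog ς θ) θ))).re
      = ∫ θ in Ioo 0 Real.pi, (f (xi ς (polar L θ))).re := by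
  obtain ⟨C, hC⟩ := exists_bound_xi hς L
  have hf'c : Continuous (deriv f) := (hf.contDiff (n := 1)).continuous_deriv le_rfl
  obtain ⟨C₁, hC₁⟩ := (isCompact_closedBall (0 : ℂ) C).exists_bound_of_continuousOn hf.continuous.continuousOn
  obtain ⟨C₂, hC₂⟩ := (isCompact_closedBall (0 : ℂ) C).exists_bound_of_continuousOn hf'c.continuousOn
  have hmeml : ∀ {θ}, θ ∈ Ioo 0 Real.pi → radMin ς < curveLog ς θ ∧ curveLog ς θ < L := fun hθ =>
    ⟨(curveLog_mem hς hθ).1, (curveLog_mem hς hθ).2.trans_le hL⟩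
  have hNL : ∀ {θ}, θ ∈ Ioo 0 Real.pi → 0 < (xi ς (polar L θ)).im := fun hθ =>
    (curveLog_lt_iff hς hθ).1 (hmeml hθ).2
  have hbd : ∀ {l θ}, θ ∈ Ioo 0 Real.pi → radMin ς ≤ l → l ≤ L → 0 ≤ (xi ς (polar l θ)).im →
      ‖(f (xi ς (polar l θ))).re‖ ≤ C₁ := fun hθ h1 h2 h3 =>
    (Complex.abs_re_le_norm _).trans (hC₁ _ (by simpa using (hC _ _ hθ h1 h2 h3).1))
  have hfre : Measurable fun z => (f z).re := (Complex.continuous_re.comp hf.continuous).measurable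
  have i1 : IntegrableOn (fun θ => (f (xi ς (polar (curveLog ς θ) θ))).re) (Ioo 0 Real.pi) := by
    refine Measure.integrableOn_of_bounded (M := C₁) (by simp)
      ((hfre.comp ((measurable_xi_polar ς).comp
        (measurable_id.prodMk (measurable_curveLog hς)))).aestronglyMeasurable) ?_
    filter_upwards [ae_restrict_mem measurableSet_Ioo] with θ hθ
    exact hbd hθ (hmeml hθ).1.le (hmeml hθ).2.le (xi_im_curve hς hθ).ge
  have i2 : IntegrableOn (fun θ => (f (xi ς (polar L θ))).re) (Ioo 0 Real.pi) := by
    refine Measure.integrableOn_of_bounded (M := C₁) (by simp)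
      ((hfre.comp ((measurable_xi_polar ς).comp
        (measurable_id.prodMk measurable_const))).aestronglyMeasurable) ?_
    filter_upwards [ae_restrict_mem measurableSet_Ioo] with θ hθ
    exact hbd hθ ((hmeml hθ).1.trans (hmeml hθ).2).le le_rfl (hNL hθ).le
  refine ⟨i1, ?_⟩
  -- The radial derivative of Re f(`xi`), cut off inside the curve. Integrated first over the radius
  -- it gives the difference of the two integrands; integrated first over the angle it gives 0.
  set k : ℝ → ℝ → ℝ := fun θ l => if 0 < (xi ς (polar l θ)).im then
    (deriv f (xi ς (polar l θ)) * xiD ς (polar l θ)).re else 0 with hk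
  have hkm : Measurable fun p : ℝ × ℝ => k p.1 p.2 := by
    refine Measurable.ite (measurableSet_lt measurable_const
      (Complex.measurable_im.comp (measurable_xi_polar ς))) ?_ measurable_const
    exact Complex.measurable_re.comp
      ((hf'c.measurable.comp (measurable_xi_polar ς)).mul (measurable_xiD_polar ς))
  have hkb : ∀ θ ∈ Ioo 0 Real.pi, ∀ l ∈ Ioc (radMin ς) L, ‖k θ l‖ ≤ |C₂| * |C| := by
    intro θ hθ l hl
    simp only [hk]
    split_ifs with h
    · obtain ⟨h1, h2⟩ := hC l θ hθ hl.1.le hl.2 h.le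
      refine (Complex.abs_re_le_norm _).trans ?_
      rw [norm_mul]
      exact mul_le_mul ((hC₂ _ (by simpa using h1)).trans (le_abs_self _)) (h2.trans (le_abs_self _))
        (norm_nonneg _) (abs_nonneg _)
    · rw [norm_zero]; positivity
  have hkint : Integrable (Function.uncurry k)
      ((volume.restrict (Ioo 0 Real.pi)).prod (volume.restrict (Ioc (radMin ς) L))) := by
    rw [Measure.prod_restrict]
    refine Measure.integrableOn_of_bounded (M := |C₂| * |C|) ?_ hkm.aestronglyMeasurable ?_
    · rw [Measure.prod_prod]
      exact (ENNReal.mul_lt_top (by simp) (by simp)).ne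
    · filter_upwards [ae_restrict_mem (measurableSet_Ioo.prod measurableSet_Ioc)] with p hp
      exact hkb p.1 hp.1 p.2 hp.2
  have hinner : ∀ θ ∈ Ioo 0 Real.pi, ∫ l in Ioc (radMin ς) L, k θ l
      = (f (xi ς (polar L θ))).re - (f (xi ς (polar (curveLog ς θ) θ))).re := by
    intro θ hθ
    obtain ⟨h1, h2⟩ := hmeml hθ
    have hd : ∀ l, HasDerivAt (fun l => (f (xi ς (polar l θ))).re)
        (deriv f (xi ς (polar l θ)) * xiD ς (polar l θ)).re l := fun l =>
      Complex.reCLM.hasFDerivAt.comp_hasDerivAt l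
        ((hf _).hasDerivAt.comp l (hasDerivAt_xi_left ς l hθ))
    have hXc : Continuous fun l => xi ς (polar l θ) :=
      continuous_iff_continuousAt.2 fun l => (hasDerivAt_xi_left ς l hθ).continuousAt
    have hDc : Continuous fun l => xiD ς (polar l θ) := by
      have hp : Continuous fun l => polar l θ :=
        continuous_polar.comp (by fun_prop : Continuous fun l : ℝ => (l, θ))
      exact (continuous_const.mul hp).sub
        ((hp.sub continuous_const).inv₀ fun l => sub_ne_zero.2 (polar_ne_one l hθ))
    have e : ∀ l, k θ l = (Ioi (curveLog ς θ)).indicator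
        (fun l => (deriv f (xi ς (polar l θ)) * xiD ς (polar l θ)).re) l := fun l => by
      simp only [hk, indicator_apply, mem_Ioi, curveLog_lt_iff hς hθ]
    simp_rw [e]
    rw [setIntegral_indicator measurableSet_Ioi, Ioc_inter_Ioi, max_eq_right h1.le,
      ← intervalIntegral.integral_of_le h2.le]
    exact intervalIntegral.integral_eq_sub_of_hasDerivAt (fun l _ => hd l)
      ((Complex.continuous_re.comp ((hf'c.comp hXc).mul hDc)).intervalIntegrable _ _)
  have hswap := integral_integral_swap hkint
  have hzero : ∀ᵐ l ∂volume.restrict (Ioc (radMin ς) L), ∫ θ in Ioo 0 Real.pi, k θ l = 0 := by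
    refine ae_restrict_of_ae ?_
    have hne0 : ∀ᵐ l : ℝ, l ≠ 0 := by simp [ae_iff, measure_singleton]
    -- The graph of `curveLog` is a null set in the plane, so almost every circle meets the curve at
    -- a null set of angles.
    have hgr : ∀ᵐ l : ℝ, ∀ᵐ θ : ℝ, curveLog ς θ ≠ l := by
      rw [← Measure.ae_ae_comm (p := fun θ l => curveLog ς θ ≠ l)
        ((measurableSet_eq_fun ((measurable_curveLog hς).comp measurable_fst) measurable_snd).compl)]
      refine Eventually.of_forall fun θ => ?_
      have : {l : ℝ | ¬ curveLog ς θ ≠ l} = {curveLog ς θ} := by ext; simp [eq_comm]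
      rw [ae_iff, this, measure_singleton]
    filter_upwards [hne0, hgr] with l h0 h1
    refine integral_circle_eq_zero hf hfr h0 ?_
    filter_upwards [h1] with θ hθ hθI h
    exact hθ ((curveLog_eq_iff hς hθI).2 h)
  rw [integral_congr_ae hzero, integral_zero, setIntegral_congr_fun measurableSet_Ioo hinner,
    integral_sub i2 i1] at hswap
  linarith

end Deformation

end

end QPlancherel

/-! ### The diagram with a given Rayleigh measure, and its transform. -/

namespace QPlancherel

noncomputable section

/-- The diagram with the Rayleigh measure `τ`. -/
def diagramOf (τ : Measure ℝ) (s : ℝ) : ℝ := ∫ u, |s - u| ∂τ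

section DiagramOf

variable {τ : Measure ℝ} [IsProbabilityMeasure τ] {a b : ℝ}

lemma integrable_of_ae_mem_Icc (hτ : ∀ᵐ u ∂τ, u ∈ Icc a b) {g : ℝ → ℝ} (hg : ContinuousOn g (Icc a b)) :
    Integrable g τ := by
  have hres : τ.restrict (Icc a b) = τ := Measure.restrict_eq_self_of_ae_mem hτ
  rw [← hres]
  exact hg.integrableOn_Icc

/-- Outside [a,b] the function u ↦ |s - u| is linear on the support, so total mass 1 and mean 0
produce |s|. -/
lemma isDiagramWith_diagramOf (ha : a < 0) (hb : 0 < b) (hτ : ∀ᵐ u ∂τ, u ∈ Icc a b)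
    (h0 : ∫ u, u ∂τ = 0) : IsDiagramWith a b 0 (diagramOf τ) := by
  have hi : ∀ s : ℝ, Integrable (fun u => |s - u|) τ := fun s =>
    integrable_of_ae_mem_Icc hτ (by fun_prop)
  have hid : Integrable (fun u : ℝ => u) τ := integrable_of_ae_mem_Icc hτ (by fun_prop)
  refine ⟨ha, hb, LipschitzWith.of_dist_le_mul fun s t => ?_, ⟨ha.le, hb.le⟩, fun s hs => ?_⟩
  · rw [Real.dist_eq, Real.dist_eq, NNReal.coe_one, one_mul]
    unfold diagramOf
    rw [← integral_sub (hi s) (hi t), ← Real.norm_eq_abs]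
    refine (norm_integral_le_of_norm_le_const (C := |s - t|) (Eventually.of_forall fun u => ?_)).trans
      (by simp)
    have := abs_abs_sub_abs_le (s - u) (t - u)
    simpa using this
  · have key : ∀ ε : ℝ, (∀ u ∈ Icc a b, |s - u| = ε * (s - u)) → diagramOf τ s = ε * s := fun ε h => by
      unfold diagramOf
      rw [integral_congr_ae (hτ.mono h), integral_const_mul, integral_sub (integrable_const _) hid, h0]
      simp
    rw [sub_zero]
    rcases lt_or_ge s a with h | h
    · rw [key (-1) fun u hu => by rw [abs_of_neg (by linarith [hu.1])]; ring,
        abs_of_neg (h.trans ha)]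
      ring
    · have hsb : b < s := by
        by_contra h'; exact hs ⟨h, not_lt.1 h'⟩
      rw [key 1 fun u hu => by rw [abs_of_pos (by linarith [hu.2])]; ring, abs_of_pos (hb.trans hsb)]
      ring

lemma hasDerivAt_abs_sub {u s : ℝ} (h : s ≠ u) :
    HasDerivAt (fun s => |s - u|) (2 * (Iic s).indicator (fun _ => 1) u - 1) s := by
  have h0 : s - u ≠ 0 := sub_ne_zero.2 h
  refine ((hasDerivAt_abs h0).comp_sub_const s u).congr_deriv ?_
  rw [indicator_apply]
  rcases lt_or_gt_of_ne h with h1 | h1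
  · rw [if_neg (by simpa using h1), sign_neg (sub_neg.2 h1)]; norm_num
  · rw [if_pos (show u ∈ Iic s from h1.le), sign_pos (sub_pos.2 h1)]; norm_num

lemma ae_hasDerivAt_diagramOf (hτ : ∀ᵐ u ∂τ, u ∈ Icc a b) :
    ∀ᵐ s, HasDerivAt (diagramOf τ) (2 * τ.real (Iic s) - 1) s := by
  have hae : ∀ᵐ s : ℝ, ∀ᵐ u ∂τ, s ≠ u := by
    rw [Measure.ae_ae_comm (p := fun s u : ℝ => s ≠ u)
      ((measurableSet_eq_fun measurable_fst measurable_snd).compl)]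
    refine Eventually.of_forall fun u => ?_
    simp [ae_iff, measure_singleton]
  filter_upwards [hae] with s hs
  have hm : Measurable fun u : ℝ => 2 * (Iic s).indicator (fun _ => (1 : ℝ)) u - 1 :=
    ((measurable_const.indicator measurableSet_Iic).const_mul 2).sub_const 1
  have h := (hasDerivAt_integral_of_dominated_loc_of_lip (μ := τ) (F := fun s u => |s - u|)
    (x₀ := s) (s := univ) (bound := fun _ => 1) univ_mem
    (Eventually.of_forall fun s => (by fun_prop : Continuous fun u : ℝ => |s - u|).aestronglyMeasurable)
    (integrable_of_ae_mem_Icc hτ (by fun_prop)) hm.aestronglyMeasurable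
    (Eventually.of_forall fun u => by
      have : Real.nnabs 1 = 1 := by simp
      rw [this]
      exact (lipschitz_abs_sub u).lipschitzOnWith)
    (integrable_const _) (hs.mono fun u hu => hasDerivAt_abs_sub hu)).2
  refine h.congr_deriv ?_
  have hi : Integrable (fun u => (Iic s).indicator (fun _ => (1 : ℝ)) u) τ :=
    (integrable_const 1).indicator measurableSet_Iic
  rw [integral_sub (hi.const_mul 2) (integrable_const _), integral_const_mul,
    integral_indicator measurableSet_Iic]
  simp [Measure.real]

lemma isRayleighMeasure_diagramOf (hτ : ∀ᵐ u ∂τ, u ∈ Icc a b) :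
    IsRayleighMeasure (diagramOf τ) τ.toSignedMeasure := by
  filter_upwards [ae_hasDerivAt_diagramOf hτ] with s hs
  rw [hs.deriv, Measure.toSignedMeasure_apply_measurable measurableSet_Iic]
  ring

lemma ae_deriv_charge_diagramOf (hτ : ∀ᵐ u ∂τ, u ∈ Icc a b) :
    ∀ᵐ s, deriv (charge (diagramOf τ)) s = ∫ u, stepDiff u s ∂τ := by
  have h0 : ∀ᵐ s : ℝ, s ≠ 0 := by simp [ae_iff, measure_singleton]
  filter_upwards [ae_hasDerivAt_diagramOf hτ, h0] with s hs h0
  have h1 : HasDerivAt (fun s : ℝ => |s|) (2 * (Iic s).indicator (fun _ => 1) (0 : ℝ) - 1) s := by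
    simpa using hasDerivAt_abs_sub h0
  have h2 : HasDerivAt (charge (diagramOf τ)) _ s := (hs.sub h1).div_const 2
  rw [h2.deriv]
  have e : ∀ u, stepDiff u s = (Iic s).indicator (fun _ => (1 : ℝ)) u - (if 0 ≤ s then 1 else 0) :=
    fun u => by simp [stepDiff, indicator_apply]
  simp_rw [e]
  have hi : Integrable (fun u => (Iic s).indicator (fun _ => (1 : ℝ)) u) τ :=
    (integrable_const 1).indicator measurableSet_Iic
  rw [integral_sub hi (integrable_const _), integral_indicator measurableSet_Iic]
  rw [integral_const, integral_const, indicator_apply, measureReal_restrict_apply_univ,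
    probReal_univ, smul_eq_mul, smul_eq_mul]
  simp only [mem_Iic]
  split_ifs <;> ring

lemma qMoment_toSignedMeasure {q : ℝ} (hq : 0 < q) (n : ℕ) :
    qMoment q n τ.toSignedMeasure = ∫ u, Real.exp (n * (-Real.log q * u)) ∂τ := by
  -- Multiplication of reals is symmetric, so the pairing may be flipped to the form that
  -- `VectorMeasure.integral_toSignedMeasure` applies to.
  have e : (ContinuousLinearMap.lsmul ℝ ℝ : ℝ →L[ℝ] ℝ →L[ℝ] ℝ)
      = (ContinuousLinearMap.lsmul ℝ ℝ : ℝ →L[ℝ] ℝ →L[ℝ] ℝ).flip := by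
    ext; simp
  unfold qMoment
  rw [e, VectorMeasure.integral_toSignedMeasure]
  congr 1
  ext u
  rw [Real.rpow_def_of_pos hq]
  congr 1
  ring

/-- The derivative of the charge is the τ-average of the step functions `stepDiff u`, and the
integrals may be exchanged. -/
lemma integral_deriv_charge_diagramOf (ha : a < 0) (hb : 0 < b) (hτ : ∀ᵐ u ∂τ, u ∈ Icc a b)
    {α x : ℝ} (hα : α ≠ 0) (hx : b < x) :
    ∫ s, deriv (charge (diagramOf τ)) s * kerR α (x - s)
      = ∫ u, (logKer α x u - logKer α x 0) ∂τ := by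
  have hcont : ContinuousOn (fun s => kerR α (x - s)) (Icc a b) :=
    (continuousOn_kerR hα).comp (by fun_prop) fun s hs => by
      have := hs.2
      simp only [mem_compl_iff, mem_singleton_iff]
      linarith
  have hstep : ∀ u ∈ Icc a b, ∀ s, ‖stepDiff u s‖ ≤ (Icc a b).indicator (fun _ => 1) s := by
    intro u hu s
    rw [stepDiff, indicator_apply]
    by_cases hs : s ∈ Icc a b
    · rw [if_pos hs]; split_ifs <;> norm_num
    · rw [if_neg hs]
      have : (u ≤ s ↔ 0 ≤ s) := by
        rcases lt_or_ge s a with h | h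
        · exact ⟨fun h' => by linarith [hu.1], fun h' => by linarith⟩
        · have hsb : b < s := by
            by_contra h'; exact hs ⟨h, not_lt.1 h'⟩
          exact ⟨fun _ => by linarith, fun _ => by linarith [hu.2]⟩
      simp [this]
  have e1 : ∫ s, deriv (charge (diagramOf τ)) s * kerR α (x - s)
      = ∫ s, ∫ u, stepDiff u s * kerR α (x - s) ∂τ := by
    refine integral_congr_ae ?_
    filter_upwards [ae_deriv_charge_diagramOf hτ] with s hs
    rw [hs, integral_mul_const]
  have hk : Integrable fun s => (Icc a b).indicator (fun _ => (1 : ℝ)) s * kerR α (x - s) := by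
    have h1 := (integrable_indicator_iff measurableSet_Icc).2 (hcont.integrableOn_Icc (μ := volume))
    refine h1.congr (Eventually.of_forall fun s => ?_)
    simp only [indicator_apply]
    split_ifs <;> simp
  have hm : Measurable fun p : ℝ × ℝ => stepDiff p.2 p.1 * kerR α (x - p.1) :=
    (measurable_stepDiff.comp measurable_swap).mul
      ((measurable_kerR α).comp (measurable_const.sub measurable_fst))
  have hint : Integrable (Function.uncurry fun s u => stepDiff u s * kerR α (x - s))
      (volume.prod τ) := by
    have hb := (hk.comp_fst τ)
    refine hb.mono hm.aestronglyMeasurable ?_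
    have hae : ∀ᵐ p ∂(volume : Measure ℝ).prod τ, p.2 ∈ Icc a b :=
      Measure.quasiMeasurePreserving_snd.ae hτ
    filter_upwards [hae] with p hp
    simp only [Function.uncurry]
    rw [norm_mul, norm_mul]
    refine mul_le_mul_of_nonneg_right ((hstep p.2 hp p.1).trans (le_abs_self _)) (norm_nonneg _)
  rw [e1, integral_integral_swap hint]
  refine integral_congr_ae ?_
  filter_upwards [hτ] with u hu
  have hsub : uIcc 0 u ⊆ Icc a b := uIcc_subset_Icc ⟨ha.le, hb.le⟩ hu
  rw [(integral_stepDiff_mul u (hcont.integrableOn_Icc.mono_set hsub)).2,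
    integral_kerR_eq_logKer hα fun h' => by linarith [(hsub h').2]]
  ring

/-- In `logKer` the part linear in u integrates to 0 because the mean is 0. The remaining logarithm
expands into the exponential moments of τ. -/
lemma trG_diagramOf (ha : a < 0) (hb : 0 < b) (hτ : ∀ᵐ u ∂τ, u ∈ Icc a b)
    (h0 : ∫ u, u ∂τ = 0) {α x : ℝ} (hα : 0 < α) (hx : b < x) :
    trG α 0 (cCharge 0 (diagramOf τ)) x = ((α * Real.exp
      (-∫ u, Real.log (1 - Real.exp (-(α * x)) * Real.exp (α * u)) ∂τ) : ℝ) : ℂ) := by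
  have hd := isDiagramWith_diagramOf ha hb hτ h0
  rw [hd.trG_ofReal hα fun h' => by linarith [h'.2],
    integral_deriv_charge_diagramOf ha hb hτ hα.ne' hx]
  congr 1
  have hpos : ∀ u ≤ b, 0 < 1 - Real.exp (-(α * x)) * Real.exp (α * u) := fun u hu => by
    rw [← Real.exp_add, sub_pos, Real.exp_lt_one_iff]
    nlinarith
  have hlk : ∀ u ≤ b, logKer α x u
      = α * (x - u) + Real.log (1 - Real.exp (-(α * x)) * Real.exp (α * u)) := fun u hu => by
    unfold logKer
    rw [← Real.log_exp (α * (x - u)), ← Real.log_mul (Real.exp_pos _).ne' (hpos u hu).ne',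
      Real.log_exp, mul_sub (Real.exp _), mul_one, ← Real.exp_add, ← Real.exp_add]
    have e0 : α * (x - u) + (-(α * x) + α * u) = 0 := by ring
    rw [e0, Real.exp_zero]
  have hlog : Integrable (fun u => Real.log (1 - Real.exp (-(α * x)) * Real.exp (α * u))) τ :=
    integrable_of_ae_mem_Icc hτ (ContinuousOn.log (by fun_prop) fun u hu => (hpos u hu.2).ne')
  have hid : Integrable (fun u : ℝ => u) τ := integrable_of_ae_mem_Icc hτ (by fun_prop)
  set z := Real.exp (-(α * x)) with hz
  have hz1 : 0 < 1 - z := by simpa using hpos 0 hb.le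
  have e : ∫ u, (logKer α x u - logKer α x 0) ∂τ
      = (∫ u, Real.log (1 - z * Real.exp (α * u)) ∂τ) - Real.log (1 - z) := by
    have h1 : ∀ᵐ u ∂τ, logKer α x u - logKer α x 0
        = (Real.log (1 - z * Real.exp (α * u)) - Real.log (1 - z)) - α * u := by
      filter_upwards [hτ] with u hu
      rw [hlk u hu.2, hlk 0 hb.le]
      simp
      ring
    have hs : Integrable (fun u => Real.log (1 - z * Real.exp (α * u)) - Real.log (1 - z)) τ :=
      hlog.sub (integrable_const _)
    rw [integral_congr_ae h1, integral_sub hs (hid.const_mul α),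
      integral_sub hlog (integrable_const _), integral_const_mul, h0]
    simp
  rw [e, neg_sub, Real.exp_sub, Real.exp_log hz1, Real.exp_neg, kerR, ← hz]
  field_simp

lemma hasSum_log_integral {α z : ℝ} (hα : 0 < α) (hz : 0 ≤ z) (hzb : z * Real.exp (α * b) < 1)
    (hτ : ∀ᵐ u ∂τ, u ∈ Icc a b) :
    HasSum (fun n : ℕ => z ^ (n + 1) / (n + 1) * ∫ u, Real.exp ((n + 1 : ℕ) * (α * u)) ∂τ)
      (-∫ u, Real.log (1 - z * Real.exp (α * u)) ∂τ) := by
  set r := z * Real.exp (α * b) with hr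
  have hr0 : 0 ≤ r := mul_nonneg hz (Real.exp_pos _).le
  have hle : ∀ u ∈ Icc a b, 0 ≤ z * Real.exp (α * u) ∧ z * Real.exp (α * u) ≤ r := fun u hu =>
    ⟨mul_nonneg hz (Real.exp_pos _).le, mul_le_mul_of_nonneg_left
      (Real.exp_le_exp.2 (mul_le_mul_of_nonneg_left hu.2 hα.le)) hz⟩
  have hsum : Summable fun n : ℕ => r ^ (n + 1) :=
    (summable_nat_add_iff 1).2 (summable_geometric_of_lt_one hr0 hzb)
  have h := hasSum_integral_of_dominated_convergence (μ := τ)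
    (F := fun (n : ℕ) u => (z * Real.exp (α * u)) ^ (n + 1) / (n + 1))
    (f := fun u => -Real.log (1 - z * Real.exp (α * u))) (fun n _ => r ^ (n + 1))
    (fun n => (by fun_prop : Continuous fun u : ℝ =>
      (z * Real.exp (α * u)) ^ (n + 1) / ((n : ℝ) + 1)).aestronglyMeasurable)
    (fun n => hτ.mono fun u hu => ?_) (Eventually.of_forall fun _ => hsum) (integrable_const _)
    (hτ.mono fun u hu => ?_)
  · rw [integral_neg] at h
    refine h.congr_fun ?_
    intro n
    rw [← integral_const_mul]
    congr 1
    ext u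
    rw [mul_pow, ← Real.exp_nat_mul]
    ring
  · obtain ⟨h1, h2⟩ := hle u hu
    rw [Real.norm_eq_abs, abs_of_nonneg (by positivity)]
    calc _ ≤ (z * Real.exp (α * u)) ^ (n + 1) := div_le_self (by positivity) (by
            have : (0 : ℝ) ≤ n := Nat.cast_nonneg n
            linarith)
      _ ≤ r ^ (n + 1) := pow_le_pow_left₀ h1 h2 _
  · obtain ⟨h1, h2⟩ := hle u hu
    exact Real.hasSum_pow_div_log_of_abs_lt_one (by rw [abs_of_nonneg h1]; linarith)

end DiagramOf

end

end QPlancherel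

/-! ### The limiting Rayleigh measure and its moments as circle averages. -/

namespace QPlancherel

noncomputable section

/-- The function `e^{ςρ} / (1 - 1/ρ)`. -/
def symF (ς : ℝ) (ρ : ℂ) : ℂ := Complex.exp (ς * ρ) * (1 - ρ⁻¹)⁻¹

/-- The abscissa `s` of the point of the curve at the angle `θ`. -/
def curveS (α θ : ℝ) : ℝ := (xi (α ^ 2) (polar (curveLog (α ^ 2) θ) θ)).re / α

/-- The Rayleigh measure of the limiting diagram. -/
def limMeasure (α : ℝ) : Measure ℝ :=
  ENNReal.ofReal (1 / Real.pi) • (volume.restrict (Ioo 0 Real.pi)).map (curveS α)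

lemma symF_conj (ς : ℝ) (ρ : ℂ) : symF ς (starRingEnd ℂ ρ) = starRingEnd ℂ (symF ς ρ) := by
  unfold symF
  simp [← Complex.exp_conj]

lemma polar_eq_circleMap (l θ : ℝ) : polar l θ = circleMap 0 (Real.exp l) θ := by
  simp [polar, circleMap, Complex.exp_add]

lemma circleMap_two_pi_sub (R θ : ℝ) :
    circleMap 0 R (2 * Real.pi - θ) = starRingEnd ℂ (circleMap 0 R θ) := by
  simp only [circleMap, zero_add, map_mul, Complex.conj_ofReal, ← Complex.exp_conj]
  congr 1
  push_cast
  rw [sub_mul, Complex.exp_sub, Complex.exp_two_pi_mul_I, one_div, ← Complex.exp_neg]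
  simp

lemma circleMap_ne_one {R : ℝ} (hR : 1 < R) (θ : ℝ) : circleMap 0 R θ ≠ 1 := fun h => by
  have h1 := norm_circleMap_zero R θ
  rw [h, norm_one, abs_of_pos (by linarith)] at h1
  linarith

lemma continuous_symF_circle (ς : ℝ) {R : ℝ} (hR : 1 < R) :
    Continuous fun θ => symF ς (circleMap 0 R θ) := by
  have h0 : ∀ θ, circleMap 0 R θ ≠ 0 := fun θ => circleMap_ne_center (by linarith)
  have hc : Continuous (circleMap 0 R) := continuous_circleMap 0 R
  exact (Complex.continuous_exp.comp (continuous_const.mul hc)).mul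
    ((continuous_const.sub (hc.inv₀ h0)).inv₀ fun θ => one_sub_inv_ne_zero (circleMap_ne_one hR θ))

/-- The lower semicircle contributes the conjugate of the upper one. -/
lemma circleAverage_of_conj {g : ℂ → ℂ} (hg : ∀ ρ, g (starRingEnd ℂ ρ) = starRingEnd ℂ (g ρ)) {R : ℝ}
    (hc : Continuous fun θ => g (circleMap 0 R θ)) :
    Real.circleAverage g 0 R = ((1 / Real.pi * ∫ θ in Ioo 0 Real.pi, (g (circleMap 0 R θ)).re : ℝ) : ℂ) := by
  have hpi := Real.pi_pos
  have hcc : Continuous fun θ => starRingEnd ℂ (g (circleMap 0 R θ)) :=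
    Complex.continuous_conj.comp hc
  have e1 : ∫ θ in (0 : ℝ)..2 * Real.pi, g (circleMap 0 R θ)
      = (∫ θ in (0 : ℝ)..Real.pi, g (circleMap 0 R θ))
        + ∫ θ in (0 : ℝ)..Real.pi, starRingEnd ℂ (g (circleMap 0 R θ)) := by
    rw [← intervalIntegral.integral_add_adjacent_intervals (hc.intervalIntegrable 0 Real.pi)
      (hc.intervalIntegrable Real.pi (2 * Real.pi))]
    congr 1
    have := intervalIntegral.integral_comp_sub_left (a := 0) (b := Real.pi)
      (fun θ => g (circleMap 0 R θ)) (2 * Real.pi)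
    rw [sub_zero, show 2 * Real.pi - Real.pi = Real.pi by ring] at this
    rw [← this]
    refine intervalIntegral.integral_congr fun θ _ => ?_
    rw [circleMap_two_pi_sub, hg]
  have e2 : ∫ θ in (0 : ℝ)..2 * Real.pi, g (circleMap 0 R θ)
      = ((2 * ∫ θ in Ioo 0 Real.pi, (g (circleMap 0 R θ)).re : ℝ) : ℂ) := by
    rw [e1, ← intervalIntegral.integral_add (hc.intervalIntegrable _ _)
      (hcc.intervalIntegrable _ _)]
    have : ∀ θ, g (circleMap 0 R θ) + starRingEnd ℂ (g (circleMap 0 R θ))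
        = ((2 * (g (circleMap 0 R θ)).re : ℝ) : ℂ) := fun θ => Complex.add_conj _
    simp_rw [this]
    rw [intervalIntegral.integral_ofReal, intervalIntegral.integral_const_mul,
      intervalIntegral.integral_of_le hpi.le, integral_Ioc_eq_integral_Ioo]
  rw [Real.circleAverage_def, e2, Complex.real_smul]
  push_cast
  field_simp

/-- Circle averages of functions analytic outside of the unit disc do not depend on the radius. -/
lemma circleAverage_eq_of_one_lt {g : ℂ → ℂ}
    (hg : ∀ ρ : ℂ, ρ ≠ 0 → ρ ≠ 1 → DifferentiableAt ℂ g ρ) {r R : ℝ} (hr : 1 < r) (hrR : r ≤ R) :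
    Real.circleAverage g 0 R = Real.circleAverage g 0 r := by
  have hd : ∀ ρ : ℂ, r ≤ ‖ρ‖ → DifferentiableAt ℂ g ρ := fun ρ h => by
    refine hg ρ (fun h0 => ?_) fun h1 => ?_
    · rw [h0, norm_zero] at h; linarith
    · rw [h1, norm_one] at h; linarith
  have h := Complex.circleIntegral_sub_center_inv_smul_eq_of_differentiable_on_annulus_off_countable
    (c := (0 : ℂ)) (f := g) (by linarith : (0 : ℝ) < r) hrR countable_empty
    (fun ρ hρ => (hd ρ (by simpa using hρ.2)).continuousAt.continuousWithinAt)
    (fun ρ hρ => hd ρ (by have := hρ.1.2; simp only [Metric.mem_closedBall, dist_zero_right, not_le] at this; exact this.le))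
  rw [Real.circleAverage_eq_circleIntegral (by linarith), Real.circleAverage_eq_circleIntegral (by linarith), h]

lemma differentiableAt_symF (ς : ℝ) {ρ : ℂ} (h0 : ρ ≠ 0) (h1 : ρ ≠ 1) :
    DifferentiableAt ℂ (symF ς) ρ := by
  have hw := one_sub_inv_ne_zero h1
  unfold symF
  fun_prop (disch := assumption)

lemma abs_log_norm_one_sub_le {w : ℂ} (hw : ‖w‖ ≤ 1 / 2) : |Real.log ‖1 - w‖| ≤ 2 * ‖w‖ := by
  have h1 : 1 - ‖w‖ ≤ ‖1 - w‖ := by simpa using norm_sub_norm_le 1 w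
  have h2 : ‖1 - w‖ ≤ 1 + ‖w‖ := by simpa using norm_sub_le 1 w
  have hp : 0 < ‖1 - w‖ := by linarith
  have h3 := Real.log_le_sub_one_of_pos hp
  have h4 := Real.one_sub_inv_le_log_of_pos hp
  have h5 : ‖1 - w‖⁻¹ ≤ 1 + 2 * ‖w‖ := by
    rw [inv_le_iff_one_le_mul₀ hp]
    nlinarith [norm_nonneg w]
  rw [abs_le]
  constructor <;> linarith [norm_nonneg w]

section LimMeasure

variable {α : ℝ} (hα : 0 < α)

include hα

lemma measurable_curveS : Measurable (curveS α) :=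
  (Complex.measurable_re.comp ((measurable_xi_polar (α ^ 2)).comp
    (measurable_id.prodMk (measurable_curveLog (pow_pos hα 2))))).div_const _

lemma isProbabilityMeasure_limMeasure : IsProbabilityMeasure (limMeasure α) := by
  constructor
  rw [limMeasure, Measure.smul_apply, Measure.map_apply (measurable_curveS hα) MeasurableSet.univ,
    preimage_univ, Measure.restrict_apply_univ, Real.volume_Ioo, sub_zero, smul_eq_mul,
    ← ENNReal.ofReal_mul (by positivity)]
  simp [Real.pi_ne_zero]

lemma integral_limMeasure {g : ℝ → ℝ} (hg : Continuous g) :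
    ∫ u, g u ∂limMeasure α = 1 / Real.pi * ∫ θ in Ioo 0 Real.pi, g (curveS α θ) := by
  have hpi : 0 ≤ 1 / Real.pi := by positivity
  rw [limMeasure, integral_smul_measure, integral_map (measurable_curveS hα).aemeasurable
    hg.aestronglyMeasurable, ENNReal.toReal_ofReal hpi, smul_eq_mul]

lemma exists_ae_limMeasure_mem :
    ∃ a b, a < 0 ∧ 0 < b ∧ ∀ᵐ u ∂limMeasure α, u ∈ Icc a b := by
  have hς : 0 < α ^ 2 := pow_pos hα 2
  obtain ⟨C, hC⟩ := exists_bound_xi hς (radMax (α ^ 2))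
  have hC' : ∀ θ ∈ Ioo 0 Real.pi, |curveS α θ| ≤ |C| / α + 1 := fun θ hθ => by
    have h1 := curveLog_mem hς hθ
    have h2 := (hC _ θ hθ h1.1.le h1.2.le (xi_im_curve hς hθ).ge).1
    rw [curveS, abs_div, abs_of_pos hα]
    have h3 := (Complex.abs_re_le_norm _).trans (h2.trans (le_abs_self C))
    have := div_le_div_of_nonneg_right h3 hα.le
    linarith
  have hp : 0 < |C| / α + 1 := by positivity
  refine ⟨-(|C| / α + 1), |C| / α + 1, by linarith, hp, ?_⟩
  refine Measure.ae_smul_measure ?_ _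
  refine (ae_map_iff (measurable_curveS hα).aemeasurable
    (p := fun u => u ∈ Icc (-(|C| / α + 1)) (|C| / α + 1)) measurableSet_Icc).2 ?_
  filter_upwards [ae_restrict_mem measurableSet_Ioo] with θ hθ
  exact abs_le.1 (hC' θ hθ)

lemma xi_curve_eq {θ : ℝ} (hθ : θ ∈ Ioo 0 Real.pi) :
    xi (α ^ 2) (polar (curveLog (α ^ 2) θ) θ) = ((α * curveS α θ : ℝ) : ℂ) := by
  have h := xi_im_curve (pow_pos hα 2) hθ
  apply Complex.ext
  · rw [Complex.ofReal_re, curveS, mul_div_cancel₀ _ hα.ne']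
  · rw [h, Complex.ofReal_im]

/-- The deformation theorem for f(z) = e^{nz}: on the curve this is e^{nαs}, on the circle it is
F^n, since e^{`xi`} = `symF`. -/
lemma integral_exp_limMeasure (n : ℕ) :
    ((∫ u, Real.exp (n * (α * u)) ∂limMeasure α : ℝ) : ℂ)
      = Real.circleAverage (fun ρ => symF (α ^ 2) ρ ^ n) 0 2 := by
  have hς : 0 < α ^ 2 := pow_pos hα 2
  -- The circle must enclose the curve, and its radius must be at least 2, to which the average is
  -- then moved.
  set L := max (radMax (α ^ 2)) (Real.log 2) with hL
  have hLR : 2 ≤ Real.exp L := by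
    rw [← Real.log_le_iff_le_exp two_pos]; exact le_max_right _ _
  have hf : Differentiable ℂ fun z : ℂ => Complex.exp (n * z) := by fun_prop
  have h1 := (integral_curve_eq hς hf (fun x => by
    have : Complex.exp (n * x) = ((Real.exp (n * x) : ℝ) : ℂ) := by push_cast; rfl
    rw [this, Complex.ofReal_im]) (L := L) (le_max_left _ _)).2
  rw [← circleAverage_eq_of_one_lt (g := fun ρ => symF (α ^ 2) ρ ^ n)
      (fun ρ h0 h1 => (differentiableAt_symF _ h0 h1).pow n) one_lt_two hLR,
    circleAverage_of_conj (fun ρ => by simp only [symF_conj, map_pow])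
      ((continuous_symF_circle _ (by linarith)).pow n), integral_limMeasure hα (by fun_prop)]
  congr 2
  have e1 : ∫ θ in Ioo 0 Real.pi, Real.exp (n * (α * curveS α θ))
      = ∫ θ in Ioo 0 Real.pi, (Complex.exp (n * xi (α ^ 2) (polar (curveLog (α ^ 2) θ) θ))).re := by
    refine setIntegral_congr_fun measurableSet_Ioo fun θ hθ => ?_
    rw [xi_curve_eq hα hθ]
    have : Complex.exp (n * ((α * curveS α θ : ℝ) : ℂ))
        = ((Real.exp (n * (α * curveS α θ)) : ℝ) : ℂ) := by push_cast; rfl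
    rw [this, Complex.ofReal_re]
  rw [e1, h1]
  refine setIntegral_congr_fun measurableSet_Ioo fun θ hθ => ?_
  rw [Complex.exp_nat_mul, exp_xi _ (polar_ne_one _ hθ), polar_eq_circleMap]
  rfl

/-- The deformation theorem for f(z) = z. On the circle of radius e^L the term ς Re ρ integrates to
0 and log|1 - 1/ρ| is O(e^{-L}); now L → ∞. -/
lemma integral_id_limMeasure : ∫ u, u ∂limMeasure α = 0 := by
  have hς : 0 < α ^ 2 := pow_pos hα 2
  have hpi := Real.pi_pos
  set I := ∫ θ in Ioo 0 Real.pi, (xi (α ^ 2) (polar (curveLog (α ^ 2) θ) θ)).re with hI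
  have key : ∀ L, radMax (α ^ 2) ≤ L → Real.log 2 ≤ L → ‖I‖ ≤ 2 * Real.exp (-L) * Real.pi := by
    intro L hL hL2
    have h1 := (integral_curve_eq hς differentiable_id (fun x => by simp) hL).2
    simp only [id] at h1
    rw [hI, h1]
    have hcos : ∫ θ in Ioo 0 Real.pi, α ^ 2 * (polar L θ).re = 0 := by
      rw [← integral_Ioc_eq_integral_Ioo, ← intervalIntegral.integral_of_le hpi.le]
      simp_rw [polar_re]
      rw [intervalIntegral.integral_const_mul, intervalIntegral.integral_const_mul, integral_cos]
      simp
    have hn : ∀ θ, ‖(polar L θ)⁻¹‖ = Real.exp (-L) := fun θ => by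
      rw [norm_inv, norm_polar, Real.exp_neg]
    have hle : Real.exp (-L) ≤ 1 / 2 := by
      rw [Real.exp_neg, one_div]
      refine inv_anti₀ two_pos ?_
      rwa [← Real.log_le_iff_le_exp two_pos]
    have hb : ∀ θ, ‖Real.log ‖1 - (polar L θ)⁻¹‖‖ ≤ 2 * Real.exp (-L) := fun θ => by
      have := abs_log_norm_one_sub_le (w := (polar L θ)⁻¹) (by rw [hn]; exact hle)
      rwa [hn] at this
    have hpc : Continuous fun θ => polar L θ :=
      continuous_polar.comp (by fun_prop : Continuous fun θ : ℝ => (L, θ))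
    have hlm : Measurable fun θ => Real.log ‖1 - (polar L θ)⁻¹‖ :=
      Real.measurable_log.comp (measurable_const.sub hpc.measurable.inv).norm
    have hli : IntegrableOn (fun θ => Real.log ‖1 - (polar L θ)⁻¹‖) (Ioo 0 Real.pi) :=
      Measure.integrableOn_of_bounded (by simp) hlm.aestronglyMeasurable (Eventually.of_forall hb)
    have hci : IntegrableOn (fun θ => α ^ 2 * (polar L θ).re) (Ioo 0 Real.pi) :=
      ((continuous_const.mul (Complex.continuous_re.comp hpc)).continuousOn.integrableOn_Icc).mono_set
        Ioo_subset_Icc_self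
    simp_rw [xi_re]
    rw [integral_sub hci hli, hcos, zero_sub, norm_neg]
    refine (norm_setIntegral_le_of_norm_le_const (by simp) fun θ _ => hb θ).trans ?_
    rw [Real.volume_real_Ioo_of_le hpi.le, sub_zero]
  have hlim : Tendsto (fun L => 2 * Real.exp (-L) * Real.pi) atTop (𝓝 0) := by
    have := ((Real.tendsto_exp_neg_atTop_nhds_zero).const_mul 2).mul_const Real.pi
    simpa using this
  have hI0 : ‖I‖ ≤ 0 := ge_of_tendsto hlim (by
    filter_upwards [eventually_ge_atTop (radMax (α ^ 2)), eventually_ge_atTop (Real.log 2)] with L h1 h2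
      using key L h1 h2)
  have hI1 : I = 0 := norm_le_zero_iff.1 hI0
  rw [integral_limMeasure hα (g := fun u => u) continuous_id]
  simp only [curveS]
  rw [integral_div, ← hI, hI1]
  simp

end LimMeasure

end

end QPlancherel

/-! ### Generating functions of circle averages by residues. -/

namespace QPlancherel

noncomputable section

/-- A bound for `symF` on the circle of radius `2`. -/
def symBound (ς : ℝ) : ℝ := 2 * Real.exp (2 * |ς|)

lemma symBound_pos (ς : ℝ) : 0 < symBound ς := by unfold symBound; positivity

lemma norm_circleMap_two (θ : ℝ) : ‖circleMap 0 2 θ‖ = 2 := by simp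

lemma norm_exp_mul_le {ς : ℝ} {w : ℂ} (hw : ‖w‖ ≤ 2) : ‖Complex.exp (ς * w)‖ ≤ Real.exp (2 * |ς|) := by
  rw [Complex.norm_exp, Real.exp_le_exp]
  refine (Complex.re_le_norm _).trans ?_
  rw [norm_mul, Complex.norm_real, Real.norm_eq_abs, mul_comm]
  exact mul_le_mul_of_nonneg_right hw (abs_nonneg _)

lemma norm_symF_le (ς θ : ℝ) : ‖symF ς (circleMap 0 2 θ)‖ ≤ symBound ς := by
  have h1 := norm_exp_mul_le (ς := ς) (norm_circleMap_two θ).le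
  have h2 : (1 / 2 : ℝ) ≤ ‖1 - (circleMap 0 2 θ)⁻¹‖ := by
    have := norm_sub_norm_le (1 : ℂ) (circleMap 0 2 θ)⁻¹
    rw [norm_inv, norm_circleMap_two, norm_one] at this
    linarith
  have h3 : ‖1 - (circleMap 0 2 θ)⁻¹‖⁻¹ ≤ 2 := by
    have := inv_anti₀ (by norm_num) h2
    simpa using this
  rw [symF, norm_mul, norm_inv, symBound, mul_comm 2]
  exact mul_le_mul h1 h3 (inv_nonneg.2 (norm_nonneg _)) (Real.exp_pos _).le

/-- The real part of the average of `f symF ^ n` over the circle of radius `2`. -/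
def symMom (f : ℂ → ℂ) (ς : ℝ) (n : ℕ) : ℝ :=
  (Real.circleAverage (fun ρ => f ρ * symF ς ρ ^ n) 0 2).re

lemma continuous_symF_two (ς : ℝ) : Continuous fun θ => symF ς (circleMap 0 2 θ) :=
  continuous_symF_circle ς one_lt_two

lemma ofReal_symMom {f : ℂ → ℂ} (hf : Continuous f)
    (hfc : ∀ ρ, f (starRingEnd ℂ ρ) = starRingEnd ℂ (f ρ)) (ς : ℝ) (n : ℕ) :
    (symMom f ς n : ℂ) = Real.circleAverage (fun ρ => f ρ * symF ς ρ ^ n) 0 2 := by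
  rw [symMom, circleAverage_of_conj (fun ρ => by simp only [symF_conj, hfc, map_pow, map_mul])
    ((hf.comp (continuous_circleMap 0 2)).mul ((continuous_symF_two ς).pow n)), Complex.ofReal_re]

lemma norm_circleAverage_le {g : ℂ → ℂ} {R C : ℝ} (h : ∀ θ, ‖g (circleMap 0 R θ)‖ ≤ C) :
    ‖Real.circleAverage g 0 R‖ ≤ C := by
  have hpi := Real.pi_pos
  have h1 := intervalIntegral.norm_integral_le_of_norm_le_const (a := 0) (b := 2 * Real.pi)
    (f := fun θ => g (circleMap 0 R θ)) fun θ _ => h θ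
  rw [Real.circleAverage_def, norm_smul, norm_inv, Real.norm_eq_abs, abs_of_pos (by positivity)]
  rw [sub_zero, abs_of_pos (by positivity)] at h1
  rw [inv_mul_le_iff₀ (by positivity)]
  linarith

lemma abs_symMom_le {f : ℂ → ℂ} {C : ℝ} (hC : ∀ w, ‖w‖ = 2 → ‖f w‖ ≤ C) (ς : ℝ) (n : ℕ) :
    |symMom f ς n| ≤ C * symBound ς ^ n := by
  refine (Complex.abs_re_le_norm _).trans (norm_circleAverage_le fun θ => ?_)
  rw [norm_mul, norm_pow]
  have h1 := hC _ (norm_circleMap_two θ)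
  exact mul_le_mul h1 (pow_le_pow_left₀ (norm_nonneg _) (norm_symF_le ς θ) n) (by positivity)
    ((norm_nonneg _).trans h1)

lemma hasSum_circleAverage {f : ℂ → ℂ} (hf : Continuous f) {C : ℝ} (hC : ∀ w, ‖w‖ = 2 → ‖f w‖ ≤ C)
    {ς z : ℝ} (hz : |z| * symBound ς < 1) :
    HasSum (fun n : ℕ => (z : ℂ) ^ n * Real.circleAverage (fun ρ => f ρ * symF ς ρ ^ (n + 1)) 0 2)
      (Real.circleAverage (fun ρ => f ρ * symF ς ρ / (1 - z * symF ς ρ)) 0 2) := by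
  have hM := symBound_pos ς
  have hs : Summable fun n : ℕ => C * symBound ς * (|z| * symBound ς) ^ n :=
    (summable_geometric_of_lt_one (by positivity) hz).mul_left _
  have hfc := hf.comp (continuous_circleMap 0 2)
  have key := intervalIntegral.hasSum_integral_of_dominated_convergence (μ := volume)
    (a := 0) (b := 2 * Real.pi)
    (F := fun (n : ℕ) θ => (z : ℂ) ^ n * (f (circleMap 0 2 θ) * symF ς (circleMap 0 2 θ) ^ (n + 1)))
    (f := fun θ => f (circleMap 0 2 θ) * symF ς (circleMap 0 2 θ)
      / (1 - z * symF ς (circleMap 0 2 θ)))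
    (fun n _ => C * symBound ς * (|z| * symBound ς) ^ n)
    (fun n => (continuous_const.mul (hfc.mul ((continuous_symF_two ς).pow _))).aestronglyMeasurable)
    (fun n => Eventually.of_forall fun θ _ => by
      have h1 := hC _ (norm_circleMap_two θ)
      have h2 := pow_le_pow_left₀ (norm_nonneg _) (norm_symF_le ς θ) (n + 1)
      have h3 := mul_le_mul h1 h2 (by positivity) ((norm_nonneg _).trans h1)
      rw [norm_mul, norm_mul, norm_pow, norm_pow, Complex.norm_real, Real.norm_eq_abs]
      calc _ ≤ |z| ^ n * (C * symBound ς ^ (n + 1)) := mul_le_mul_of_nonneg_left h3 (by positivity)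
        _ = _ := by ring)
    (Eventually.of_forall fun θ _ => hs)
    intervalIntegrable_const
    (Eventually.of_forall fun θ _ => by
      have hlt : ‖(z : ℂ) * symF ς (circleMap 0 2 θ)‖ < 1 := by
        rw [norm_mul, Complex.norm_real, Real.norm_eq_abs]
        exact (mul_le_mul_of_nonneg_left (norm_symF_le ς θ) (abs_nonneg _)).trans_lt hz
      have := (hasSum_geometric_of_norm_lt_one hlt).mul_left
        (f (circleMap 0 2 θ) * symF ς (circleMap 0 2 θ))
      rw [div_eq_mul_inv]
      refine this.congr_fun fun n => ?_
      ring)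
  have key2 := key.const_smul ((2 * Real.pi)⁻¹ : ℝ)
  simp only [Real.circleAverage_def]
  refine key2.congr_fun fun n => ?_
  rw [intervalIntegral.integral_const_mul, mul_smul_comm]

/-- The real inverse function `(1 - 1/ρ) e^{-ςρ}`. -/
def symPsi (ς ρ : ℝ) : ℝ := (1 - ρ⁻¹) * Real.exp (-(ς * ρ))

/-- The residue factor. -/
def symRes (ς ρ : ℝ) : ℝ := Real.exp (ς * ρ) / (ρ⁻¹ - ς * (ρ - 1))

/-- The function `w e^{ςw}`. -/
def mulExp (ς : ℝ) (w : ℂ) : ℂ := w * Complex.exp (ς * w)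

lemma hasDerivAt_mulExp (ς : ℝ) (w : ℂ) :
    HasDerivAt (mulExp ς) ((1 + ς * w) * Complex.exp (ς * w)) w := by
  have h1 : HasDerivAt (fun w : ℂ => (ς : ℂ) * w) ς w := by
    simpa using (hasDerivAt_id w).const_mul (ς : ℂ)
  refine HasDerivAt.congr_deriv (f := mulExp ς) ((hasDerivAt_id w).mul h1.cexp) ?_
  simp only [id]
  ring

/-- A Lipschitz constant of `mulExp` on the disc of radius `2`. -/
def mulExpBound (ς : ℝ) : ℝ := (1 + 2 * |ς|) * Real.exp (2 * |ς|)

lemma norm_dslope_mulExp_le {ς : ℝ} {v w : ℂ} (hv : ‖v‖ ≤ 2) (hw : ‖w‖ ≤ 2) :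
    ‖dslope (mulExp ς) v w‖ ≤ mulExpBound ς := by
  have hd : ∀ x : ℂ, ‖x‖ ≤ 2 → ‖(1 + ς * x) * Complex.exp (ς * x)‖ ≤ mulExpBound ς := fun x hx => by
    rw [norm_mul]
    refine mul_le_mul ?_ (norm_exp_mul_le hx) (norm_nonneg _) (by positivity)
    refine (norm_add_le _ _).trans ?_
    rw [norm_one, norm_mul, Complex.norm_real, Real.norm_eq_abs, mul_comm]
    have := mul_le_mul_of_nonneg_right hx (abs_nonneg ς)
    linarith
  by_cases hvw : w = v
  · rw [hvw, dslope_same, (hasDerivAt_mulExp ς v).deriv]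
    exact hd v hv
  · rw [dslope_of_ne _ hvw, slope_def_module, norm_smul, norm_inv,
      inv_mul_le_iff₀ (norm_pos_iff.2 (sub_ne_zero.2 hvw)), mul_comm]
    have := (convex_closedBall (0 : ℂ) 2).norm_image_sub_le_of_norm_hasDerivWithin_le
      (fun x _ => (hasDerivAt_mulExp ς x).hasDerivWithinAt) (fun x hx => hd x (by simpa using hx))
      (by simpa using hv : v ∈ Metric.closedBall (0 : ℂ) 2)
      (by simpa using hw : w ∈ Metric.closedBall (0 : ℂ) 2)
    exact this

lemma differentiable_dslope_mulExp (ς : ℝ) (v : ℂ) : Differentiable ℂ (dslope (mulExp ς) v) := by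
  have h : DifferentiableOn ℂ (mulExp ς) univ := fun x _ =>
    (hasDerivAt_mulExp ς x).differentiableAt.differentiableWithinAt
  have := (Complex.differentiableOn_dslope (c := v) univ_mem).2 h
  exact fun x => (this x (mem_univ x)).differentiableAt univ_mem

/-- For z = `symPsi ς ρ` the denominator w - 1 - z w e^{ςw} vanishes at w = ρ. The other factor 1 -
z · (divided difference of w e^{ςw}) has no zeros in the disc for small z. Cauchy's formula at ρ
gives the value. -/
lemma circleAverage_residue {f : ℂ → ℂ} (hf : Differentiable ℂ f) {ς ρ : ℝ} (hρ0 : 0 < ρ)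
    (hρ2 : ρ < 2) (hz : |symPsi ς ρ| * mulExpBound ς < 1) :
    Real.circleAverage (fun w => f w * symF ς w / (1 - symPsi ς ρ * symF ς w)) 0 2
      = f ρ * symRes ς ρ := by
  set z := symPsi ς ρ with hzdef
  have hρn : ‖(ρ : ℂ)‖ < 2 := by rwa [Complex.norm_real, Real.norm_eq_abs, abs_of_pos hρ0]
  have hzρ : (z : ℂ) * mulExp ς ρ = ρ - 1 := by
    rw [hzdef, symPsi, mulExp]
    have : (Complex.exp (ς * ρ)) = ((Real.exp (ς * ρ) : ℝ) : ℂ) := by push_cast; rfl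
    rw [this]
    norm_cast
    rw [Real.exp_neg]
    have := (Real.exp_pos (ς * ρ)).ne'
    field_simp
  have hne : ∀ w : ℂ, ‖w‖ ≤ 2 → 1 - z * dslope (mulExp ς) ρ w ≠ 0 := fun w hw h => by
    have h1 : ‖(z : ℂ) * dslope (mulExp ς) ρ w‖ < 1 := by
      rw [norm_mul, Complex.norm_real, Real.norm_eq_abs]
      exact (mul_le_mul_of_nonneg_left (norm_dslope_mulExp_le hρn.le hw) (abs_nonneg _)).trans_lt hz
    rw [← sub_eq_zero.1 h, norm_one] at h1
    exact lt_irrefl _ h1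
  set F : ℂ → ℂ := fun w => f w * Complex.exp (ς * w) / (1 - z * dslope (mulExp ς) ρ w) with hF
  have hFd : ∀ w : ℂ, ‖w‖ ≤ 2 → DifferentiableAt ℂ F w := fun w hw => by
    have h1 := (differentiable_dslope_mulExp ς ρ) w
    have h2 := hf w
    have h3 := hne w hw
    simp only [hF]
    fun_prop (disch := assumption)
  have hFc : DiffContOnCl ℂ F (Metric.ball 0 |2|) := by
    refine DifferentiableOn.diffContOnCl fun w hw => (hFd w ?_).differentiableWithinAt
    rw [abs_of_pos two_pos, closure_ball _ two_ne_zero] at hw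
    simpa using hw
  have key := hFc.circleAverage_smul_div (w := (ρ : ℂ)) (by simpa using hρn)
  have e1 : Real.circleAverage (fun w => f w * symF ς w / (1 - z * symF ς w)) 0 2
      = Real.circleAverage (fun w => ((w - 0) / (w - ρ)) • F w) 0 2 := by
    refine Real.circleAverage_congr_sphere fun w hw => ?_
    have hw2 : ‖w‖ = 2 := by simpa using hw
    have hw0 : w ≠ 0 := by rintro rfl; simp at hw2
    have hw1 : w - 1 ≠ 0 := fun h => by rw [sub_eq_zero.1 h] at hw2; simp at hw2
    have hwρ : w ≠ ρ := by rintro rfl; linarith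
    have hwρ' : w - ρ ≠ 0 := sub_ne_zero.2 hwρ
    have hd := hne w hw2.le
    have hs : dslope (mulExp ς) ρ w * (w - ρ) = mulExp ς w - mulExp ς ρ := by
      rw [dslope_of_ne _ hwρ, slope_def_field, div_mul_cancel₀ _ hwρ']
    have hsym : symF ς w = mulExp ς w / (w - 1) := by
      rw [symF, mulExp]; field_simp
    have hden : (w - ρ) * (1 - z * dslope (mulExp ς) ρ w) = w - 1 - z * mulExp ς w := by
      linear_combination -(z : ℂ) * hs + hzρ
    have hden0 : w - 1 - z * mulExp ς w ≠ 0 := by rw [← hden]; exact mul_ne_zero hwρ' hd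
    have hL : f w * symF ς w / (1 - z * symF ς w) = f w * mulExp ς w / (w - 1 - z * mulExp ς w) := by
      rw [hsym]
      have h3 : 1 - z * (mulExp ς w / (w - 1)) ≠ 0 := by
        rw [show 1 - z * (mulExp ς w / (w - 1)) = (w - 1 - z * mulExp ς w) / (w - 1) by field_simp]
        exact div_ne_zero hden0 hw1
      field_simp
    rw [hL, ← hden, sub_zero, hF, smul_eq_mul, mulExp]
    simp only
    field_simp
  rw [e1, key, hF]
  simp only
  rw [dslope_same, (hasDerivAt_mulExp ς ρ).deriv, mul_div_assoc]
  congr 1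
  have hx : (Complex.exp (ς * ρ)) = ((Real.exp (ς * ρ) : ℝ) : ℂ) := by push_cast; rfl
  rw [hx, symRes, hzdef, symPsi]
  norm_cast
  congr 1
  rw [Real.exp_neg]
  have := (Real.exp_pos (ς * ρ)).ne'
  field_simp
  ring

lemma hasDerivAt_symPsi (ς : ℝ) {ρ : ℝ} (hρ : ρ ≠ 0) :
    HasDerivAt (symPsi ς) (Real.exp (-(ς * ρ)) * (ρ⁻¹ * (ρ⁻¹ - ς * (ρ - 1)))) ρ := by
  have h1 : HasDerivAt (fun ρ : ℝ => -(ς * ρ)) (-ς) ρ := by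
    simpa using ((hasDerivAt_id ρ).const_mul ς).fun_neg
  refine HasDerivAt.congr_deriv (f := symPsi ς) (((hasDerivAt_inv hρ).const_sub 1).mul h1.exp) ?_
  field_simp
  ring

lemma symPsi_one (ς : ℝ) : symPsi ς 1 = 0 := by simp [symPsi]

/-- The derivative at 1 is nonzero, so the inverse function theorem applies. Identities of power
series near z = 0 can therefore be checked along z = `symPsi ς ρ` for ρ near 1. -/
lemma map_symPsi_nhds_one (ς : ℝ) : map (symPsi ς) (𝓝 1) = 𝓝 0 := by
  have h : HasStrictDerivAt (symPsi ς) (Real.exp (-(ς * 1)) * (1⁻¹ * (1⁻¹ - ς * (1 - 1)))) 1 := by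
    have hc : ContDiffAt ℝ 1 (symPsi ς) 1 := by
      unfold symPsi
      exact (contDiffAt_const.sub (contDiffAt_inv _ one_ne_zero)).mul (by fun_prop)
    exact hc.hasStrictDerivAt' (hasDerivAt_symPsi ς one_ne_zero) one_ne_zero
  have := h.map_nhds_eq (by simp)
  rwa [symPsi_one] at this

/-- The conditions under which the residue formula holds. -/
lemma eventually_symPsi (ς : ℝ) : ∀ᶠ ρ in 𝓝 (1 : ℝ), 0 < ρ ∧ ρ < 2 ∧
    |symPsi ς ρ| * mulExpBound ς < 1 ∧ |symPsi ς ρ| * symBound ς < 1 ∧ 0 < ρ⁻¹ - ς * (ρ - 1) := by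
  have hc : Tendsto (symPsi ς) (𝓝 1) (𝓝 0) := (map_symPsi_nhds_one ς).le
  have hc' : ∀ C, Tendsto (fun ρ => |symPsi ς ρ| * C) (𝓝 1) (𝓝 0) := fun C => by
    simpa using hc.abs.mul_const C
  have hN : ContinuousAt (fun ρ : ℝ => ρ⁻¹ - ς * (ρ - 1)) 1 :=
    (continuousAt_inv₀ one_ne_zero).sub (by fun_prop)
  have hN' : ∀ᶠ ρ in 𝓝 (1 : ℝ), 0 < ρ⁻¹ - ς * (ρ - 1) := hN.eventually (lt_mem_nhds (by simp))
  filter_upwards [lt_mem_nhds zero_lt_one, gt_mem_nhds one_lt_two,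
    (hc' (mulExpBound ς)).eventually (gt_mem_nhds one_pos),
    (hc' (symBound ς)).eventually (gt_mem_nhds one_pos), hN'] with ρ h1 h2 h3 h4 h5
    using ⟨h1, h2, h3, h4, h5⟩

lemma eventually_hasSum_symMom {f : ℂ → ℂ} (hf : Differentiable ℂ f)
    (hfc : ∀ ρ, f (starRingEnd ℂ ρ) = starRingEnd ℂ (f ρ)) (ς : ℝ) :
    ∀ᶠ ρ : ℝ in 𝓝 1, HasSum (fun n => symPsi ς ρ ^ n * symMom f ς (n + 1))
      ((f ρ).re * symRes ς ρ) := by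
  obtain ⟨C, hC⟩ := (isCompact_sphere (0 : ℂ) 2).exists_bound_of_continuousOn hf.continuous.continuousOn
  filter_upwards [eventually_symPsi ς] with ρ ⟨h1, h2, h3, h4, h5⟩
  have h := hasSum_circleAverage hf.continuous (fun w hw => hC w (by simpa using hw)) h4
  rw [circleAverage_residue hf h1 h2 h3] at h
  have h' := Complex.hasSum_re h
  simp only [← ofReal_symMom hf.continuous hfc] at h'
  rw [Complex.re_mul_ofReal] at h'
  refine h'.congr_fun fun n => ?_
  rw [← Complex.ofReal_pow, ← Complex.ofReal_mul, Complex.ofReal_re]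

/-- Termwise differentiation of a power series with geometrically bounded coefficients. -/
lemma hasDerivAt_tsum_pow {c : ℕ → ℝ} {C M : ℝ} (hM : 0 < M) (hc : ∀ n, |c n| ≤ C * M ^ n) {z : ℝ}
    (hz : |z| * M < 1) :
    HasDerivAt (fun z => ∑' n : ℕ, c n / (n + 1) * z ^ (n + 1)) (∑' n : ℕ, z ^ n * c n) z := by
  obtain ⟨r, hzr, hr⟩ := exists_between ((lt_div_iff₀ hM).2 hz)
  have hr0 : 0 < r := (abs_nonneg z).trans_lt hzr
  rw [lt_div_iff₀ hM] at hr
  have hs : Summable fun n : ℕ => C * (r * M) ^ n :=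
    (summable_geometric_of_lt_one (by positivity) hr).mul_left _
  refine hasDerivAt_tsum_of_isPreconnected (g := fun (n : ℕ) z => c n / (n + 1) * z ^ (n + 1))
    (g' := fun n z => z ^ n * c n) hs (isOpen_Ioo (a := -r) (b := r)) isPreconnected_Ioo (fun n y _ => ?_) (fun n y hy => ?_) (y₀ := 0) ⟨by linarith, hr0⟩ (by simp) (abs_lt.1 hzr)
  · refine ((hasDerivAt_pow (n + 1) y).const_mul (c n / (n + 1))).congr_deriv ?_
    push_cast
    have : (n : ℝ) + 1 ≠ 0 := by positivity
    field_simp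
  · rw [norm_mul, norm_pow, Real.norm_eq_abs, Real.norm_eq_abs, mul_pow, ← mul_assoc, mul_right_comm]
    rw [mul_comm (|y| ^ n)]
    exact mul_le_mul (hc n) (pow_le_pow_left₀ (abs_nonneg _) (abs_lt.2 hy).le n) (by positivity)
      ((abs_nonneg _).trans (hc n))

/-- The primitive of the generating function of the moments, along `symPsi`. -/
lemma eventually_primitive_symMom {f : ℂ → ℂ} (hf : Differentiable ℂ f)
    (hfc : ∀ ρ, f (starRingEnd ℂ ρ) = starRingEnd ℂ (f ρ)) (ς : ℝ) {G : ℝ → ℝ} (hG1 : G 1 = 0)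
    (hG : ∀ ρ : ℝ, 0 < ρ → HasDerivAt G ((f ρ).re * ρ⁻¹) ρ) :
    ∀ᶠ ρ in 𝓝 1, ∑' n : ℕ, symMom f ς (n + 1) / (n + 1) * symPsi ς ρ ^ (n + 1) = G ρ := by
  obtain ⟨C, hC⟩ := (isCompact_sphere (0 : ℂ) 2).exists_bound_of_continuousOn hf.continuous.continuousOn
  have hb : ∀ n, |symMom f ς (n + 1)| ≤ C * symBound ς * symBound ς ^ n := fun n => by
    refine (abs_symMom_le (fun w hw => hC w (by simpa using hw)) ς (n + 1)).trans_eq ?_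
    ring
  have hev := (eventually_symPsi ς).and (eventually_hasSum_symMom hf hfc ς)
  obtain ⟨ε, hε, hball⟩ := Metric.eventually_nhds_iff_ball.1 hev
  have hder : ∀ ρ ∈ Metric.ball (1 : ℝ) ε, HasDerivAt
      (fun ρ => ∑' n : ℕ, symMom f ς (n + 1) / (n + 1) * symPsi ς ρ ^ (n + 1))
      ((f ρ).re * ρ⁻¹) ρ := fun ρ hρ => by
    obtain ⟨⟨h1, h2, h3, h4, h5⟩, h6⟩ := hball ρ hρ
    have h := hasDerivAt_tsum_pow (symBound_pos ς) hb h4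
    rw [h6.tsum_eq] at h
    -- `symRes` times the derivative of `symPsi` is 1/ρ².. multiplied by ρ, that is 1/ρ; only f(ρ)/ρ
    -- is left.
    refine (h.comp ρ (hasDerivAt_symPsi ς h1.ne')).congr_deriv ?_
    rw [symRes, Real.exp_neg]
    have hx := (Real.exp_pos (ς * ρ)).ne'
    have hN : 1 - ς * ρ * (ρ - 1) ≠ 0 := by
      have := mul_pos h1 h5
      rw [mul_sub, mul_inv_cancel₀ h1.ne'] at this
      intro h0
      linarith
    field_simp
  have heq := Metric.isOpen_ball.eqOn_of_deriv_eq (convex_ball (1 : ℝ) ε).isPreconnected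
    (f := fun ρ => ∑' n : ℕ, symMom f ς (n + 1) / (n + 1) * symPsi ς ρ ^ (n + 1)) (g := G)
    (fun ρ hρ => (hder ρ hρ).differentiableAt.differentiableWithinAt)
    (fun ρ hρ => (hG ρ (hball ρ hρ).1.1).differentiableAt.differentiableWithinAt)
    (fun ρ hρ => by rw [(hder ρ hρ).deriv, (hG ρ (hball ρ hρ).1.1).deriv])
    (Metric.mem_ball_self hε) (by simp [symPsi_one, hG1])
  filter_upwards [Metric.ball_mem_nhds (1 : ℝ) hε] with ρ hρ using heq hρ

end

end QPlancherel

/-! ### Power sums, complete symmetric functions, and Newton's identities. -/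

namespace QPlancherel

noncomputable section

lemma coeff_eq_of_eventually_hasSum {c d : ℕ → ℝ} {g : ℝ → ℝ}
    (hc : ∀ᶠ z in 𝓝 (0 : ℝ), HasSum (fun n => z ^ n * c n) (g z))
    (hd : ∀ᶠ z in 𝓝 (0 : ℝ), HasSum (fun n => z ^ n * d n) (g z)) : c = d := by
  have h : ∀ e : ℕ → ℝ, (∀ᶠ z in 𝓝 (0 : ℝ), HasSum (fun n => z ^ n * e n) (g z)) →
      HasFPowerSeriesAt g (FormalMultilinearSeries.ofScalars ℝ e) 0 := fun e he => by
    rw [hasFPowerSeriesAt_iff]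
    simpa [FormalMultilinearSeries.coeff_ofScalars] using he
  have := (h c hc).eq_formalMultilinearSeries (h d hd)
  funext n
  simpa [FormalMultilinearSeries.coeff_ofScalars] using
    congrArg (fun p : FormalMultilinearSeries ℝ ℝ ℝ => p.coeff n) this

lemma coeff_eq_of_eventually_symPsi {c d : ℕ → ℝ} {ς : ℝ} {g : ℝ → ℝ}
    (hc : ∀ᶠ ρ in 𝓝 (1 : ℝ), HasSum (fun n => symPsi ς ρ ^ n * c n) (g ρ))
    (hd : ∀ᶠ ρ in 𝓝 (1 : ℝ), HasSum (fun n => symPsi ς ρ ^ n * d n) (g ρ)) : c = d := by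
  have h : ∀ᶠ z in 𝓝 (0 : ℝ), ∃ v, HasSum (fun n => z ^ n * c n) v ∧ HasSum (fun n => z ^ n * d n) v := by
    rw [← map_symPsi_nhds_one ς, eventually_map]
    exact (hc.and hd).mono fun ρ h => ⟨g ρ, h.1, h.2⟩
  refine coeff_eq_of_eventually_hasSum (g := fun z => ∑' n, z ^ n * c n) ?_ ?_
  · exact h.mono fun z ⟨v, h1, _⟩ => h1.summable.hasSum
  · exact h.mono fun z ⟨v, h1, h2⟩ => h1.tsum_eq ▸ h2

/-- The power sums: averages of the powers of `symF`. -/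
def symP (ς : ℝ) (n : ℕ) : ℝ := symMom (fun _ => 1) ς n

/-- The complete symmetric functions attached to the power sums `symP`. -/
def symH (ς : ℝ) (n : ℕ) : ℝ := if n = 0 then 1 else symMom id ς n / n

lemma eventually_hasSum_symP (ς : ℝ) :
    ∀ᶠ ρ : ℝ in 𝓝 1, HasSum (fun n => symPsi ς ρ ^ n * symP ς (n + 1)) (symRes ς ρ) := by
  simpa [symP] using eventually_hasSum_symMom (f := fun _ => 1) (differentiable_const _) (by simp) ς

lemma eventually_hasSum_symMom_id (ς : ℝ) :
    ∀ᶠ ρ : ℝ in 𝓝 1, HasSum (fun n => symPsi ς ρ ^ n * symMom id ς (n + 1)) (ρ * symRes ς ρ) := by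
  simpa using eventually_hasSum_symMom (f := id) differentiable_id (by simp) ς

lemma summable_div_mul_pow {c : ℕ → ℝ} {z : ℝ} (hs : Summable fun n => z ^ n * c n) :
    Summable fun n : ℕ => c n / (n + 1) * z ^ (n + 1) := by
  refine .of_norm_bounded (hs.abs.mul_left |z|) fun n => ?_
  have h1 : (1 : ℝ) ≤ n + 1 := by linarith [(Nat.cast_nonneg n : (0 : ℝ) ≤ n)]
  rw [Real.norm_eq_abs, abs_mul, abs_div, abs_mul, abs_of_pos (by linarith : (0 : ℝ) < n + 1),
    pow_succ, abs_mul]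
  have := div_le_self (abs_nonneg (c n)) h1
  nlinarith [mul_nonneg (abs_nonneg (z ^ n)) (abs_nonneg z)]

/-- For f(ρ) = ρ the primitive of f(ρ)/ρ is ρ - 1, and the term `symH ς 0 = 1` supplies the missing
constant. -/
lemma eventually_hasSum_symH (ς : ℝ) :
    ∀ᶠ ρ : ℝ in 𝓝 1, HasSum (fun n => symPsi ς ρ ^ n * symH ς n) ρ := by
  have h1 := eventually_primitive_symMom (f := id) differentiable_id (by simp) ς
    (G := fun ρ => ρ - 1) (by simp) (fun ρ hρ => by
      simpa [hρ.ne'] using (hasDerivAt_id ρ).sub_const 1)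
  filter_upwards [h1, eventually_hasSum_symMom_id ς] with ρ h2 h3
  have h4 := (summable_div_mul_pow h3.summable).hasSum
  rw [h2] at h4
  rw [← hasSum_nat_add_iff' 1]
  simp only [Finset.sum_range_one, pow_zero, symH, if_true, mul_one]
  refine h4.congr_fun fun n => ?_
  simp [mul_comm]

/-- For f = 1 the primitive of f(ρ)/ρ is log ρ. Compared with `eventually_hasSum_symH`, this is the
relation between power sums and complete symmetric functions. -/
lemma eventually_hasSum_log (ς : ℝ) :
    ∀ᶠ ρ : ℝ in 𝓝 1, HasSum (fun n : ℕ => symP ς (n + 1) / (n + 1) * symPsi ς ρ ^ (n + 1))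
      (Real.log ρ) := by
  have h1 := eventually_primitive_symMom (f := fun _ => 1) (differentiable_const _) (by simp) ς
    (G := Real.log) (by simp) (fun ρ hρ => by simpa using Real.hasDerivAt_log hρ.ne')
  filter_upwards [h1, eventually_hasSum_symP ς] with ρ h2 h3
  have h4 := (summable_div_mul_pow h3.summable).hasSum
  rwa [show ∑' n : ℕ, symP ς (n + 1) / (n + 1) * symPsi ς ρ ^ (n + 1) = Real.log ρ from h2] at h4

/-- Newton's identity. -/
lemma newton_symP (ς : ℝ) (n : ℕ) :
    ((n + 1 : ℕ) : ℝ) * symH ς (n + 1)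
      = ∑ kl ∈ Finset.HasAntidiagonal.antidiagonal n, symP ς (kl.1 + 1) * symH ς kl.2 := by
  have key := coeff_eq_of_eventually_symPsi (ς := ς) (g := fun ρ => ρ * symRes ς ρ)
    (c := fun n => symMom id ς (n + 1))
    (d := fun n => ∑ kl ∈ Finset.HasAntidiagonal.antidiagonal n, symP ς (kl.1 + 1) * symH ς kl.2)
    (eventually_hasSum_symMom_id ς) (by
      filter_upwards [eventually_hasSum_symP ς, eventually_hasSum_symH ς] with ρ h1 h2
      have hs1 : Summable fun n => ‖symPsi ς ρ ^ n * symP ς (n + 1)‖ := h1.summable.norm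
      have hs2 : Summable fun n => ‖symPsi ς ρ ^ n * symH ς n‖ := h2.summable.norm
      have h3 := (summable_norm_sum_mul_antidiagonal_of_summable_norm hs1 hs2).of_norm.hasSum
      rw [← tsum_mul_tsum_eq_tsum_sum_antidiagonal_of_summable_norm hs1 hs2, h1.tsum_eq, h2.tsum_eq,
        mul_comm] at h3
      refine h3.congr_fun fun n => ?_
      rw [Finset.mul_sum]
      refine Finset.sum_congr rfl fun kl hkl => ?_
      rw [← Finset.HasAntidiagonal.mem_antidiagonal.1 hkl, pow_add]
      ring)
  rw [← congrFun key n, symH, if_neg n.succ_ne_zero, mul_div_cancel₀]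
  exact Nat.cast_ne_zero.2 n.succ_ne_zero

/-- At ς = 0 one has z = 1 - 1/ρ, and `symRes 0 ρ` = ρ = 1/(1 - z) is the geometric series. -/
lemma symP_zero_left (n : ℕ) : symP 0 (n + 1) = 1 := by
  have := coeff_eq_of_eventually_symPsi (ς := 0) (g := symRes 0)
    (c := fun n => symP 0 (n + 1)) (d := fun _ => 1) (eventually_hasSum_symP 0) (by
      have hc : Tendsto (symPsi 0) (𝓝 1) (𝓝 0) := (map_symPsi_nhds_one 0).le
      filter_upwards [hc.abs.eventually (gt_mem_nhds (by simp : |(0 : ℝ)| < 1)),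
        lt_mem_nhds zero_lt_one] with ρ h1 h2
      have := hasSum_geometric_of_abs_lt_one h1
      simpa [symPsi, symRes] using this)
  exact congrFun this n

lemma integral_exp_limMeasure_eq {α : ℝ} (hα : 0 < α) (n : ℕ) :
    ∫ u, Real.exp (n * (α * u)) ∂limMeasure α = symP (α ^ 2) n := by
  have h2 := integral_exp_limMeasure hα n
  have h3 := ofReal_symMom (f := fun _ => 1) continuous_const (by simp) (α ^ 2) n
  simp only [one_mul] at h3
  rw [← h3] at h2
  exact_mod_cast h2

/-- The transform of the limiting diagram satisfies the limit equation near infinity. -/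
lemma eventually_trG_limMeasure {α : ℝ} (hα : 0 < α) : ∀ᶠ x : ℝ in atTop,
    trG α 0 (cCharge 0 (diagramOf (limMeasure α))) x
      * kerE α (x - trG α 0 (cCharge 0 (diagramOf (limMeasure α))) x) = 1 := by
  have := isProbabilityMeasure_limMeasure hα
  obtain ⟨a, b, ha, hb, hτ⟩ := exists_ae_limMeasure_mem hα
  have hz : ∀ᶠ z in 𝓝 (0 : ℝ), ∃ ρ : ℝ, 0 < ρ ∧ z = symPsi (α ^ 2) ρ ∧
      HasSum (fun n : ℕ => symP (α ^ 2) (n + 1) / (n + 1) * z ^ (n + 1)) (Real.log ρ) := by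
    rw [← map_symPsi_nhds_one (α ^ 2), eventually_map]
    filter_upwards [eventually_hasSum_log (α ^ 2), lt_mem_nhds zero_lt_one] with ρ h1 h2
      using ⟨ρ, h2, rfl, h1⟩
  have hlim : Tendsto (fun x => Real.exp (-(α * x))) atTop (𝓝 0) :=
    Real.tendsto_exp_neg_atTop_nhds_zero.comp (tendsto_id.const_mul_atTop hα)
  have hlim2 : Tendsto (fun x => Real.exp (-(α * x)) * Real.exp (α * b)) atTop (𝓝 0) := by
    simpa using hlim.mul_const (Real.exp (α * b))
  filter_upwards [hlim.eventually hz, hlim2.eventually (gt_mem_nhds one_pos), eventually_gt_atTop b]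
    with x ⟨ρ, hρ, hzρ, hs⟩ hx1 hx2
  have h1 := hasSum_log_integral hα (Real.exp_pos (-(α * x))).le hx1 hτ
  have h2 : -∫ u, Real.log (1 - Real.exp (-(α * x)) * Real.exp (α * u)) ∂limMeasure α = Real.log ρ := by
    refine h1.unique (hs.congr_fun fun n => ?_)
    rw [integral_exp_limMeasure_eq hα]
    ring
  rw [trG_diagramOf ha hb hτ (integral_id_limMeasure hα) hα hx2, h2, Real.exp_log hρ, kerE,
    if_neg hα.ne']
  norm_cast
  -- This is e^{-αx} = `symPsi (α ^ 2) ρ` rearranged; it makes `kerE` at x - αρ equal to 1/(αρ), the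
  -- inverse of G = αρ.
  have h3 : Real.exp (-(α * (x - α * ρ))) = 1 - ρ⁻¹ := by
    rw [show -(α * (x - α * ρ)) = -(α * x) + α ^ 2 * ρ by ring, Real.exp_add, hzρ, symPsi, mul_assoc,
      ← Real.exp_add, neg_add_cancel, Real.exp_zero, mul_one]
  rw [h3]
  field_simp
  ring

/-- The average of `symF ^ n` as a function of the parameter. -/
lemma hasDerivAt_symP (ς : ℝ) (n : ℕ) :
    HasDerivAt (fun ς => symP ς n) (n * symMom id ς n) ς := by
  have hcont : ∀ ς, Continuous fun θ => symF ς (circleMap 0 2 θ) ^ n := fun ς =>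
    (continuous_symF_two ς).pow n
  have hcm := continuous_circleMap (0 : ℂ) 2
  have hder : ∀ (w : ℂ) (x : ℝ), HasDerivAt (fun ς => symF ς w ^ n) (n * (w * symF x w ^ n)) x := by
    intro w x
    have h1 : HasDerivAt (fun ς : ℝ => (ς : ℂ) * w) w x := by
      simpa using (Complex.ofRealCLM.hasDerivAt (x := x)).mul_const w
    have h2 := (h1.cexp.mul_const (1 - w⁻¹)⁻¹).pow n
    rcases n with _ | n
    · simpa using hasDerivAt_const x (1 : ℂ)
    · refine h2.congr_deriv ?_
      simp only [symF, Nat.add_sub_cancel]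
      ring
  have key := (intervalIntegral.hasDerivAt_integral_of_dominated_loc_of_deriv_le (𝕜 := ℝ)
    (μ := volume) (a := 0) (b := 2 * Real.pi) (s := Metric.ball ς 1) (x₀ := ς)
    (F := fun ς θ => symF ς (circleMap 0 2 θ) ^ n)
    (F' := fun ς θ => n * (circleMap 0 2 θ * symF ς (circleMap 0 2 θ) ^ n))
    (bound := fun _ => n * (2 * symBound (|ς| + 1) ^ n))
    (Metric.ball_mem_nhds ς one_pos)
    (Eventually.of_forall fun x => (hcont x).aestronglyMeasurable)
    ((hcont ς).intervalIntegrable _ _)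
    (continuous_const.mul (hcm.mul (hcont ς))).aestronglyMeasurable
    (Eventually.of_forall fun θ _ x hx => by
      have hx' : |x| ≤ |(|ς| + 1)| := by
        rw [Metric.mem_ball, Real.dist_eq] at hx
        rw [abs_of_nonneg (by positivity : (0 : ℝ) ≤ |ς| + 1)]
        have := abs_sub_abs_le_abs_sub x ς
        linarith
      have hb : symBound x ≤ symBound (|ς| + 1) := by
        unfold symBound
        have := Real.exp_le_exp.2 (mul_le_mul_of_nonneg_left hx' two_pos.le)
        linarith
      rw [norm_mul, norm_mul, norm_pow, norm_circleMap_two, Complex.norm_natCast]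
      have := pow_le_pow_left₀ (norm_nonneg _) ((norm_symF_le x θ).trans hb) n
      exact mul_le_mul_of_nonneg_left (by linarith) (Nat.cast_nonneg n))
    intervalIntegrable_const
    (Eventually.of_forall fun θ _ x _ => hder _ x)).2
  have key2 : HasDerivAt (fun ς => Real.circleAverage (fun w => 1 * symF ς w ^ n) 0 2)
      (n * Real.circleAverage (fun w => id w * symF ς w ^ n) 0 2) ς := by
    simp only [Real.circleAverage_def, one_mul, id]
    refine (key.const_smul ((2 * Real.pi)⁻¹ : ℝ)).congr_deriv ?_
    rw [intervalIntegral.integral_const_mul, mul_smul_comm]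
  have key3 := (Complex.reCLM.hasFDerivAt.comp_hasDerivAt ς key2)
  refine (HasDerivAt.congr_deriv (f := fun ς => symP ς n) key3 ?_)
  simp [symMom]

/-- The weight of a partition given by its parts. -/
def partWeight (y : ℕ → ℝ) (s : Multiset ℕ) : ℝ :=
  ∏ k ∈ s.toFinset, y k ^ s.count k / ((k : ℝ) ^ s.count k * (s.count k).factorial)

lemma hPoly_eq (n : ℕ) (y : ℕ → ℝ) : hPoly n y = ∑ p : n.Partition, partWeight y p.parts := rfl

/-- Only the factor of k changes; the new multiplicity comes out of the factorial and k out of the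
power. -/
lemma partWeight_cons (y : ℕ → ℝ) {k : ℕ} (hk : 0 < k) (s : Multiset ℕ) :
    (k * (k ::ₘ s).count k : ℝ) * partWeight y (k ::ₘ s) = y k * partWeight y s := by
  have hk' : (k : ℝ) ≠ 0 := by positivity
  set F := insert k s.toFinset with hF
  have h1 : partWeight y (k ::ₘ s) = ∏ j ∈ F, y j ^ (k ::ₘ s).count j
      / ((j : ℝ) ^ (k ::ₘ s).count j * ((k ::ₘ s).count j).factorial) := by
    rw [partWeight, Multiset.toFinset_cons]
  have h2 : partWeight y s = ∏ j ∈ F, y j ^ s.count j / ((j : ℝ) ^ s.count j * (s.count j).factorial) := by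
    refine Finset.prod_subset (Finset.subset_insert _ _) fun j _ hj => ?_
    have : s.count j = 0 := Multiset.count_eq_zero.2 (by simpa using hj)
    simp [this]
  have hkF : k ∈ F := Finset.mem_insert_self _ _
  rw [h1, h2, ← Finset.mul_prod_erase F _ hkF, ← Finset.mul_prod_erase F _ hkF, ← mul_assoc,
    ← mul_assoc]
  congr 1
  · rw [Multiset.count_cons_self, Nat.factorial_succ]
    have := (Nat.cast_ne_zero (R := ℝ)).2 (s.count k).factorial_ne_zero
    push_cast
    have h3 : (s.count k : ℝ) + 1 ≠ 0 := by positivity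
    field_simp
    ring
  · refine Finset.prod_congr rfl fun j hj => ?_
    rw [Multiset.count_cons_of_ne (Finset.ne_of_mem_erase hj)]

/-- Newton's identity for the polynomials `hPoly`. -/
lemma newton_hPoly (n : ℕ) (y : ℕ → ℝ) :
    (n : ℝ) * hPoly n y = ∑ k ∈ Finset.Icc 1 n, y k * hPoly (n - k) y := by
  have e1 : ∀ p : n.Partition, (n : ℝ) * partWeight y p.parts
      = ∑ k ∈ Finset.Icc 1 n, if k ∈ p.parts then (k * p.parts.count k : ℝ) * partWeight y p.parts
          else 0 := fun p => by
    -- Grouping the parts by size splits n times the weight into terms that mark a part k. Removing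
    -- that part gives a bijection with the partitions of n - k.
    have h1 : (n : ℝ) = ∑ k ∈ Finset.Icc 1 n, (p.parts.count k : ℝ) * k := by
      conv_lhs => rw [← p.parts_sum, Finset.sum_multiset_count]
      push_cast
      simp only [smul_eq_mul, Nat.cast_mul]
      refine Finset.sum_subset (fun k hk => ?_) fun k _ hk => ?_
      · rw [Multiset.mem_toFinset] at hk
        exact Finset.mem_Icc.2 ⟨p.parts_pos hk, p.le_of_mem_parts hk⟩
      · rw [Multiset.mem_toFinset] at hk
        simp [hk]
    conv_lhs => rw [h1, Finset.sum_mul]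
    refine Finset.sum_congr rfl fun k _ => ?_
    split_ifs with hk
    · ring
    · simp [hk]
  rw [hPoly_eq, Finset.mul_sum, Finset.sum_congr rfl fun p _ => e1 p, Finset.sum_comm]
  refine Finset.sum_congr rfl fun k hk => ?_
  obtain ⟨hk1, hkn⟩ := Finset.mem_Icc.1 hk
  rw [hPoly_eq, Finset.mul_sum, ← Finset.sum_filter, ← Finset.sum_subtype_eq_sum_filter,
    Finset.subtype_univ]
  refine Fintype.sum_equiv (Nat.Partition.partitionWithPartEquiv hk1 hkn) _ _ fun p => ?_
  rw [Nat.Partition.partitionWithPartEquiv_apply_parts, ← partWeight_cons y hk1,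
    Multiset.cons_erase p.2]

end

end QPlancherel

/-! ### The moment system, the limiting diagram, and uniform convergence. -/

namespace QPlancherel

noncomputable section

lemma hPoly_zero (y : ℕ → ℝ) : hPoly 0 y = 1 := by
  simp [hPoly_eq, partWeight]

lemma hPoly_congr {n : ℕ} {y y' : ℕ → ℝ} (h : ∀ k, 1 ≤ k → k ≤ n → y k = y' k) :
    hPoly n y = hPoly n y' := by
  rw [hPoly_eq, hPoly_eq]
  refine Finset.sum_congr rfl fun p _ => Finset.prod_congr rfl fun k hk => ?_
  rw [Multiset.mem_toFinset] at hk
  rw [h k (p.parts_pos hk) (p.le_of_mem_parts hk)]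

/-- Both sides satisfy Newton's recursion with the same power sums and start from 1. -/
lemma symH_eq_hPoly (ς : ℝ) (n : ℕ) : symH ς n = hPoly n (symP ς) := by
  induction n using Nat.strong_induction_on with
  | _ n ih =>
    rcases n with _ | n
    · rw [hPoly_zero, symH, if_pos rfl]
    · have h1 := newton_symP ς n
      rw [Finset.Nat.sum_antidiagonal_eq_sum_range_succ (fun i j => symP ς (i + 1) * symH ς j)] at h1
      have h2 : ∑ k ∈ Finset.Icc 1 (n + 1), symP ς k * hPoly (n + 1 - k) (symP ς)
          = ∑ k ∈ Finset.range n.succ, symP ς (k + 1) * symH ς (n - k) := by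
        symm
        refine Finset.sum_nbij' (· + 1) (· - 1) (fun k hk => ?_) (fun k hk => ?_) (fun k _ => ?_)
          (fun k hk => ?_) fun k hk => ?_
        · simp only [Finset.mem_range, Finset.mem_Icc] at hk ⊢; omega
        · simp only [Finset.mem_range, Finset.mem_Icc] at hk ⊢; omega
        · simp
        · simp only [Finset.mem_Icc] at hk; omega
        · rw [ih (n - k) (by omega), Nat.add_sub_add_right]
      rw [← h2, ← newton_hPoly] at h1
      exact mul_left_cancel₀ (Nat.cast_ne_zero.2 n.succ_ne_zero) h1

/-- The power sums solve the system of differential equations. -/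
lemma solvesMomentSystem_symP : SolvesMomentSystem fun n ς => symP ς n := by
  intro n hn
  obtain ⟨m, rfl⟩ := Nat.exists_eq_add_of_le' hn
  refine ⟨symP_zero_left m, fun ς _ => (hasDerivAt_symP ς (m + 1)).hasDerivWithinAt.congr_deriv ?_⟩
  have hm : ((m + 1 : ℕ) : ℝ) ≠ 0 := Nat.cast_ne_zero.2 m.succ_ne_zero
  have : hPoly (m + 1) (fun k => symP ς k) = symMom id ς (m + 1) / (m + 1 : ℕ) := by
    rw [← symH_eq_hPoly, symH, if_neg m.succ_ne_zero]
  rw [this]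
  field_simp

/-- In Newton's identity only the term k = n sees the top variable, with coefficient h₀ = 1. So the
system is triangular and affine in the top unknown. -/
lemma hPoly_sub_hPoly {n : ℕ} {y y' : ℕ → ℝ} (h : ∀ k, 1 ≤ k → k < n → y k = y' k) (hn : 1 ≤ n) :
    (n : ℝ) * (hPoly n y - hPoly n y') = y n - y' n := by
  rw [mul_sub, newton_hPoly, newton_hPoly, ← Finset.sum_sub_distrib,
    Finset.sum_eq_single_of_mem n (Finset.mem_Icc.2 ⟨hn, le_rfl⟩)]
  · simp [hPoly_zero]
  · intro k hk hkn
    obtain ⟨h1, h2⟩ := Finset.mem_Icc.1 hk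
    rw [h k h1 (lt_of_le_of_ne h2 hkn), hPoly_congr fun j h3 h4 => h j h3 (by omega), sub_self]

/-- The system of differential equations has at most one solution. -/
lemma SolvesMomentSystem.unique {y y' : ℕ → ℝ → ℝ} (h : SolvesMomentSystem y)
    (h' : SolvesMomentSystem y') {n : ℕ} (hn : 1 ≤ n) {ς : ℝ} (hς : 0 ≤ ς) : y n ς = y' n ς := by
  induction n using Nat.strong_induction_on generalizing ς with
  | _ n ih =>
    -- Once the lower unknowns agree, the difference d of the n-th ones satisfies d' = n d; e^{-nu}
    -- is the integrating factor.
    have hd : ∀ u, 0 ≤ u → HasDerivWithinAt (fun u => Real.exp (-(n * u)) * (y n u - y' n u)) 0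
        (Ici 0) u := fun u hu => by
      have h1 : HasDerivAt (fun u : ℝ => -(n * u)) (-n : ℝ) u := by
        simpa using ((hasDerivAt_id u).const_mul (n : ℝ)).fun_neg
      refine (h1.exp.hasDerivWithinAt.mul
        (((h n hn).2 u hu).sub ((h' n hn).2 u hu))).congr_deriv ?_
      have h2 := hPoly_sub_hPoly (n := n) (y := fun k => y k u) (y' := fun k => y' k u)
        (fun k hk hkn => ih k hkn hk hu) hn
      simp only [Pi.sub_apply]
      linear_combination (n * Real.exp (-(n * u))) * h2
    have h3 := constant_of_has_deriv_right_zero (a := 0) (b := ς)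
      (f := fun u => Real.exp (-(n * u)) * (y n u - y' n u))
      (fun u hu => ((hd u hu.1).continuousWithinAt).mono Icc_subset_Ici_self)
      (fun u hu => (hd u hu.1).mono (Ici_subset_Ici.2 hu.1)) ς ⟨hς, le_rfl⟩
    simp only [(h n hn).1, (h' n hn).1, sub_self, mul_zero, mul_eq_zero, Real.exp_ne_zero, false_or,
      sub_eq_zero] at h3
    exact h3

/-- The limiting diagram. -/
def limDiagram (s q : ℝ) : ℝ := diagramOf (limMeasure (-Real.log q)) s

section LimDiagram

variable {q : ℝ} (hq : q ∈ Ioo (0 : ℝ) 1)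

include hq

lemma exists_isDiagramWith_limDiagram : ∃ a b, IsDiagramWith a b 0 fun s => limDiagram s q := by
  have hα := neg_log_pos hq
  have := isProbabilityMeasure_limMeasure hα
  obtain ⟨a, b, ha, hb, hτ⟩ := exists_ae_limMeasure_mem hα
  exact ⟨a, b, isDiagramWith_diagramOf ha hb hτ (integral_id_limMeasure hα)⟩

lemma isDiagramWith_limDiagram {a b : ℝ} (h : InDiagramSpace a b fun s => limDiagram s q) :
    IsDiagramWith a b 0 fun s => limDiagram s q := by
  obtain ⟨c, hc⟩ := h.exists_center
  obtain ⟨A, B, h0⟩ := exists_isDiagramWith_limDiagram hq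
  have : c = 0 := h0.center_eq_of_le hc fun _ => le_rfl
  rwa [this] at hc

lemma isContinualDiagram_limDiagram : IsContinualDiagram fun s => limDiagram s q := by
  obtain ⟨A, B, h0⟩ := exists_isDiagramWith_limDiagram hq
  refine ⟨h0.lip, 0, max |A| |B|, fun s hs => h0.out s fun hm => ?_⟩
  exact absurd (abs_le_max_abs_abs hm.1 hm.2) (not_le.2 hs)

lemma limitEquation_limDiagram {a b x : ℝ} (h : InDiagramSpace a b fun s => limDiagram s q)
    (hx : x ∉ Icc a b) : LimitEquation q x (qR q (fun s => limDiagram s q) x) := by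
  have hα := neg_log_pos hq
  have hd := isDiagramWith_limDiagram hq h
  rw [limitEquation_iff hq (hd.qR_eq hq hx)]
  exact hd.limit_eq_of_eventually hα.le (eventually_trG_limMeasure hα) (ofReal_mem_outer hx)

/-- The equation at large x forces the center to be 0; it then extends to the strip, where
`charge_unique` applies. -/
lemma eq_limDiagram_of_limitEquation {a b : ℝ} {v : ℝ → ℝ} (hv : InDiagramSpace a b v)
    (h : ∀ x, x ∉ Icc a b → LimitEquation q x (qR q v x)) (s : ℝ) : v s = limDiagram s q := by
  have hα := neg_log_pos hq
  obtain ⟨c, hc⟩ := hv.exists_center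
  have hev : ∀ᶠ x : ℝ in atTop, trG (-Real.log q) c (cCharge c v) x
      * kerE (-Real.log q) (x - trG (-Real.log q) c (cCharge c v) x) = 1 := by
    filter_upwards [eventually_gt_atTop b] with x hx
    have hx' : x ∉ Icc a b := fun h' => absurd h'.2 (not_le.2 hx)
    rw [← limitEquation_iff hq (hc.qR_eq hq hx')]
    exact h x hx'
  obtain rfl : c = 0 := hc.center_eq_zero hα hev
  obtain ⟨A, B, h0⟩ := exists_isDiagramWith_limDiagram hq
  have key := charge_unique hα.le hc.integrable_cCharge h0.integrable_cCharge hc.continuous_cCharge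
    h0.continuous_cCharge
    (fun x hx => hc.limit_eq_of_eventually hα.le hev (strip_subset_outer a b hx))
    (fun x hx => h0.limit_eq_of_eventually hα.le (eventually_trG_limMeasure hα)
      (strip_subset_outer A B hx))
  have := congrFun key s
  simp only [cCharge] at this
  linarith

lemma exists_rayleighMeasure_limDiagram : ∃ τ : SignedMeasure ℝ,
    IsRayleighMeasure (fun s => limDiagram s q) τ ∧
      ∀ n, qMoment q n τ = symP (Real.log q ^ 2) n := by
  have hα := neg_log_pos hq
  have := isProbabilityMeasure_limMeasure hα
  obtain ⟨a, b, ha, hb, hτ⟩ := exists_ae_limMeasure_mem hα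
  refine ⟨(limMeasure (-Real.log q)).toSignedMeasure, isRayleighMeasure_diagramOf hτ, fun n => ?_⟩
  rw [qMoment_toSignedMeasure hq.1, integral_exp_limMeasure_eq hα, neg_sq]

end LimDiagram

/-- The common asymptotics of the solutions of the dynamic equation. -/
theorem tendstoUniformlyOn_limDiagram {a b t₀ : ℝ} {w : ℝ → ℝ → ℝ → ℝ}
    (h0 : ∀ q ∈ Ioo (0 : ℝ) 1, InDiagramSpace a b (fun s => w s t₀ q))
    (hw : ∀ q ∈ Ioo (0 : ℝ) 1, SolvesDynamicEquation q t₀ (fun s t => w s t q)) :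
    TendstoUniformlyOn
      (fun (t : ℝ) (p : ℝ × ℝ) => 1 / √t * w (p.1 * √t) t (p.2 ^ (1 / √t)))
      (fun p => limDiagram p.1 p.2) atTop (univ ×ˢ Ioo (0 : ℝ) 1) := by
  rw [Metric.tendstoUniformlyOn_iff]
  intro ε hε
  by_contra hcon
  have hfr := frequently_atTop.1 (not_eventually.1 hcon)
  -- A failure of uniform convergence gives times tending to infinity with arbitrary points s and
  -- parameters q. Nothing is known about these q, which is why the approximating sequences allow
  -- any positive α n.
  choose t ht hbad using fun n : ℕ => hfr (max n (max 1 t₀))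
  have ht1 : ∀ n, 1 ≤ t n := fun n => (le_max_left _ _).trans ((le_max_right _ _).trans (ht n))
  have ht0 : ∀ n, t₀ ≤ t n := fun n => (le_max_right _ _).trans ((le_max_right _ _).trans (ht n))
  have htt : Tendsto t atTop atTop :=
    tendsto_atTop_mono (fun n => (le_max_left _ _).trans (ht n)) tendsto_natCast_atTop_atTop
  simp only [not_forall, not_lt] at hbad
  choose p hp hbad using hbad
  have hq : ∀ n, (p n).2 ∈ Ioo (0 : ℝ) 1 := fun n => (hp n).2
  have hl : ∀ n, 0 < 1 / √(t n) := fun n =>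
    one_div_pos.2 (Real.sqrt_pos.2 (one_pos.trans_le (ht1 n)))
  have hq' : ∀ n, (p n).2 ^ (1 / √(t n)) ∈ Ioo (0 : ℝ) 1 := fun n =>
    ⟨Real.rpow_pos_of_pos (hq n).1 _, Real.rpow_lt_one (hq n).1.le (hq n).2 (hl n)⟩
  have hα : ∀ n, 0 < -Real.log (p n).2 := fun n => neg_log_pos (hq n)
  choose c A B μ hd G using fun n => (hw _ (hq' n)).exists_isGrowth (hq' n) (h0 _ (hq' n))
  -- The solution is taken at parameter α/√t, and rescaling by √t returns it to α, the parameter of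
  -- the limiting diagram.
  have hlog : ∀ n, -Real.log ((p n).2 ^ (1 / √(t n))) = -Real.log (p n).2 / √(t n) := fun n => by
    rw [Real.log_rpow (hq n).1]
    ring
  simp only [hlog] at G
  have H₁ := IsGrowth.isApproxSeq hα htt ht1 ht0 hd G
  have H₂ := isApproxSeq_of_limit_equation (W := fun n s => limDiagram s (p n).2) hα
    (fun n => exists_isDiagramWith_limDiagram (hq n)) (fun n => eventually_trG_limMeasure (hα n))
  obtain ⟨n, hn⟩ := (H₁.asymptotically_eq H₂ hε).exists
  have := hn (p n).1
  rw [← Real.dist_eq, dist_comm] at this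
  exact absurd this (not_lt.2 (hbad n))

end

end QPlancherel

theorem mainTheorem1 :
    ∃ Ω : ℝ → ℝ → ℝ,
      (∀ q ∈ Ioo (0 : ℝ) 1, QPlancherel.IsContinualDiagram (fun s => Ω s q)) ∧
      -- common asymptotics of all solutions, uniform in `s` and `q`
      (∀ (a b t₀ : ℝ) (w : ℝ → ℝ → ℝ → ℝ),
        (∀ q ∈ Ioo (0 : ℝ) 1, QPlancherel.InDiagramSpace a b (fun s => w s t₀ q)) →
        (∀ q ∈ Ioo (0 : ℝ) 1, QPlancherel.SolvesDynamicEquation q t₀ (fun s t => w s t q)) →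
        TendstoUniformlyOn
          (fun (t : ℝ) (p : ℝ × ℝ) =>
            1 / Real.sqrt t * w (p.1 * Real.sqrt t) t (p.2 ^ (1 / Real.sqrt t)))
          (fun p => Ω p.1 p.2) atTop (univ ×ˢ Ioo (0 : ℝ) 1)) ∧
      -- the `q`-deformed `R`-function of the limiting diagram satisfies the equation
      (∀ q ∈ Ioo (0 : ℝ) 1, ∀ a b : ℝ, QPlancherel.InDiagramSpace a b (fun s => Ω s q) →
        ∀ x, x ∉ Icc a b →
          QPlancherel.LimitEquation q x (QPlancherel.qR q (fun s => Ω s q) x)) ∧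
      -- and the limiting diagram is uniquely determined by this equation
      (∀ q ∈ Ioo (0 : ℝ) 1, ∀ (a b : ℝ) (v : ℝ → ℝ), QPlancherel.InDiagramSpace a b v →
        (∀ x, x ∉ Icc a b → QPlancherel.LimitEquation q x (QPlancherel.qR q v x)) →
        ∀ s, v s = Ω s q) ∧
      -- and by its `q`-deformed `R`-function
      (∀ q ∈ Ioo (0 : ℝ) 1, ∀ (a b : ℝ) (v : ℝ → ℝ), QPlancherel.InDiagramSpace a b v →
        QPlancherel.InDiagramSpace a b (fun s => Ω s q) →
        (∀ x, x ∉ Icc a b → QPlancherel.qR q v x = QPlancherel.qR q (fun s => Ω s q) x) →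
        ∀ s, v s = Ω s q) ∧
      -- the `q`-moments of the Rayleigh measure of the limiting diagram
      (∃ y : ℕ → ℝ → ℝ, QPlancherel.SolvesMomentSystem y) ∧
      (∀ q ∈ Ioo (0 : ℝ) 1, ∃ τ : SignedMeasure ℝ,
        QPlancherel.IsRayleighMeasure (fun s => Ω s q) τ ∧
        ∀ y : ℕ → ℝ → ℝ, QPlancherel.SolvesMomentSystem y →
          ∀ n : ℕ, 1 ≤ n → QPlancherel.qMoment q n τ = y n (Real.log q ^ 2)) := by
  refine ⟨QPlancherel.limDiagram, fun q hq => QPlancherel.isContinualDiagram_limDiagram hq,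
    fun a b t₀ w h0 hw => QPlancherel.tendstoUniformlyOn_limDiagram h0 hw,
    fun q hq a b h x hx => QPlancherel.limitEquation_limDiagram hq h hx,
    fun q hq a b v hv h => QPlancherel.eq_limDiagram_of_limitEquation hq hv h,
    fun q hq a b v hv h hR => QPlancherel.eq_limDiagram_of_limitEquation hq hv fun x hx => ?_,
    ⟨_, QPlancherel.solvesMomentSystem_symP⟩, fun q hq => ?_⟩
  · rw [hR x hx]
    exact QPlancherel.limitEquation_limDiagram hq h hx
  · obtain ⟨τ, hτ, hm⟩ := QPlancherel.exists_rayleighMeasure_limDiagram hq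
    refine ⟨τ, hτ, fun y hy n hn => ?_⟩
    rw [hm n]
    exact QPlancherel.solvesMomentSystem_symP.unique hy hn (sq_nonneg _)
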